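/- A mixed graph $G$ on a finite nonempty set $V$ with $|V|=n$ consists of a set $U$ of undirected edges (no loops) and a set $D$ of directed edges; two vertices may be joined both by an undirected and by a directed edge. $G$ is acyclic if it has no directed cycle. A mixed cycle is a cycle (of length at least $3$) in the underlying undirected graph with at least one directed edge (where two vertices are joined by both kinds of edges, the cycle uses one of them); a near cycle is a mixed cycle of length three with exactly one undirected edge. Let $m(G)$ be the minimum number of undirected edges on a mixed cycle of $G$, with $m(G)=n$ if there is no mixed cycle. A (weak) coloring of $G$ is a map $f:V\to\mathbb N$ with $f(u)\ne f(v)$ for $uv\in U$ and $f(u)\le f(v)$ for $(u,v)\in D$; $\chi(G)$ is the least number of colors of a coloring. Let a finite group $\mathfrak G$ act on $G$ by automorphisms. For $\mathfrak g\in\mathfrak G$ let $\chi(G,\mathfrak G,\mathbf x;\mathfrak g)=\sum_f\prod_{v\in V}x_{f(v)}$, summed over the colorings with $f\circ\mathfrak g^{-1}=f$, and let $\chi(G,\mathfrak G,x;\mathfrak g)$ be the polynomial whose value at $k\in\mathbb N$ is the number of such colorings with values in $[k]$. For $S=\{s_1<\dots<s_k\}\subseteq[n-1]$, $s_0=0$,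 $s_{k+1}=n$, let $M_{S,n}=\sum_{i_1<\dots<i_{k+1}}\prod_j x_{i_j}^{s_j-s_{j-1}}$ and $F_{S,n}=\sum_{S\subseteq T\subseteq[n-1]}M_{T,n}$. An effective character is the character of a finite-dimensional complex representation of $\mathfrak G$ (possibly zero), and $\varphi\le_{\mathfrak G}\psi$ means that $\psi-\varphi$ is an effective character. Suppose $G$ is acyclic. Let $P$ be the poset on $V$ given by the reflexive transitive closure of the directed edges, and $\Delta(P)$ the simplicial complex of chains of order ideals of $P$ other than $\emptyset$ and $V$. Let $\Phi(G)\subseteq\Delta(P)$ be the set of chains $I_1\subset\dots\subset I_k$ such that, with $I_0=\emptyset$ and $I_{k+1}=V$, no set $I_{j+1}\setminus I_j$ ($0\le j\le k$) contains an undirected edge, and let $\Gamma(G)=\Delta(P)\setminus\Phi(G)$. For $\ell\ge 0$, $\Phi(G)$ satisfies Serre's condition $(S_\ell)$ over a field $K$ if for all $\sigma\in\Delta(P)$ and all $i\le\min(\dim\operatorname{lk}_{\Phi(G)}(\sigma),\ell-1)$ we have $\widetilde H_{i-1}(\operatorname{lk}_{\Delta(P)}(\sigma),\operatorname{lk}_{\Gamma(G)}(\sigma);K)=0$.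 **Theorem.** Let $G$ be an acyclic mixed graph on $n\ge1$ vertices with no near cycles, let $\mathfrak G$ be a finite group acting on $G$, and put $m=m(G)$, $\chi=\chi(G)$, $d=n-1$. Then $\Phi(G)$ satisfies $(S_m)$ over every field. For every $S\subseteq[n-1]$ with $|S|\le m$, the coefficient $[F_{S,n}]\chi(G,\mathfrak G,\mathbf x)$ is an effective character. Write $$\chi(G,\mathfrak G,x)=\sum_{i=0}^n f_{i-2}\binom xi=\sum_{i=0}^n h_{i-1}\binom{x+n-i}{n},$$ with class functions $f_{-2},\dots,f_{n-2}$ and $h_{-1},\dots,h_{n-1}$ (and $f_i=0$, $h_i=0$ for all other $i$). Then: 1. $h_i\ge_{\mathfrak G}0$ for $i\le m$. 2. For $0\le i\le m$, $\displaystyle\sum_{j=m}^{d}\binom{i+j-m}{i}h_j\ge_{\mathfrak G}0$. If moreover $m\ge\chi$, then: 3. $(d-i)f_{i-1}\le_{\mathfrak G}(i-\chi+2)f_i$ for all $i\ge\chi$. 4. $f_{i-1}\le_{\mathfrak G}f_i$ for $\chi-1\le i\le\lfloor(d+\chi-2)/2\rfloor$. 5. $f_{i-1}\le_{\mathfrak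 G}f_{d+\chi-i-2}$ for $\chi-1\le i\le\lfloor(d+\chi-1)/2\rfloor$. (4 and 5 say that the sequence $(f_{\chi-2},\dots,f_{d-1})$, which is what remains after the initial zeros of the $f$-vector are removed, is strongly flawless with respect to $\le_{\mathfrak G}$.) -/

import Mathlib

noncomputable section

/-! ### Relative simplicial complexes and Serre's condition -/

namespace RelComplex

variable {W : Type*} [DecidableEq W]

/-- The link of `σ` in a family `Φ` of finite sets. -/
def link (Φ : Set (Finset W)) (σ : Finset W) : Set (Finset W) :=
  {τ | Disjoint σ τ ∧ σ ∪ τ ∈ Φ}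

/-- `dim Φ ≥ i`: some face of `Φ` has dimension (cardinality minus one) at least `i`. -/
def DimGE (Φ : Set (Finset W)) (i : ℤ) : Prop :=
  ∃ τ ∈ Φ, i ≤ (τ.card : ℤ) - 1

variable (K : Type*) [Field K] (κ : W → ℕ)

open Classical in
/-- The boundary of a face `σ` in the relative chain complex `C(Δ)/C(Γ)`, where `Φ = Δ \ Γ`:
the alternating sum of the codimension-one faces of `σ`, those outside `Φ` being zero.
The vertices of `σ` are ordered by the coloring `κ`, which is injective on every face of a
balanced complex. -/
def faceBoundary (Φ : Set (Finset W)) (σ : Finset W) : Finset W →₀ K :=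
  ∑ v ∈ σ, if σ.erase v ∈ Φ then
    Finsupp.single (σ.erase v) ((-1 : K) ^ (σ.filter fun w => κ w < κ v).card) else 0

/-- The boundary map of the relative chain complex with basis `Φ`. -/
def boundary (Φ : Set (Finset W)) : (Finset W →₀ K) →ₗ[K] (Finset W →₀ K) :=
  Finsupp.linearCombination K (faceBoundary K κ Φ)

/-- Relative chains spanned by the faces of `Φ` with `i` vertices, that is, of dimension `i - 1`. -/
def chains (Φ : Set (Finset W)) (i : ℕ) : Submodule K (Finset W →₀ K) :=
  Finsupp.supported K K {σ | σ ∈ Φ ∧ σ.card = i}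

/-- Cycles of dimension `i - 1`. -/
def cycles (Φ : Set (Finset W)) (i : ℕ) : Submodule K (Finset W →₀ K) :=
  chains K Φ i ⊓ LinearMap.ker (boundary K κ Φ)

/-- Boundaries of dimension `i - 1`. -/
def boundaries (Φ : Set (Finset W)) (i : ℕ) : Submodule K (Finset W →₀ K) :=
  (chains K Φ (i + 1)).map (boundary K κ Φ)

/-- The reduced relative homology of the pair `(Δ, Γ)` in dimension `i - 1`, with
coefficients in `K`, is zero: every cycle is a boundary. The empty face, of dimension `-1`,
belongs to the chain complex. -/
def ReducedHomologyVanishes (Δ Γ : Set (Finset W)) (i : ℕ) : Prop :=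
  cycles K κ (Δ \ Γ) i ≤ boundaries K κ (Δ \ Γ) i

/-- Serre's condition `(S_ℓ)` over `K` for the relative complex presented by `(Δ, Γ)`:
for every `σ ∈ Δ` and every `i ≤ min (dim (lk σ)) (ℓ - 1)`, the reduced homology of
`(lk_Δ σ, lk_Γ σ)` in dimension `i - 1` vanishes. -/
def SatisfiesSerre (Δ Γ : Set (Finset W)) (ℓ : ℕ) : Prop :=
  ∀ σ ∈ Δ, ∀ i : ℕ, DimGE (link Δ σ \ link Γ σ) i → (i : ℤ) ≤ (ℓ : ℤ) - 1 →
    ReducedHomologyVanishes K κ (link Δ σ) (link Γ σ) i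

end RelComplex

/-! ### Quasisymmetric functions -/

namespace QSymFun

/-- For `S = {s₁ < ⋯ < s_k} ⊆ [n-1]`, the sequence `s₀ = 0, s₁, …, s_k, s_{k+1} = n`. -/
def cut (n : ℕ) (S : Finset ℕ) (j : ℕ) : ℕ :=
  Nat.nth (fun x => x ∈ insert 0 (insert n S)) j

/-- The monomial quasisymmetric function `M_{S,n}`, the sum of
`x_{i_1}^{s_1 - s_0} ⋯ x_{i_{k+1}}^{s_{k+1} - s_k}` over all `i_1 < ⋯ < i_{k+1}`: the coefficient
of a monomial is the number of index sequences that produce it. -/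
def monomialQ (n : ℕ) (S : Finset ℕ) : MvPowerSeries ℕ ℂ := fun μ =>
  (Nat.card {i : Fin (S.card + 1) → ℕ // StrictMono i ∧
    ∑ j, Finsupp.single (i j) (cut n S (j + 1) - cut n S j) = μ} : ℂ)

/-- The fundamental quasisymmetric function `F_{S,n} = ∑_{S ⊆ T ⊆ [n-1]} M_{T,n}`. -/
def fundamentalQ (n : ℕ) (S : Finset ℕ) : MvPowerSeries ℕ ℂ :=
  ∑ T ∈ (Finset.Icc 1 (n - 1)).powerset with S ⊆ T, monomialQ n T

end QSymFun

/-- A complex valued function on a group is an effective character if it is the character of a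
finite-dimensional complex representation (possibly zero). -/
def IsEffectiveCharacter {H : Type*} [Group H] (φ : H → ℂ) : Prop :=
  ∃ (k : ℕ) (ρ : Representation ℂ H (Fin k → ℂ)), φ = ρ.character

/-- `φ ≤ ψ` in the effective order: `ψ - φ` is an effective character. -/
def EffLE {H : Type*} [Group H] (φ ψ : H → ℂ) : Prop :=
  IsEffectiveCharacter (ψ - φ)

/-! ### Mixed graphs -/

/-- A mixed graph: undirected edges and directed edges on the vertex set `V`. -/
structure MixedGraph (V : Type*) where
  /-- the undirected edges -/
  und : SimpleGraph V
  /-- the directed edges -/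
  dir : Digraph V

namespace MixedGraph

variable {V : Type*} (G : MixedGraph V)

/-- No directed cycles. -/
def IsAcyclic : Prop := ∀ v, ¬ Relation.TransGen G.dir.Adj v v

/-- The underlying undirected graph. -/
def underlying : SimpleGraph V := G.und ⊔ SimpleGraph.fromRel G.dir.Adj

/-- A mixed cycle: a cycle of the underlying graph with at least one directed edge. Two vertices
may be joined both by an undirected and by a directed edge, so the cycle records the set
`directed` of those of its edges that it takes from the directed edges; the others are taken
from the undirected edges. -/
structure MixedCycle where
  /-- the starting point -/
  base : V
  /-- the closed walk -/
  walk : G.underlying.Walk base base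
  isCycle : walk.IsCycle
  /-- the edges that are taken from the directed edges -/
  directed : Set (Sym2 V)
  directed_subset : ∀ e ∈ directed, e ∈ walk.edges
  directed_adj : ∀ e ∈ directed, ∃ u v, G.dir.Adj u v ∧ e = s(u, v)
  directed_nonempty : directed.Nonempty
  undirected_adj : ∀ e ∈ walk.edges, e ∉ directed → e ∈ G.und.edgeSet

/-- The number of undirected edges on a mixed cycle. -/
def MixedCycle.numUndirected {G : MixedGraph V} (c : G.MixedCycle) : ℕ :=
  Set.ncard {e | e ∈ c.walk.edges ∧ e ∉ c.directed}

/-- A near cycle: a mixed cycle of length three with exactly one undirected edge. -/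
def MixedCycle.IsNear {G : MixedGraph V} (c : G.MixedCycle) : Prop :=
  c.walk.length = 3 ∧ c.numUndirected = 1

open Classical in
/-- `m(G)`: the minimum number of undirected edges on a mixed cycle, and the number of vertices
if there is no mixed cycle. -/
def minUndirected [Fintype V] : ℕ :=
  if Nonempty G.MixedCycle then sInf (Set.range fun c : G.MixedCycle => c.numUndirected)
  else Fintype.card V

/-- Weak colorings of a mixed graph. -/
def IsColoring (f : V → ℕ) : Prop :=
  (∀ u v, G.und.Adj u v → f u ≠ f v) ∧ (∀ u v, G.dir.Adj u v → f u ≤ f v)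

/-- The chromatic number `χ(G)`: the least number of colors of a weak coloring. -/
def chromaticNumber : ℕ := sInf {k | ∃ f : V → ℕ, G.IsColoring f ∧ ∀ v, f v < k}

/-- The action of `H` on the vertices is an action by automorphisms of `G`. -/
def IsActedOnBy (H : Type*) [Group H] [MulAction H V] : Prop :=
  ∀ (g : H) (u v : V), (G.und.Adj (g • u) (g • v) ↔ G.und.Adj u v) ∧
    (G.dir.Adj (g • u) (g • v) ↔ G.dir.Adj u v)

section ClassFunctions

variable {H : Type*} [Group H] [MulAction H V]

/-- Weak colorings `f` that are fixed by `g`, where `g f = f ∘ g⁻¹`. -/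
def IsFixedColoring (g : H) (f : V → ℕ) : Prop :=
  G.IsColoring f ∧ ∀ v, f (g⁻¹ • v) = f v

/-- The chromatic quasisymmetric class function `χ(G, H, x; g)`, the sum over all weak colorings
`f` fixed by `g` of `∏_v x_{f v}`: the coefficient of a monomial is the number of colorings that
produce it. -/
def chromaticQ [Fintype V] (g : H) : MvPowerSeries ℕ ℂ := fun μ =>
  (Nat.card {f : V → ℕ // G.IsFixedColoring g f ∧ ∑ v, Finsupp.single (f v) 1 = μ} : ℂ)

/-- The chromatic polynomial class function `χ(G, H, k; g)` at a natural number `k`: the number of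
weak colorings with `k` colors that are fixed by `g`. -/
def chromaticP (k : ℕ) (g : H) : ℂ :=
  (Nat.card {f : V → ℕ // G.IsFixedColoring g f ∧ ∀ v, f v < k} : ℂ)

end ClassFunctions

/-- Order ideals of the poset `P`, the reflexive and transitive closure of the directed edges
(`u ≤ v` if there is a directed path from `u` to `v`). -/
def IsIdeal (I : Finset V) : Prop :=
  ∀ u v, Relation.ReflTransGen G.dir.Adj u v → v ∈ I → u ∈ I

/-- `(I, J)` is stable: there is no undirected edge inside `J \ I`. -/
def IsStable (I J : Finset V) : Prop :=
  ∀ u v, u ∈ J → u ∉ I → v ∈ J → v ∉ I → ¬ G.und.Adj u v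

/-- The order complex `Δ(P)`: chains of order ideals different from `∅` and `V`. -/
def orderComplex [Fintype V] : Set (Finset (Finset V)) :=
  {σ | (∀ I ∈ σ, G.IsIdeal I ∧ I ≠ ∅ ∧ I ≠ Finset.univ) ∧
    IsChain (· ⊆ ·) (σ : Set (Finset V))}

/-- The coloring complex `Φ(G)`: chains `I_1 ⊂ ⋯ ⊂ I_k` in `Δ(P)` such that `(I_j, I_{j+1})` is
stable for `0 ≤ j ≤ k`, where `I_0 = ∅` and `I_{k+1} = V`. -/
def coloringComplex [Fintype V] : Set (Finset (Finset V)) :=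
  {σ | σ ∈ G.orderComplex ∧
    ∀ I ∈ (σ : Set (Finset V)) ∪ {∅, Finset.univ}, ∀ J ∈ (σ : Set (Finset V)) ∪ {∅, Finset.univ},
      I ⊂ J → (¬ ∃ L ∈ σ, I ⊂ L ∧ L ⊂ J) → G.IsStable I J}

/-- `Φ(G)` satisfies `(S_ℓ)` over `K`, with respect to the presentation `(Δ(P), Δ(P) \ Φ(G))` and
the coloring `I ↦ |I|`. -/
def ColoringComplexSatisfiesSerre [Fintype V] [DecidableEq V] (K : Type*) [Field K] (ℓ : ℕ) :
    Prop :=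
  RelComplex.SatisfiesSerre K Finset.card G.orderComplex (G.orderComplex \ G.coloringComplex) ℓ

end MixedGraph

end

/-! ### Relative chain complexes and their long exact sequences -/

noncomputable section

set_option linter.unusedSectionVars false

namespace RelComplex

open Finset

variable {W : Type*} [DecidableEq W] [Fintype W] {K : Type*} [Field K] {κ : W → ℕ}
  {Φ Ψ Θ : Set (Finset W)}

/-! Sort colorings by the chain of their proper sublevel sets. The chains that occur are exactly the
faces of Φ(G), and the colorings over a face are the strictly increasing labellings of its blocks
(`card_fixedColorings`). So both chromatic functions are determined by the numbers `flagCount S g`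
of g-fixed faces with rank set S, and the Möbius inverse β(S) = `flagCoeff S` is the coefficient of
F_S. The numerical claims ask which combinations of the β(S) are effective.

Topology answers with a single statement, `intervalPositive_flagCoeff`: the sum of β over an
interval [T, T ∪ R] is effective when |T| ≤ m. By inclusion–exclusion this sum is the alternating
face count of the faces whose rank set lies between R and T ∪ R. By the Hopf trace formula it is the
character on the top cycles once the lower homology vanishes (`isEffectiveCharacter_alternating`).

For the vanishing, a chain of order ideals is a face of Φ(G) iff every undirected edge is separated
by one of its members (`coloringComplex_eq`). Without edges, the complex of a preorder with c
classes and all its stars have no homology below c - 1 vertices: split along an incomparable pair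
and use Mayer–Vietoris (`vanishes_star_preorder`). Edges are then imposed one by one: the chains
separating e are all chains modulo those of the preorder with e contracted
(`vanishes_star_idealChains`). This works as long as contracting a set F of edges loses at most |F|
classes. If |F| < m it does: an arc on a closed walk through arcs and F would otherwise close to a
mixed cycle with at most |F| undirected edges, so its ends are already joined by F
(`connected_of_adj_of_reflTransGen`). Passing from stars to links gives Serre's condition; exact
sequences that remove ranks one at a time give `vanishes_rankInterval`.

The rest is combinatorics of `IntervalPositive`. Item 1 is the case of one-element intervals. Items
2 and 3 follow by cutting a weighted Boolean lattice into intervals (`sum_choose_mem`), items 4 and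
5 by matching a-sets with b-sets containing them (`sum_sub_sum_mem`), with β(S) = 0 for |S| < χ - 1.
-/

/-- A relative complex on which `κ` is a proper coloring: an order-convex family of faces. -/
structure IsRelative (κ : W → ℕ) (Φ : Set (Finset W)) : Prop where
  injOn : ∀ σ ∈ Φ, ∀ v ∈ σ, ∀ w ∈ σ, κ v = κ w → v = w
  convex : ∀ ρ ∈ Φ, ∀ σ ∈ Φ, ∀ τ, ρ ⊆ τ → τ ⊆ σ → τ ∈ Φ

/-- `Θ` is closed under taking those faces that lie in `Φ`. -/
structure IsSubfamily (Θ Φ : Set (Finset W)) : Prop where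
  subset : Θ ⊆ Φ
  lower : ∀ σ ∈ Θ, ∀ τ ∈ Φ, τ ⊆ σ → τ ∈ Θ

/-- Every cycle with `i` vertices per face is a boundary. -/
def Vanishes (K : Type*) [Field K] (κ : W → ℕ) (Φ : Set (Finset W)) (i : ℕ) : Prop :=
  cycles K κ Φ i ≤ boundaries K κ Φ i

open Classical in
-- The coefficient at τ collects the cofaces `insert w τ`. The sign may be counted in τ instead of
-- `insert w τ`, as w is not below itself. All later identities are checked coefficientwise in this
-- form.
theorem boundary_apply (Φ : Set (Finset W)) (x : Finset W →₀ K) (τ : Finset W) :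
    boundary K κ Φ x τ = if τ ∈ Φ then
      ∑ w, if w ∈ τ then 0 else (-1) ^ #{u ∈ τ | κ u < κ w} * x (insert w τ) else 0 := by
  induction x using Finsupp.induction_linear with
  | zero => simp
  | add x y hx hy =>
    rw [map_add, Finsupp.add_apply, hx, hy]
    split_ifs with h
    · rw [← sum_add_distrib]
      refine sum_congr rfl fun w _ => ?_
      split_ifs <;> simp [mul_add]
    · simp
  | single σ c =>
    have h1 : boundary K κ Φ (Finsupp.single σ c) τ
        = ∑ w, if w ∈ σ then (if σ.erase w ∈ Φ then
          (Finsupp.single (σ.erase w) (c * (-1 : K) ^ #{u ∈ σ | κ u < κ w})) τ else 0) else 0 := by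
      rw [boundary, Finsupp.linearCombination_single, faceBoundary, smul_sum,
        Finsupp.finsetSum_apply, ← sum_filter, filter_univ_mem]
      refine sum_congr rfl fun w _ => ?_
      split_ifs <;> simp
    rw [h1]
    have key : ∀ w, (w ∈ σ ∧ σ.erase w = τ) ↔ (w ∉ τ ∧ insert w τ = σ) := by
      intro w
      constructor
      · rintro ⟨h, rfl⟩; exact ⟨by simp, insert_erase h⟩
      · rintro ⟨h, rfl⟩; exact ⟨by simp, erase_insert h⟩
    by_cases hτ : τ ∈ Φ
    · rw [if_pos hτ]
      refine sum_congr rfl fun w _ => ?_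
      by_cases h : w ∈ σ ∧ σ.erase w = τ
      · obtain ⟨h3, h4⟩ := (key w).1 h
        rw [if_pos h.1, h.2, if_pos hτ, if_neg h3, h4]
        have : filter (fun u => κ u < κ w) σ = filter (fun u => κ u < κ w) τ := by
          rw [← h4, filter_insert]; simp
        simp [this, mul_comm]
      · have h' := fun h'' => h ((key w).2 h'')
        have e1 : (if w ∈ σ then (if σ.erase w ∈ Φ then (Finsupp.single (σ.erase w)
            (c * (-1 : K) ^ #{u ∈ σ | κ u < κ w})) τ else 0) else 0) = 0 := by
          split_ifs with h5 h6
          · exact Finsupp.single_eq_of_ne (fun h7 => h ⟨h5, h7.symm⟩)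
          · rfl
          · rfl
        rw [e1]
        split_ifs with h5
        · rfl
        · rw [Finsupp.single_eq_of_ne (fun h7 => h' ⟨h5, h7⟩), mul_zero]
    · rw [if_neg hτ]
      refine sum_eq_zero fun w _ => ?_
      split_ifs with h5 h6
      · exact Finsupp.single_eq_of_ne (fun h7 => hτ (h7 ▸ h6))
      · rfl
      · rfl

theorem mem_chains {x : Finset W →₀ K} {i : ℕ} :
    x ∈ chains K Φ i ↔ ∀ τ, x τ ≠ 0 → τ ∈ Φ ∧ #τ = i := by
  rw [chains, Finsupp.mem_supported']
  constructor
  · intro h τ hτ; by_contra h'; exact hτ (h τ h')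
  · intro h τ hτ; by_contra h'; exact hτ (h τ h')

theorem chains_mono (h : Θ ⊆ Φ) (i : ℕ) : chains K Θ i ≤ chains K Φ i :=
  Finsupp.supported_mono fun _ hσ => ⟨h hσ.1, hσ.2⟩

theorem boundary_mem_chains {x : Finset W →₀ K} {i : ℕ} (hx : x ∈ chains K Φ (i + 1)) :
    boundary K κ Φ x ∈ chains K Φ i := by
  rw [mem_chains] at hx ⊢
  intro τ hτ
  rw [boundary_apply] at hτ
  split_ifs at hτ with h
  · obtain ⟨w, -, hw⟩ := exists_ne_zero_of_sum_ne_zero hτ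
    split_ifs at hw with h'
    · exact absurd rfl hw
    · have := (hx _ (right_ne_zero_of_mul hw)).2
      rw [card_insert_of_notMem h'] at this
      exact ⟨h, by omega⟩
  · exact absurd rfl hτ

theorem boundary_chains_zero {x : Finset W →₀ K} (hx : x ∈ chains K Φ 0) :
    boundary K κ Φ x = 0 := by
  rw [mem_chains] at hx
  ext τ
  rw [boundary_apply]
  split_ifs with h
  · refine sum_eq_zero fun w _ => ?_
    split_ifs with h'
    · rfl
    · have : x (insert w τ) = 0 := by
        by_contra h3
        have := (hx _ h3).2
        simp at this
      rw [this, mul_zero]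
  · rfl

/-- Terms are indexed by the ordered pairs of vertices added to τ, and swapping a pair changes the
sign: κ distinguishes the two vertices, so exactly one of the two counts shifts by one. Convexity
puts both intermediate faces in Φ, so no term lacks its partner. -/
theorem boundary_boundary (hΦ : IsRelative κ Φ) {x : Finset W →₀ K} {i : ℕ}
    (hx : x ∈ chains K Φ i) : boundary K κ Φ (boundary K κ Φ x) = 0 := by
  classical
  rw [mem_chains] at hx
  ext τ
  rw [boundary_apply]
  split_ifs with hτ
  swap
  · rfl
  simp only [boundary_apply, Finsupp.coe_zero, Pi.zero_apply]
  let F : W × W → K := fun p => if p.1 ∈ τ then 0 else if insert p.1 τ ∈ Φ then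
    (if p.2 ∈ insert p.1 τ then 0 else (-1) ^ #{u ∈ τ | κ u < κ p.1} *
      ((-1) ^ #{u ∈ insert p.1 τ | κ u < κ p.2} * x (insert p.2 (insert p.1 τ)))) else 0
  have h1 : (∑ w, if w ∈ τ then 0 else (-1 : K) ^ #{u ∈ τ | κ u < κ w} *
      (if insert w τ ∈ Φ then ∑ w', (if w' ∈ insert w τ then 0 else
        (-1) ^ #{u ∈ insert w τ | κ u < κ w'} * x (insert w' (insert w τ))) else 0))
      = ∑ p, F p := by
    rw [Fintype.sum_prod_type]
    refine sum_congr rfl fun w _ => ?_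
    simp only [F]
    split_ifs with h2 h3
    · simp
    · rw [mul_sum]
      refine sum_congr rfl fun w' _ => ?_
      split_ifs <;> simp
    · simp
  rw [h1]
  have main : ∀ p : W × W, F p ≠ 0 → p.1 ∉ τ ∧ p.2 ∉ τ ∧ p.1 ≠ p.2 ∧
      insert p.2 (insert p.1 τ) ∈ Φ := by
    intro p hp
    simp only [F] at hp
    split_ifs at hp with h2 h3 h4 <;> try exact absurd rfl hp
    have := (hx _ (right_ne_zero_of_mul (right_ne_zero_of_mul hp))).1
    rw [mem_insert, not_or] at h4
    exact ⟨h2, h4.2, fun h => h4.1 h.symm, this⟩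
  refine sum_involution (fun p _ => (p.2, p.1)) ?_ ?_ (by simp) (by simp)
  · rintro ⟨v, w⟩ -
    by_cases hF : v ∉ τ ∧ w ∉ τ ∧ v ≠ w ∧ insert w (insert v τ) ∈ Φ
    · obtain ⟨hv, hw, hvw, hΦ'⟩ := hF
      have e1 : insert v τ ∈ Φ := hΦ.convex _ hτ _ hΦ' _ (subset_insert _ _) (subset_insert _ _)
      have e2 : insert w τ ∈ Φ := hΦ.convex _ hτ _ hΦ' _ (subset_insert _ _)
        (insert_subset_insert _ (subset_insert _ _))
      have hk : κ v ≠ κ w := fun h => hvw (hΦ.injOn _ hΦ' v (by simp) w (by simp) h)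
      have hcomm : insert v (insert w τ) = insert w (insert v τ) := insert_comm _ _ _
      simp only [F, hv, hw, e1, e2, hcomm, mem_insert, hvw, hvw.symm, or_self, if_false, if_true,
        filter_insert]
      rcases lt_or_gt_of_ne hk with h | h
      · rw [if_pos h, if_neg h.le.not_gt, card_insert_of_notMem (by simp [hv])]
        ring
      · rw [if_pos h, if_neg h.le.not_gt, card_insert_of_notMem (by simp [hw])]
        ring
    · have a1 : F (v, w) = 0 := by
        by_contra h; exact hF (main _ h)
      have a2 : F (w, v) = 0 := by
        by_contra h
        obtain ⟨b1, b2, b3, b4⟩ := main _ h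
        exact hF ⟨b2, b1, b3.symm, by rw [insert_comm]; exact b4⟩
      rw [a1, a2, add_zero]
  · rintro ⟨v, w⟩ - hF h
    exact (main _ hF).2.2.1 (congrArg Prod.fst h).symm

/-- The chains on Θ form a subcomplex of those on Φ. The quotient complex is the one on `Φ \ Θ`,
which gives the exact sequences below. -/
theorem boundary_eq_of_isSubfamily (h : IsSubfamily Θ Φ) {x : Finset W →₀ K} {i : ℕ}
    (hx : x ∈ chains K Θ i) : boundary K κ Φ x = boundary K κ Θ x := by
  rw [mem_chains] at hx
  ext τ
  rw [boundary_apply, boundary_apply]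
  by_cases h1 : τ ∈ Θ
  · rw [if_pos h1, if_pos (h.subset h1)]
  · rw [if_neg h1]
    split_ifs with h2
    · refine sum_eq_zero fun w _ => ?_
      split_ifs
      · rfl
      · have : x (insert w τ) = 0 := by
          by_contra h3
          exact h1 (h.lower _ (hx _ h3).1 _ h2 (subset_insert _ _))
        rw [this, mul_zero]
    · rfl

open Classical in
/-- The part of a chain that lies on the faces in `Φ`. -/
def part (Φ : Set (Finset W)) (x : Finset W →₀ K) : Finset W →₀ K := x.filter (· ∈ Φ)

open Classical in
theorem part_apply (x : Finset W →₀ K) (τ : Finset W) :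
    part Φ x τ = if τ ∈ Φ then x τ else 0 := Finsupp.filter_apply _ _ _

theorem part_sub (x y : Finset W →₀ K) : part Φ (x - y) = part Φ x - part Φ y := by
  ext τ; simp only [part_apply, Finsupp.sub_apply]; split_ifs <;> simp

theorem part_zero : part Φ (0 : Finset W →₀ K) = 0 := by
  ext τ; simp only [part_apply]; split_ifs <;> simp

theorem part_mem_chains {x : Finset W →₀ K} {i : ℕ} (hx : x ∈ chains K Φ i) :
    part Ψ x ∈ chains K Ψ i := by
  rw [mem_chains] at hx ⊢
  intro τ hτ
  rw [part_apply] at hτ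
  split_ifs at hτ with h'
  · exact ⟨h', (hx _ hτ).2⟩
  · exact absurd rfl hτ

theorem part_of_mem_chains {x : Finset W →₀ K} {i : ℕ} (hx : x ∈ chains K Φ i) :
    part Φ x = x := by
  rw [mem_chains] at hx
  ext τ
  rw [part_apply]
  split_ifs with h
  · rfl
  · by_contra h'; exact h (hx _ (Ne.symm h')).1

theorem part_diff_of_mem_chains {x : Finset W →₀ K} {i : ℕ} (hx : x ∈ chains K Θ i) :
    part (Φ \ Θ) x = 0 := by
  rw [mem_chains] at hx
  ext τ
  rw [part_apply]
  split_ifs with h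
  · by_contra h'; exact h.2 (hx _ h').1
  · rfl

/-- Faces outside Ψ count as zero in the boundary for Ψ, so it is the boundary for Φ followed by
truncation. The diagram chases below project to the quotient in this way. -/
theorem part_boundary (h : Ψ ⊆ Φ) (x : Finset W →₀ K) :
    part Ψ (boundary K κ Φ x) = boundary K κ Ψ x := by
  ext τ
  rw [part_apply, boundary_apply, boundary_apply]
  split_ifs with h1 h2
  · rfl
  · exact absurd (h h1) h2
  · rfl

theorem mem_chains_sub_of_part_eq_zero {x : Finset W →₀ K} {i : ℕ} (hx : x ∈ chains K Φ i)
    (h : part (Φ \ Θ) x = 0) : x ∈ chains K Θ i := by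
  rw [mem_chains] at hx ⊢
  intro τ hτ
  refine ⟨?_, (hx τ hτ).2⟩
  by_contra h'
  have := DFunLike.congr_fun h τ
  rw [part_apply, if_pos ⟨(hx τ hτ).1, h'⟩] at this
  exact hτ this

theorem part_add_part_diff {x : Finset W →₀ K} {i : ℕ} (hx : x ∈ chains K Φ i) :
    part Θ x + part (Φ \ Θ) x = x := by
  rw [mem_chains] at hx
  ext τ
  rw [Finsupp.add_apply, part_apply, part_apply]
  by_cases h1 : τ ∈ Θ
  · simp [h1]
  · by_cases h2 : τ ∈ Φ
    · simp [h1, h2]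
    · have : x τ = 0 := by
        by_contra h3; exact h2 (hx _ h3).1
      simp [this]

theorem vanishes_iff {i : ℕ} : Vanishes K κ Φ i ↔ ∀ z ∈ chains K Φ i, boundary K κ Φ z = 0 →
    ∃ w ∈ chains K Φ (i + 1), boundary K κ Φ w = z := by
  constructor
  · intro h z hz hz'
    exact Submodule.mem_map.1 (h ⟨hz, hz'⟩)
  · rintro h z ⟨hz, hz'⟩
    exact Submodule.mem_map.2 (h z hz hz')

theorem IsRelative.mono (hΦ : IsRelative κ Φ) (h : IsSubfamily Θ Φ) : IsRelative κ Θ where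
  injOn σ hσ := hΦ.injOn σ (h.subset hσ)
  convex ρ hρ σ hσ τ h1 h2 :=
    h.lower σ hσ τ (hΦ.convex ρ (h.subset hρ) σ (h.subset hσ) τ h1 h2) h2

/-- Vanishing for the quotient in the long exact sequence of `Θ ⊆ Φ`. -/
theorem Vanishes.quotient (hΦ : IsRelative κ Φ) (h : IsSubfamily Θ Φ) {i : ℕ}
    (h1 : Vanishes K κ Φ i) (h2 : ∀ j, j + 1 = i → Vanishes K κ Θ j) :
    Vanishes K κ (Φ \ Θ) i := by
  rw [vanishes_iff] at h1 ⊢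
  intro z hz hz'
  have hzΦ := chains_mono (K := K) (Set.sdiff_subset (s := Φ) (t := Θ)) i hz
  -- The connecting map: the boundary of z in Φ is a cycle of Θ one degree lower, hence a boundary
  -- there. In degree zero it is zero and nothing is required of Θ.
  obtain ⟨y, hy, hy'⟩ : ∃ y ∈ chains K Θ i, boundary K κ Θ y = boundary K κ Φ z := by
    cases i with
    | zero =>
      exact ⟨0, Submodule.zero_mem _, by rw [map_zero, boundary_chains_zero hzΦ]⟩
    | succ j =>
      have hu : boundary K κ Φ z ∈ chains K Θ j :=
        mem_chains_sub_of_part_eq_zero (boundary_mem_chains hzΦ)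
          (by rw [part_boundary Set.sdiff_subset, hz'])
      refine vanishes_iff.1 (h2 j rfl) _ hu ?_
      rw [← boundary_eq_of_isSubfamily h hu, boundary_boundary hΦ hzΦ]
  obtain ⟨w, hw, hw'⟩ := h1 (z - y) (Submodule.sub_mem _ hzΦ (chains_mono h.subset i hy))
    (by rw [map_sub, boundary_eq_of_isSubfamily h hy, hy', sub_self])
  refine ⟨part (Φ \ Θ) w, part_mem_chains hw, ?_⟩
  have h3 := congrArg (part (Φ \ Θ)) hw'
  rw [part_sub, part_of_mem_chains hz, part_diff_of_mem_chains hy, sub_zero,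
    part_boundary Set.sdiff_subset] at h3
  have hwΘ : part Θ w ∈ chains K Θ (i + 1) := part_mem_chains hw
  have h4 : boundary K κ (Φ \ Θ) (part Θ w) = 0 := by
    rw [← part_boundary (Set.sdiff_subset (s := Φ) (t := Θ)), boundary_eq_of_isSubfamily h hwΘ]
    exact part_diff_of_mem_chains (boundary_mem_chains hwΘ)
  rw [← h3]
  conv_rhs => rw [← part_add_part_diff hw, map_add, h4, zero_add]

/-- Vanishing for the middle term in the long exact sequence of `Θ ⊆ Φ`. -/
theorem Vanishes.extension (hΦ : IsRelative κ Φ) (h : IsSubfamily Θ Φ) {i : ℕ}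
    (h1 : Vanishes K κ Θ i) (h2 : Vanishes K κ (Φ \ Θ) i) : Vanishes K κ Φ i := by
  rw [vanishes_iff] at h1 h2 ⊢
  intro z hz hz'
  have hzΘ : part Θ z ∈ chains K Θ i := part_mem_chains hz
  have hdiff : Φ \ Θ ⊆ Φ := Set.sdiff_subset
  have h4 : boundary K κ (Φ \ Θ) (part Θ z) = 0 := by
    rw [← part_boundary hdiff, boundary_eq_of_isSubfamily h hzΘ]
    cases i with
    | zero => rw [boundary_chains_zero hzΘ, part_zero]
    | succ j => exact part_diff_of_mem_chains (boundary_mem_chains hzΘ)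
  obtain ⟨w, hw, hw'⟩ := h2 (part (Φ \ Θ) z) (part_mem_chains hz) (by
    have : boundary K κ (Φ \ Θ) z = 0 := by rw [← part_boundary hdiff, hz', part_zero]
    rwa [← part_add_part_diff hz, map_add, h4, zero_add] at this)
  have hwΦ := chains_mono hdiff _ hw
  have hsub : z - boundary K κ Φ w ∈ chains K Θ i :=
    mem_chains_sub_of_part_eq_zero (Submodule.sub_mem _ hz (boundary_mem_chains hwΦ))
      (by rw [part_sub, part_boundary hdiff, hw', sub_self])
  obtain ⟨y, hy, hy'⟩ := h1 _ hsub (by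
    rw [← boundary_eq_of_isSubfamily h hsub, map_sub, hz', boundary_boundary hΦ hwΦ, sub_zero])
  refine ⟨w + y, Submodule.add_mem _ hwΦ (chains_mono h.subset _ hy), ?_⟩
  rw [map_add, boundary_eq_of_isSubfamily h hy, hy']
  abel

/-- Vanishing for the first term in the long exact sequence of `Θ ⊆ Φ`. -/
theorem Vanishes.subfamily (hΦ : IsRelative κ Φ) (h : IsSubfamily Θ Φ) {i : ℕ}
    (h1 : Vanishes K κ Φ i) (h2 : Vanishes K κ (Φ \ Θ) (i + 1)) : Vanishes K κ Θ i := by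
  rw [vanishes_iff] at h1 h2 ⊢
  intro z hz hz'
  have hdiff : Φ \ Θ ⊆ Φ := Set.sdiff_subset
  obtain ⟨w, hw, hw'⟩ := h1 z (chains_mono h.subset _ hz)
    (by rw [boundary_eq_of_isSubfamily h hz, hz'])
  have hwΘ : part Θ w ∈ chains K Θ (i + 1) := part_mem_chains hw
  have h4 : boundary K κ (Φ \ Θ) (part Θ w) = 0 := by
    rw [← part_boundary hdiff, boundary_eq_of_isSubfamily h hwΘ]
    exact part_diff_of_mem_chains (boundary_mem_chains hwΘ)
  obtain ⟨y, hy, hy'⟩ := h2 (part (Φ \ Θ) w) (part_mem_chains hw) (by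
    have : boundary K κ (Φ \ Θ) w = 0 := by
      rw [← part_boundary hdiff, hw', part_diff_of_mem_chains hz]
    rwa [← part_add_part_diff hw, map_add, h4, zero_add] at this)
  have hyΦ := chains_mono hdiff _ hy
  have hsub : w - boundary K κ Φ y ∈ chains K Θ (i + 1) :=
    mem_chains_sub_of_part_eq_zero (Submodule.sub_mem _ hw (boundary_mem_chains hyΦ))
      (by rw [part_sub, part_boundary hdiff, hy', sub_self])
  refine ⟨_, hsub, ?_⟩
  rw [← boundary_eq_of_isSubfamily h hsub, map_sub, boundary_boundary hΦ hyΦ, hw', sub_zero]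

/-- Mayer–Vietoris. -/
theorem Vanishes.union {Φ₁ Φ₂ : Set (Finset W)} (hΦ : IsRelative κ (Φ₁ ∪ Φ₂))
    (h₁ : IsSubfamily Φ₁ (Φ₁ ∪ Φ₂)) (h₂ : IsSubfamily Φ₂ (Φ₁ ∪ Φ₂)) {i : ℕ}
    (v₁ : Vanishes K κ Φ₁ i) (v₂ : Vanishes K κ Φ₂ i)
    (v : ∀ j, j + 1 = i → Vanishes K κ (Φ₁ ∩ Φ₂) j) : Vanishes K κ (Φ₁ ∪ Φ₂) i := by
  refine Vanishes.extension hΦ h₁ v₁ ?_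
  -- Excision, which turns Mayer–Vietoris into an extension followed by a quotient.
  have e : (Φ₁ ∪ Φ₂) \ Φ₁ = Φ₂ \ (Φ₁ ∩ Φ₂) := by ext; simp
  rw [e]
  exact Vanishes.quotient (hΦ.mono h₂) ⟨Set.inter_subset_right, fun σ hσ τ hτ hle =>
    ⟨h₁.lower σ hσ.1 τ (Or.inr hτ) hle, hτ⟩⟩ v₂ v

theorem vanishes_empty (i : ℕ) : Vanishes K κ (∅ : Set (Finset W)) i := by
  rw [vanishes_iff]
  intro z hz _
  refine ⟨0, Submodule.zero_mem _, ?_⟩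
  rw [mem_chains] at hz
  rw [map_zero]
  ext τ
  by_contra h
  exact (hz τ (Ne.symm h)).1

/-- A disjoint union of families without face relations between them. -/
theorem vanishes_biUnion {ι : Type*} (s : Finset ι) (Ψ : ι → Set (Finset W))
    (hrel : ∀ a ∈ s, IsRelative κ (Ψ a))
    (hsep : ∀ a ∈ s, ∀ b ∈ s, ∀ σ ∈ Ψ a, ∀ τ ∈ Ψ b, τ ⊆ σ → a = b) {i : ℕ}
    (hv : ∀ a ∈ s, Vanishes K κ (Ψ a) i) : Vanishes K κ (⋃ a ∈ s, Ψ a) i := by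
  classical
  induction s using Finset.induction_on with
  | empty => simpa using vanishes_empty i
  | insert a s ha ih =>
    have hrel' : IsRelative κ (⋃ b ∈ insert a s, Ψ b) := by
      constructor
      · intro σ hσ
        simp only [Set.mem_iUnion] at hσ
        obtain ⟨b, hb, hσ⟩ := hσ
        exact (hrel b hb).injOn σ hσ
      · intro ρ hρ σ hσ τ h1 h2
        simp only [Set.mem_iUnion] at hρ hσ ⊢
        obtain ⟨b, hb, hρ⟩ := hρ
        obtain ⟨c, hc, hσ⟩ := hσ
        obtain rfl := hsep c hc b hb σ hσ ρ hρ (h1.trans h2)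
        exact ⟨c, hc, (hrel c hc).convex ρ hρ σ hσ τ h1 h2⟩
    refine Vanishes.extension hrel' (Θ := ⋃ b ∈ s, Ψ b) ⟨?_, ?_⟩
      (ih (fun b hb => hrel b (mem_insert_of_mem hb)) (fun b hb c hc =>
        hsep b (mem_insert_of_mem hb) c (mem_insert_of_mem hc))
        (fun b hb => hv b (mem_insert_of_mem hb))) ?_
    · exact Set.biUnion_subset_biUnion_left fun b hb => mem_insert_of_mem hb
    · intro σ hσ τ hτ hle
      simp only [Set.mem_iUnion] at hσ hτ ⊢
      obtain ⟨b, hb, hσ⟩ := hσ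
      obtain ⟨c, hc, hτ⟩ := hτ
      obtain rfl := hsep b (mem_insert_of_mem hb) c hc σ hσ τ hτ hle
      exact ⟨b, hb, hτ⟩
    · have : (⋃ b ∈ insert a s, Ψ b) \ (⋃ b ∈ s, Ψ b) = Ψ a := by
        ext σ
        simp only [Set.mem_sdiff, Set.mem_iUnion, mem_insert]
        constructor
        · rintro ⟨⟨b, rfl | hb, hσ⟩, h⟩
          · exact hσ
          · exact absurd ⟨b, hb, hσ⟩ h
        · intro hσ
          refine ⟨⟨a, Or.inl rfl, hσ⟩, ?_⟩
          rintro ⟨b, hb, hσ'⟩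
          have := hsep a (mem_insert_self _ _) b (mem_insert_of_mem hb) σ hσ σ hσ' subset_rfl
          exact ha (this ▸ hb)
      rw [this]
      exact hv a (mem_insert_self _ _)

/-- The star of a face in a simplex is a cone over each of the remaining vertices. -/
theorem vanishes_simplex_star (s σ : Finset W) (hs : ∀ v ∈ s, ∀ w ∈ s, κ v = κ w → v = w) {v : W}
    (hv : v ∈ s) (hvσ : v ∉ σ) (i : ℕ) : Vanishes K κ {τ | σ ⊆ τ ∧ τ ⊆ s} i := by
  classical
  rw [vanishes_iff]
  intro z hz hz'
  rw [mem_chains] at hz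
  -- The cone over z with apex v. At a face without v, only the coface `insert v τ` contributes to
  -- the boundary of w; at a face with v, the claim is the cycle equation of z at `τ.erase v`, which
  -- still contains σ.
  let w : Finset W →₀ K := Finsupp.equivFunOnFinite.symm fun τ =>
    if v ∈ τ then (-1) ^ #{u ∈ τ | κ u < κ v} * z (τ.erase v) else 0
  have hw : ∀ τ, w τ = if v ∈ τ then (-1) ^ #{u ∈ τ | κ u < κ v} * z (τ.erase v) else 0 :=
    fun τ => rfl
  refine ⟨w, ?_, ?_⟩
  · rw [mem_chains]
    intro τ hτ
    rw [hw] at hτ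
    split_ifs at hτ with h
    · obtain ⟨⟨h1, h2⟩, h3⟩ := hz _ (right_ne_zero_of_mul hτ)
      rw [card_erase_of_mem h] at h3
      have := card_pos.2 ⟨v, h⟩
      refine ⟨⟨h1.trans (erase_subset _ _), ?_⟩, by omega⟩
      rw [← insert_erase h]
      exact insert_subset hv h2
    · exact absurd rfl hτ
  · ext τ
    rw [boundary_apply]
    by_cases hτ : τ ∈ {τ | σ ⊆ τ ∧ τ ⊆ s}
    swap
    · rw [if_neg hτ]
      by_contra h
      exact hτ (hz τ (Ne.symm h)).1
    rw [if_pos hτ]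
    by_cases hvτ : v ∈ τ
    · have hτ' : τ.erase v ∈ {τ | σ ⊆ τ ∧ τ ⊆ s} :=
        ⟨fun u hu => mem_erase.2 ⟨fun h => hvσ (h ▸ hu), hτ.1 hu⟩,
          (erase_subset _ _).trans hτ.2⟩
      have h0 := DFunLike.congr_fun hz' (τ.erase v)
      rw [boundary_apply, if_pos hτ', Finsupp.coe_zero, Pi.zero_apply,
        ← add_sum_erase _ _ (mem_univ v), if_neg (notMem_erase v τ), insert_erase hvτ] at h0
      rw [← add_sum_erase _ _ (mem_univ v), if_pos hvτ, zero_add]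
      have hf : #{u ∈ τ.erase v | κ u < κ v} = #{u ∈ τ | κ u < κ v} := by
        rw [← insert_erase hvτ, filter_insert]; simp
      rw [hf] at h0
      have hz0 : z τ = - ((-1) ^ #{u ∈ τ | κ u < κ v} * ∑ x ∈ univ.erase v,
          if x ∈ τ.erase v then 0 else
            (-1) ^ #{u ∈ τ.erase v | κ u < κ x} * z (insert x (τ.erase v))) := by
        have hss : (-1 : K) ^ #{u ∈ τ | κ u < κ v} * (-1) ^ #{u ∈ τ | κ u < κ v} = 1 := by
          rw [← mul_pow]; simp
        linear_combination (-1 : K) ^ #{u ∈ τ | κ u < κ v} * h0 - z τ * hss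
      rw [hz0, mul_sum, ← sum_neg_distrib]
      refine sum_congr rfl fun x hx => ?_
      have hxv : x ≠ v := (mem_erase.1 hx).1
      by_cases hxτ : x ∈ τ
      · simp [hxτ, hxv]
      rw [if_neg hxτ, if_neg (fun h => hxτ (mem_of_mem_erase h)), hw,
        if_pos (mem_insert_of_mem hvτ), erase_insert_of_ne hxv]
      by_cases hzx : z (insert x (τ.erase v)) = 0
      · rw [hzx]; ring
      have hxs : x ∈ s := (hz _ hzx).1.2 (mem_insert_self _ _)
      have hk : κ x ≠ κ v := fun h => hxv (hs x hxs v hv h)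
      have e1 : #{u ∈ insert x τ | κ u < κ v}
          = #{u ∈ τ | κ u < κ v} + if κ x < κ v then 1 else 0 := by
        rw [filter_insert]; split_ifs <;> simp [hxτ]
      have e2 : #{u ∈ τ | κ u < κ x}
          = #{u ∈ τ.erase v | κ u < κ x} + if κ v < κ x then 1 else 0 := by
        conv_lhs => rw [← insert_erase hvτ]
        rw [filter_insert]; split_ifs <;> simp
      rw [e1, e2]
      rcases lt_or_gt_of_ne hk with h | h
      · rw [if_pos h, if_neg h.le.not_gt]; ring
      · rw [if_pos h, if_neg h.le.not_gt]; ring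
    · rw [sum_eq_single v]
      · rw [if_neg hvτ, hw, if_pos (mem_insert_self _ _), erase_insert hvτ, ← mul_assoc, ← pow_add]
        have : #{u ∈ insert v τ | κ u < κ v} = #{u ∈ τ | κ u < κ v} := by
          rw [filter_insert]; simp
        rw [this, ← two_mul, pow_mul]
        simp
      · intro x _ hxv
        split_ifs with h
        · rfl
        · rw [hw, if_neg (by simp [hvτ, hxv.symm]), mul_zero]
      · simp

end RelComplex

end

/-! ### Links and stars -/

noncomputable section

set_option linter.unusedSectionVars false

namespace RelComplex

open Finset

variable {W : Type*} [DecidableEq W] [Fintype W] {K : Type*} [Field K] {κ : W → ℕ}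
  {Φ : Set (Finset W)}

/-- The faces of `Φ` that contain `σ`. -/
def star (Φ : Set (Finset W)) (σ : Finset W) : Set (Finset W) := {τ ∈ Φ | σ ⊆ τ}

theorem IsRelative.star (hΦ : IsRelative κ Φ) (σ : Finset W) : IsRelative κ (star Φ σ) where
  injOn τ hτ := hΦ.injOn τ hτ.1
  convex ρ hρ τ hτ ρ' h1 h2 := ⟨hΦ.convex ρ hρ.1 τ hτ.1 ρ' h1 h2, hρ.2.trans h1⟩

/-- The shift from the chains of a link to the chains of a star. -/
def joinChain (κ : W → ℕ) (σ : Finset W) (x : Finset W →₀ K) : Finset W →₀ K :=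
  Finsupp.equivFunOnFinite.symm fun τ =>
    if σ ⊆ τ then (∏ t ∈ τ \ σ, (-1) ^ #{s ∈ σ | κ s < κ t}) * x (τ \ σ) else 0

theorem joinChain_apply (σ : Finset W) (x : Finset W →₀ K) (τ : Finset W) :
    joinChain κ σ x τ = if σ ⊆ τ then
      (∏ t ∈ τ \ σ, (-1) ^ #{s ∈ σ | κ s < κ t}) * x (τ \ σ) else 0 := rfl

theorem prod_sign_mul_self (σ ρ : Finset W) :
    (∏ t ∈ ρ, (-1 : K) ^ #{s ∈ σ | κ s < κ t}) * ∏ t ∈ ρ, (-1 : K) ^ #{s ∈ σ | κ s < κ t} = 1 := by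
  rw [← prod_mul_distrib]
  refine prod_eq_one fun t _ => ?_
  rw [← mul_pow]; simp

/-- Adding w to τ gives the sign of w relative to `τ \ σ` times its sign relative to σ. The second
factor also appears in the product defining `joinChain` and squares to one, so no global sign
remains. -/
theorem boundary_joinChain (σ : Finset W) {x : Finset W →₀ K} {i : ℕ}
    (hx : x ∈ chains K (link Φ σ) i) :
    boundary K κ (star Φ σ) (joinChain κ σ x)
      = joinChain κ σ (boundary K κ (link Φ σ) x) := by
  rw [mem_chains] at hx
  ext τ
  rw [joinChain_apply, boundary_apply, boundary_apply]
  by_cases hσ : σ ⊆ τ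
  swap
  · rw [if_neg (fun h => hσ h.2), if_neg hσ]
  have hlink : τ \ σ ∈ link Φ σ ↔ τ ∈ Φ := by
    simp only [link, Set.mem_ofPred_eq, union_sdiff_of_subset hσ, disjoint_sdiff, true_and]
  rw [if_pos hσ]
  by_cases hτ : τ ∈ Φ
  swap
  · rw [if_neg (fun h => hτ h.1), if_neg (fun h => hτ (hlink.1 h)), mul_zero]
  rw [if_pos ⟨hτ, hσ⟩, if_pos (hlink.2 hτ), mul_sum]
  refine sum_congr rfl fun w _ => ?_
  by_cases hw : w ∈ τ
  · rw [if_pos hw]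
    by_cases hwσ : w ∈ σ
    · rw [if_neg (by simp [hwσ])]
      have : x (insert w (τ \ σ)) = 0 := by
        by_contra h
        exact disjoint_left.1 (hx _ h).1.1 hwσ (mem_insert_self _ _)
      rw [this]; ring
    · rw [if_pos (by simp [hwσ, hw]), mul_zero]
  · have hwσ : w ∉ σ := fun h => hw (hσ h)
    have e1 : insert w τ \ σ = insert w (τ \ σ) := insert_sdiff_of_notMem _ hwσ
    have e2 : #{u ∈ τ | κ u < κ w} = #{u ∈ τ \ σ | κ u < κ w} + #{u ∈ σ | κ u < κ w} := by
      rw [← card_union_of_disjoint, ← filter_union, sdiff_union_of_subset hσ]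
      exact disjoint_filter_filter sdiff_disjoint
    have e3 : ((-1 : K) ^ #{u ∈ σ | κ u < κ w}) * (-1) ^ #{u ∈ σ | κ u < κ w} = 1 := by
      rw [← mul_pow]; simp
    rw [if_neg hw, if_neg (by simp [hw]), joinChain_apply,
      if_pos (hσ.trans (subset_insert _ _)), e1, prod_insert (by simp [hw]), e2, pow_add]
    linear_combination (-1 : K) ^ #{u ∈ τ \ σ | κ u < κ w} *
      (∏ t ∈ τ \ σ, (-1 : K) ^ #{s ∈ σ | κ s < κ t}) * x (insert w (τ \ σ)) * e3

/-- Joining with σ identifies the chain complex of the link with that of the star, shifted by `#σ`.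
The sign products are their own inverses, so the same product also defines the inverse map. -/
theorem vanishes_link_of_star (σ : Finset W) {i : ℕ}
    (h : Vanishes K κ (star Φ σ) (i + #σ)) : Vanishes K κ (link Φ σ) i := by
  rw [vanishes_iff] at h ⊢
  have hcard : ∀ {τ : Finset W}, σ ⊆ τ → #(τ \ σ) + #σ = #τ := fun h => by
    rw [card_sdiff_of_subset h]; have := card_le_card h; omega
  intro z hz hz'
  obtain ⟨y, hy, hy'⟩ := h (joinChain κ σ z) (by
    rw [mem_chains] at hz ⊢
    intro τ hτ
    rw [joinChain_apply] at hτ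
    split_ifs at hτ with h1
    · obtain ⟨⟨h2, h3⟩, h4⟩ := hz _ (right_ne_zero_of_mul hτ)
      rw [union_sdiff_of_subset h1] at h3
      exact ⟨⟨h3, h1⟩, by rw [← hcard h1, h4]⟩
    · exact absurd rfl hτ) (by
    rw [boundary_joinChain σ hz, hz']
    ext τ
    rw [joinChain_apply]
    simp)
  rw [mem_chains] at hy
  let w : Finset W →₀ K := Finsupp.equivFunOnFinite.symm fun ρ =>
    if Disjoint σ ρ then (∏ t ∈ ρ, (-1) ^ #{s ∈ σ | κ s < κ t}) * y (σ ∪ ρ) else 0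
  have hw : ∀ ρ, w ρ =
    if Disjoint σ ρ then (∏ t ∈ ρ, (-1) ^ #{s ∈ σ | κ s < κ t}) * y (σ ∪ ρ) else 0 := fun _ => rfl
  have hwc : w ∈ chains K (link Φ σ) (i + 1) := by
    rw [mem_chains]
    intro ρ hρ
    rw [hw] at hρ
    split_ifs at hρ with h1
    · obtain ⟨h2, h3⟩ := hy _ (right_ne_zero_of_mul hρ)
      rw [card_union_of_disjoint h1] at h3
      exact ⟨⟨h1, h2.1⟩, by omega⟩
    · exact absurd rfl hρ
  have hwy : joinChain κ σ w = y := by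
    ext τ
    rw [joinChain_apply]
    split_ifs with h1
    · rw [hw, if_pos disjoint_sdiff, union_sdiff_of_subset h1, ← mul_assoc, prod_sign_mul_self,
        one_mul]
    · by_contra h2
      exact h1 (hy τ (Ne.symm h2)).1.2
  refine ⟨w, hwc, ?_⟩
  have key := boundary_joinChain (κ := κ) σ hwc
  rw [hwy, hy'] at key
  ext ρ
  by_cases hρ : Disjoint σ ρ
  · have := DFunLike.congr_fun key (σ ∪ ρ)
    rw [joinChain_apply, joinChain_apply, if_pos subset_union_left, if_pos subset_union_left,
      union_sdiff_cancel_left hρ] at this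
    have h0 : (∏ t ∈ ρ, (-1 : K) ^ #{s ∈ σ | κ s < κ t}) ≠ 0 :=
      left_ne_zero_of_mul (by rw [prod_sign_mul_self]; exact one_ne_zero)
    exact (mul_left_cancel₀ h0 this).symm
  · have h1 : ∀ (x : Finset W →₀ K) (j : ℕ), x ∈ chains K (link Φ σ) j → x ρ = 0 := by
      intro x j hx
      rw [mem_chains] at hx
      by_contra h2
      exact hρ (hx _ h2).1.1
    rw [h1 _ _ (boundary_mem_chains hwc), h1 _ _ hz]

end RelComplex

end

/-! ### Chains of order ideals: preorders, deletion and contraction -/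

noncomputable section

set_option linter.unusedSectionVars false

namespace IdealChains

open Finset RelComplex

variable {V : Type*} [Fintype V] [DecidableEq V] {K : Type*} [Field K]

/-- Chains of nonempty proper sets that are closed downwards under `r`, such that each pair in `E`
is separated by some member of the chain. -/
def idealChains (r : V → V → Prop) (E : Finset (V × V)) : Set (Finset (Finset V)) :=
  {τ | (∀ I ∈ τ, (∀ u v, r u v → v ∈ I → u ∈ I) ∧ I ≠ ∅ ∧ I ≠ univ) ∧
    IsChain (· ⊆ ·) (τ : Set (Finset V)) ∧ ∀ e ∈ E, ∃ I ∈ τ, ¬ (e.1 ∈ I ↔ e.2 ∈ I)}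

theorem eq_of_card_eq_of_isChain {τ : Set (Finset V)} (h : IsChain (· ⊆ ·) τ) {I J : Finset V}
    (hI : I ∈ τ) (hJ : J ∈ τ) (hc : #I = #J) : I = J := by
  rcases h.total hI hJ with h | h
  · exact eq_of_subset_of_card_le h hc.ge
  · exact (eq_of_subset_of_card_le h hc.le).symm

theorem isRelative_idealChains (r : V → V → Prop) (E : Finset (V × V)) :
    IsRelative Finset.card (idealChains r E) where
  injOn τ hτ I hI J hJ h := eq_of_card_eq_of_isChain hτ.2.1 hI hJ h
  convex ρ hρ σ hσ τ h1 h2 := ⟨fun I hI => hσ.1 I (h2 hI), hσ.2.1.mono (by exact_mod_cast h2),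
    fun e he => let ⟨I, hI, h⟩ := hρ.2.2 e he; ⟨I, h1 hI, h⟩⟩

/-- The ideals of a total preorder form one chain s, so the complex is a full simplex. A star in it
is a cone unless σ contains all of s, and then all its faces have at least `#A - 1 > j` elements. -/
theorem vanishes_star_of_total {Q : V → V → Prop} (hr : ∀ x, Q x x)
    (ht : ∀ x y z, Q x y → Q y z → Q x z) (htot : ∀ x y, Q x y ∨ Q y x) (A : Finset V)
    (hA : ∀ x ∈ A, ∀ y ∈ A, Q x y → Q y x → x = y) {j : ℕ} (hj : j + 2 ≤ #A)
    (σ : Finset (Finset V)) : Vanishes K Finset.card (star (idealChains Q ∅) σ) j := by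
  classical
  let s : Finset (Finset V) :=
    {I | (∀ u v, Q u v → v ∈ I → u ∈ I) ∧ I ≠ ∅ ∧ I ≠ univ}
  have hs : ∀ I, I ∈ s ↔ (∀ u v, Q u v → v ∈ I → u ∈ I) ∧ I ≠ ∅ ∧ I ≠ univ := by simp [s]
  have hchain : IsChain (· ⊆ ·) (s : Set (Finset V)) := by
    intro I hI J hJ _
    by_contra h
    simp only [not_or, not_subset] at h
    obtain ⟨⟨a, haI, haJ⟩, ⟨b, hbJ, hbI⟩⟩ := h
    rcases htot a b with h | h
    · exact haJ (((hs J).1 hJ).1 a b h hbJ)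
    · exact hbI (((hs I).1 hI).1 b a h haI)
  have hstar : star (idealChains Q ∅) σ = {τ | σ ⊆ τ ∧ τ ⊆ s} := by
    ext τ
    constructor
    · rintro ⟨h1, h2⟩
      exact ⟨h2, fun I hI => (hs I).2 (h1.1 I hI)⟩
    · rintro ⟨h1, h2⟩
      exact ⟨⟨fun I hI => (hs I).1 (h2 hI), hchain.mono (by exact_mod_cast h2), by simp⟩, h1⟩
  have hcard : #A ≤ #s + 1 := by
    -- The principal ideals of the elements of A are distinct, and at most one of them is improper.
    let D : V → Finset V := fun a => {x | Q x a}
    have hD : ∀ a x, x ∈ D a ↔ Q x a := by simp [D]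
    have h1 : #(A.filter fun a => D a ≠ univ) ≤ #s := by
      refine card_le_card_of_injOn D ?_ ?_
      · intro a ha
        rw [mem_coe, mem_filter] at ha
        rw [mem_coe, hs]
        refine ⟨fun u v huv hv => (hD _ _).2 (ht _ _ _ huv ((hD _ _).1 hv)), ?_, ha.2⟩
        exact ne_empty_of_mem ((hD a a).2 (hr a))
      · intro a ha b hb hab
        rw [mem_coe, mem_filter] at ha hb
        refine hA a ha.1 b hb.1 ?_ ?_
        · rw [← hD, ← hab, hD]; exact hr a
        · rw [← hD, hab, hD]; exact hr b
    have h2 : #(A.filter fun a => ¬ D a ≠ univ) ≤ 1 := by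
      rw [card_le_one]
      intro a ha b hb
      rw [mem_filter, not_not] at ha hb
      refine hA a ha.1 b hb.1 ?_ ?_
      · rw [← hD, hb.2]; exact mem_univ _
      · rw [← hD, ha.2]; exact mem_univ _
    rw [← card_filter_add_card_filter_not (s := A) (fun a => D a ≠ univ)]
    omega
  rw [hstar]
  by_cases hv : ∃ v ∈ s, v ∉ σ
  · obtain ⟨v, hv, hvσ⟩ := hv
    exact vanishes_simplex_star s σ (fun I hI J hJ h => eq_of_card_eq_of_isChain hchain hI hJ h)
      hv hvσ j
  · rw [vanishes_iff]
    push Not at hv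
    intro z hz _
    rw [mem_chains] at hz
    refine ⟨0, Submodule.zero_mem _, ?_⟩
    ext τ
    by_contra h
    rw [map_zero] at h
    obtain ⟨⟨h1, h2⟩, h3⟩ := hz τ (Ne.symm h)
    have := card_le_card (show s ⊆ τ from fun v hv' => h1 (hv v hv'))
    omega

/-- The order complex of a preorder with `c` classes, and each star in it, has no homology on
faces with at most `c - 2` elements. -/
theorem vanishes_star_preorder (N : ℕ) : ∀ {Q : V → V → Prop} (_ : ∀ x, Q x x)
    (_ : ∀ x y z, Q x y → Q y z → Q x z) (_ : {p : V × V | ¬ Q p.1 p.2}.ncard ≤ N) (A : Finset V)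
    (_ : ∀ x ∈ A, ∀ y ∈ A, Q x y → Q y x → x = y) {j : ℕ} (_ : j + 2 ≤ #A)
    (σ : Finset (Finset V)), Vanishes K Finset.card (star (idealChains Q ∅) σ) j := by
  classical
  induction N with
  | zero =>
    intro Q hr ht hN A hA j hj σ
    refine vanishes_star_of_total hr ht (fun x y => Or.inl ?_) A hA hj σ
    by_contra h
    have := (Set.ncard_pos (Set.toFinite _)).2 (⟨(x, y), h⟩ : {p : V × V | ¬ Q p.1 p.2}.Nonempty)
    omega
  | succ N ih =>
    intro Q hr ht hN A hA j hj σ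
    by_cases htot : ∀ x y, Q x y ∨ Q y x
    · exact vanishes_star_of_total hr ht htot A hA hj σ
    push Not at htot
    obtain ⟨u, v, huv, hvu⟩ := htot
    -- Adjoining u ≤ v to a preorder adds exactly the pairs with x ≤ u and v ≤ y. Elements of A stay
    -- inequivalent, since a new equivalence would force v ≤ u.
    have step : ∀ u v, ¬ Q u v → ¬ Q v u →
        Vanishes K Finset.card
          (star (idealChains (fun x y => Q x y ∨ (Q x u ∧ Q v y)) ∅) σ) j := by
      intro u v huv hvu
      refine ih (fun x => Or.inl (hr x)) ?_ ?_ A ?_ hj σ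
      · rintro x y z (h | ⟨h1, h2⟩) (h' | ⟨h1', h2'⟩)
        · exact Or.inl (ht _ _ _ h h')
        · exact Or.inr ⟨ht _ _ _ h h1', h2'⟩
        · exact Or.inr ⟨h1, ht _ _ _ h2 h'⟩
        · exact Or.inr ⟨h1, h2'⟩
      · refine Nat.le_of_lt_succ (lt_of_lt_of_le (Set.ncard_lt_ncard ?_ (Set.toFinite _)) hN)
        refine ⟨fun p hp h => hp (Or.inl h), fun h => ?_⟩
        exact h (show (u, v) ∈ {p : V × V | ¬ Q p.1 p.2} from huv) (Or.inr ⟨hr u, hr v⟩)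
      · rintro x hx y hy (h | ⟨h1, h2⟩) (h' | ⟨h1', h2'⟩)
        · exact hA x hx y hy h h'
        · exact absurd (ht _ _ _ h2' (ht _ _ _ h h1')) hvu
        · exact absurd (ht _ _ _ h2 (ht _ _ _ h' h1)) hvu
        · exact absurd (ht _ _ _ h2 h1') hvu
    have hideal : ∀ (u v : V) (I : Finset V),
        (∀ x y, (Q x y ∨ (Q x u ∧ Q v y)) → y ∈ I → x ∈ I) ↔
          (∀ x y, Q x y → y ∈ I → x ∈ I) ∧ (v ∈ I → u ∈ I) := by
      intro u v I
      constructor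
      · intro h
        exact ⟨fun x y hxy => h x y (Or.inl hxy), h u v (Or.inr ⟨hr u, hr v⟩)⟩
      · rintro ⟨h1, h2⟩ x y (h | ⟨h, h'⟩) hy
        · exact h1 x y h hy
        · exact h1 x u h (h2 (h1 v y h' hy))
    have hmem : ∀ (u v : V) (τ : Finset (Finset V)),
        τ ∈ star (idealChains (fun x y => Q x y ∨ (Q x u ∧ Q v y)) ∅) σ ↔
          τ ∈ star (idealChains Q ∅) σ ∧ ∀ I ∈ τ, v ∈ I → u ∈ I := by
      intro u v τ
      constructor
      · rintro ⟨⟨h1, h2⟩, h3⟩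
        exact ⟨⟨⟨fun I hI => ⟨((hideal u v I).1 (h1 I hI).1).1, (h1 I hI).2⟩, h2⟩, h3⟩,
          fun I hI => ((hideal u v I).1 (h1 I hI).1).2⟩
      · rintro ⟨⟨⟨h1, h2⟩, h3⟩, h4⟩
        exact ⟨⟨fun I hI => ⟨(hideal u v I).2 ⟨(h1 I hI).1, h4 I hI⟩, (h1 I hI).2⟩, h2⟩, h3⟩
    -- A chain cannot contain both an ideal with v but not u and an ideal with u but not v, so each
    -- chain respects one of the two enlarged preorders.
    have hunion : star (idealChains Q ∅) σ
        = star (idealChains (fun x y => Q x y ∨ (Q x u ∧ Q v y)) ∅) σ ∪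
          star (idealChains (fun x y => Q x y ∨ (Q x v ∧ Q u y)) ∅) σ := by
      ext τ
      rw [Set.mem_union, hmem, hmem]
      refine ⟨fun h => ?_, fun h => h.elim And.left And.left⟩
      by_contra hcon
      rw [not_or] at hcon
      have h1 : ¬ ∀ I ∈ τ, v ∈ I → u ∈ I := fun h' => hcon.1 ⟨h, h'⟩
      have h2 : ¬ ∀ I ∈ τ, u ∈ I → v ∈ I := fun h' => hcon.2 ⟨h, h'⟩
      push Not at h1 h2
      obtain ⟨I, hI, hvI, huI⟩ := h1
      obtain ⟨J, hJ, huJ, hvJ⟩ := h2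
      rcases h.1.2.1.total hI hJ with h' | h'
      · exact hvJ (h' hvI)
      · exact huI (h' huJ)
    have hlower : ∀ u v, IsSubfamily
        (star (idealChains (fun x y => Q x y ∨ (Q x u ∧ Q v y)) ∅) σ)
        (star (idealChains Q ∅) σ) := fun u v =>
      ⟨fun τ hτ => ((hmem u v τ).1 hτ).1, fun τ hτ ρ hρ hle =>
        (hmem u v ρ).2 ⟨hρ, fun I hI => ((hmem u v τ).1 hτ).2 I (hle hI)⟩⟩
    rw [hunion]
    refine Vanishes.union ?_ ?_ ?_ (step u v huv hvu) (step v u hvu huv) ?_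
    · rw [← hunion]; exact (isRelative_idealChains _ _).star σ
    · rw [← hunion]; exact hlower u v
    · rw [← hunion]; exact hlower v u
    intro k hk
    have hinter : star (idealChains (fun x y => Q x y ∨ (Q x u ∧ Q v y)) ∅) σ ∩
          star (idealChains (fun x y => Q x y ∨ (Q x v ∧ Q u y)) ∅) σ
        = star (idealChains (fun x y => Q x y ∨ (Q x u ∧ Q v y) ∨ (Q x v ∧ Q u y)) ∅) σ := by
      ext τ
      rw [Set.mem_inter_iff, hmem, hmem]
      constructor
      · rintro ⟨⟨⟨⟨h1, h2⟩, h3⟩, h4⟩, -, h5⟩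
        refine ⟨⟨fun I hI => ⟨?_, (h1 I hI).2⟩, h2⟩, h3⟩
        rintro x y (h | ⟨h, h'⟩ | ⟨h, h'⟩) hy
        · exact (h1 I hI).1 x y h hy
        · exact (h1 I hI).1 x u h (h4 I hI ((h1 I hI).1 v y h' hy))
        · exact (h1 I hI).1 x v h (h5 I hI ((h1 I hI).1 u y h' hy))
      · rintro ⟨⟨h1, h2⟩, h3⟩
        have h0 : τ ∈ star (idealChains Q ∅) σ :=
          ⟨⟨fun I hI => ⟨fun x y h => (h1 I hI).1 x y (Or.inl h), (h1 I hI).2⟩, h2⟩, h3⟩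
        exact ⟨⟨h0, fun I hI => (h1 I hI).1 u v (Or.inr (Or.inl ⟨hr u, hr v⟩))⟩, h0,
          fun I hI => (h1 I hI).1 v u (Or.inr (Or.inr ⟨hr v, hr u⟩))⟩
    rw [hinter]
    -- In the intersection u and v are equivalent. Dropping the representative of the class of v
    -- costs one class, which the lower degree k = j - 1 allows.
    have hA' : #A ≤ #(A.filter fun a => ¬ (Q a v ∧ Q v a)) + 1 := by
      have h2 : #(A.filter fun a => Q a v ∧ Q v a) ≤ 1 := by
        rw [card_le_one]
        intro a ha b hb
        rw [mem_filter] at ha hb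
        exact hA a ha.1 b hb.1 (ht _ _ _ ha.2.1 hb.2.2) (ht _ _ _ hb.2.1 ha.2.2)
      rw [← card_filter_add_card_filter_not (s := A) (fun a => Q a v ∧ Q v a)]
      omega
    refine ih (fun x => Or.inl (hr x)) ?_ ?_ (A.filter fun a => ¬ (Q a v ∧ Q v a)) ?_
      (by omega) σ
    · rintro x y z (h | ⟨h1, h2⟩ | ⟨h1, h2⟩) (h' | ⟨h1', h2'⟩ | ⟨h1', h2'⟩)
      · exact Or.inl (ht _ _ _ h h')
      · exact Or.inr (Or.inl ⟨ht _ _ _ h h1', h2'⟩)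
      · exact Or.inr (Or.inr ⟨ht _ _ _ h h1', h2'⟩)
      · exact Or.inr (Or.inl ⟨h1, ht _ _ _ h2 h'⟩)
      · exact Or.inr (Or.inl ⟨h1, h2'⟩)
      · exact Or.inl (ht _ _ _ h1 h2')
      · exact Or.inr (Or.inr ⟨h1, ht _ _ _ h2 h'⟩)
      · exact Or.inl (ht _ _ _ h1 h2')
      · exact Or.inr (Or.inr ⟨h1, h2'⟩)
    · refine Nat.le_of_lt_succ (lt_of_lt_of_le (Set.ncard_lt_ncard ?_ (Set.toFinite _)) hN)
      refine ⟨fun p hp h => hp (Or.inl h), fun h => ?_⟩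
      exact h (show (u, v) ∈ {p : V × V | ¬ Q p.1 p.2} from huv)
        (Or.inr (Or.inl ⟨hr u, hr v⟩))
    · intro x hx y hy
      rw [mem_filter] at hx hy
      rintro (h | ⟨h1, h2⟩ | ⟨h1, h2⟩) (h' | ⟨h1', h2'⟩ | ⟨h1', h2'⟩)
      · exact hA x hx.1 y hy.1 h h'
      · exact absurd (ht _ _ _ h2' (ht _ _ _ h h1')) hvu
      · exact absurd (ht _ _ _ h2' (ht _ _ _ h h1')) huv
      · exact absurd (ht _ _ _ h2 (ht _ _ _ h' h1)) hvu
      · exact absurd (ht _ _ _ h2 h1') hvu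
      · exact absurd ⟨h1', h2⟩ hy.2
      · exact absurd (ht _ _ _ h2 (ht _ _ _ h' h1)) huv
      · exact absurd ⟨h1, h2'⟩ hx.2
      · exact absurd (ht _ _ _ h2 h1') huv

/-- The relation `r` together with the pairs in `F`, in both directions. -/
def adjoin (r : V → V → Prop) (F : Finset (V × V)) (x y : V) : Prop :=
  r x y ∨ (x, y) ∈ F ∨ (y, x) ∈ F

theorem adjoin_adjoin (r : V → V → Prop) (e : V × V) (F : Finset (V × V)) :
    adjoin (adjoin r {e}) F = adjoin r (insert e F) := by
  ext x y
  simp only [adjoin, mem_insert, mem_singleton]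
  tauto

theorem idealChains_reflTransGen (r : V → V → Prop) (E : Finset (V × V)) :
    idealChains (Relation.ReflTransGen r) E = idealChains r E := by
  ext τ
  refine and_congr_left fun _ => forall₂_congr fun I _ => and_congr_left fun _ => ?_
  constructor
  · intro h u v huv
    exact h u v (Relation.ReflTransGen.single huv)
  · intro h u v huv
    induction huv with
    | refl => exact id
    | tail _ h2 ih => exact fun hc => ih (h _ _ h2 hc)

/-- Deletion and contraction of the pairs in `E`. -/
theorem vanishes_star_idealChains (E : Finset (V × V)) (σ : Finset (Finset V)) :
    ∀ {r : V → V → Prop} {j c : ℕ} (_ : j + 2 ≤ c) (_ : ∀ F ⊆ E, #F + #σ ≤ j → ∃ A : Finset V,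
      c ≤ #A + #F ∧ ∀ x ∈ A, ∀ y ∈ A, Relation.ReflTransGen (adjoin r F) x y →
        Relation.ReflTransGen (adjoin r F) y x → x = y),
      Vanishes K Finset.card (star (idealChains r E) σ) j := by
  induction E using Finset.induction_on with
  | empty =>
    intro r j c hj hF
    -- All faces of the star contain σ, so in degrees below `#σ` there are no chains at all. This is
    -- why the count of classes is assumed only for `#F + #σ ≤ j`.
    by_cases hσ : #σ ≤ j
    swap
    · rw [vanishes_iff]
      intro z hz _
      rw [mem_chains] at hz
      refine ⟨0, Submodule.zero_mem _, ?_⟩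
      ext τ
      by_contra h
      rw [map_zero] at h
      obtain ⟨h1, h2⟩ := hz τ (Ne.symm h)
      have := card_le_card h1.2
      omega
    obtain ⟨A, hA, hA'⟩ := hF ∅ subset_rfl (by simpa using hσ)
    have hadj : adjoin r ∅ = r := by ext x y; simp [adjoin]
    rw [hadj] at hA'
    rw [card_empty] at hA
    rw [← idealChains_reflTransGen]
    exact vanishes_star_preorder _ (fun _ => Relation.ReflTransGen.refl)
      (fun _ _ _ h1 h2 => h1.trans h2) le_rfl A hA' (by omega) σ
  | insert e E he ih =>
    intro r j c hj hF
    have hmem : ∀ τ, τ ∈ star (idealChains (adjoin r {e}) E) σ ↔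
        τ ∈ star (idealChains r E) σ ∧ ∀ I ∈ τ, (e.1 ∈ I ↔ e.2 ∈ I) := by
      intro τ
      constructor
      · rintro ⟨⟨h1, h2⟩, h3⟩
        refine ⟨⟨⟨fun I hI => ⟨fun u v h => (h1 I hI).1 u v (Or.inl h), (h1 I hI).2⟩, h2⟩, h3⟩,
          fun I hI => ⟨(h1 I hI).1 _ _ (Or.inr (Or.inr (by simp))),
            (h1 I hI).1 _ _ (Or.inr (Or.inl (by simp)))⟩⟩
      · rintro ⟨⟨⟨h1, h2⟩, h3⟩, h4⟩
        refine ⟨⟨fun I hI => ⟨?_, (h1 I hI).2⟩, h2⟩, h3⟩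
        rintro u v (h | h | h) hv
        · exact (h1 I hI).1 u v h hv
        · rw [mem_singleton] at h
          have := h4 I hI
          rw [← h] at this
          exact this.2 hv
        · rw [mem_singleton] at h
          have := h4 I hI
          rw [← h] at this
          exact this.1 hv
    -- A chain that fails to separate e is a chain of ideals for the relation with e contracted.
    have hdiff : star (idealChains r (insert e E)) σ
        = star (idealChains r E) σ \ star (idealChains (adjoin r {e}) E) σ := by
      ext τ
      rw [Set.mem_sdiff, hmem]
      constructor
      · rintro ⟨⟨h1, h2, h3⟩, h4⟩
        refine ⟨⟨⟨h1, h2, fun e' he' => h3 e' (mem_insert_of_mem he')⟩, h4⟩, ?_⟩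
        rintro ⟨-, h5⟩
        obtain ⟨I, hI, h⟩ := h3 e (mem_insert_self _ _)
        exact h (h5 I hI)
      · rintro ⟨⟨⟨h1, h2, h3⟩, h4⟩, h5⟩
        refine ⟨⟨h1, h2, fun e' he' => ?_⟩, h4⟩
        rcases mem_insert.1 he' with rfl | he'
        · by_contra h6
          push Not at h6
          exact h5 ⟨⟨⟨h1, h2, h3⟩, h4⟩, h6⟩
        · exact h3 e' he'
    rw [hdiff]
    refine Vanishes.quotient ((isRelative_idealChains _ _).star σ) ?_ ?_ ?_
    · exact ⟨fun τ hτ => ((hmem τ).1 hτ).1, fun τ hτ ρ hρ hle =>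
        (hmem ρ).2 ⟨hρ, fun I hI => ((hmem τ).1 hτ).2 I (hle hI)⟩⟩
    · exact ih hj fun F hFE hF' => hF F (hFE.trans (subset_insert _ _)) hF'
    · intro k hk
      -- Contraction lowers both the degree and the guaranteed number of classes by one. A set F
      -- contracted afterwards amounts to `insert e F` contracted at once.
      refine ih (c := c - 1) (by omega) fun F hFE hFk => ?_
      rw [adjoin_adjoin]
      have hcard : #(insert e F) = #F + 1 := card_insert_of_notMem fun h => he (hFE h)
      obtain ⟨A, h1, h2⟩ := hF (insert e F) (insert_subset_insert _ hFE) (by omega)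
      exact ⟨A, by omega, h2⟩

end IdealChains

end

/-! ### The coloring complex: Serre's condition and rank selection -/

noncomputable section

set_option linter.unusedSectionVars false

namespace MixedGraph

open Finset RelComplex IdealChains Relation

variable {V : Type*} [Fintype V] [DecidableEq V] {K : Type*} [Field K] (G : MixedGraph V)

open Classical in
/-- The ordered pairs of vertices joined by an undirected edge. -/
def undPairs : Finset (V × V) := {p | G.und.Adj p.1 p.2}

theorem mem_undPairs {p : V × V} : p ∈ G.undPairs ↔ G.und.Adj p.1 p.2 := by
  simp [undPairs]

theorem mem_orderComplex_iff {τ : Finset (Finset V)} :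
    τ ∈ G.orderComplex ↔ τ ∈ idealChains G.dir.Adj ∅ := by
  rw [← idealChains_reflTransGen]
  simp [orderComplex, idealChains, IsIdeal]

/-- If no member separates the ends u, v of an edge, take the smallest set J containing u and the
largest set I avoiding u in the chain with ∅ and V added: they are consecutive and `J \ I` contains
the edge. Conversely, a member separating two vertices of `J \ I` lies strictly between I and J. -/
theorem coloringComplex_eq : G.coloringComplex = idealChains G.dir.Adj G.undPairs := by
  ext τ
  constructor
  · rintro ⟨h1, h2⟩
    obtain ⟨h3, h4, -⟩ := G.mem_orderComplex_iff.1 h1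
    refine ⟨h3, h4, ?_⟩
    rintro ⟨u, v⟩ he
    rw [mem_undPairs] at he
    by_contra hsep
    push Not at hsep
    simp only at hsep he
    obtain ⟨J, hJ, hJmin⟩ := exists_min_image ((insert univ τ).filter (u ∈ ·)) card ⟨univ, by simp⟩
    obtain ⟨I, hI, hImax⟩ := exists_max_image ((insert ∅ τ).filter (u ∉ ·)) card ⟨∅, by simp⟩
    rw [mem_filter, mem_insert] at hJ hI
    have hIJ : I ⊆ J := by
      rcases hI with ⟨rfl | hI, huI⟩
      · exact empty_subset _
      rcases hJ with ⟨rfl | hJ, huJ⟩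
      · exact subset_univ _
      rcases h4.total hI hJ with h | h
      · exact h
      · exact absurd (h huJ) huI
    have hvJ : v ∈ J := by
      rcases hJ with ⟨rfl | hJ, huJ⟩
      · exact mem_univ _
      · exact (hsep J hJ).1 huJ
    have hvI : v ∉ I := by
      rcases hI with ⟨rfl | hI, huI⟩
      · exact notMem_empty _
      · exact fun h => huI ((hsep I hI).2 h)
    refine h2 I ?_ J ?_ (Finset.ssubset_iff_subset_ne.2 ⟨hIJ, fun h => hI.2 (h ▸ hJ.2)⟩) ?_ u v hJ.2 hI.2
      hvJ hvI he
    · rcases hI.1 with h | h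
      · simp [h]
      · exact Or.inl h
    · rcases hJ.1 with h | h
      · simp [h]
      · exact Or.inl h
    · rintro ⟨L, hL, hIL, hLJ⟩
      by_cases huL : u ∈ L
      · exact absurd (hJmin L (by simp [hL, huL])) (card_lt_card hLJ).not_ge
      · exact absurd (hImax L (by simp [hL, huL])) (card_lt_card hIL).not_ge
  · rintro ⟨h1, h2, h3⟩
    refine ⟨G.mem_orderComplex_iff.2 ⟨h1, h2, by simp⟩, ?_⟩
    intro I hI J hJ hIJ hno u v huJ huI hvJ hvI he
    have key : ∀ a b : V, a ∈ J → a ∉ I → b ∈ J → b ∉ I → ∀ L ∈ τ, a ∈ L → b ∉ L → False := by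
      intro a b haJ haI hbJ hbI L hL haL hbL
      refine hno ⟨L, hL, ?_, ?_⟩
      · refine Finset.ssubset_iff_subset_ne.2 ⟨?_, fun h => haI (h ▸ haL)⟩
        rcases hI with hI | rfl | rfl
        · rcases h2.total hI hL with h | h
          · exact h
          · exact absurd (h haL) haI
        · exact empty_subset _
        · exact absurd (mem_univ _) haI
      · refine Finset.ssubset_iff_subset_ne.2 ⟨?_, fun h => hbL (h ▸ hbJ)⟩
        rcases hJ with hJ | rfl | rfl
        · rcases h2.total hL hJ with h | h
          · exact h
          · exact absurd (h hbJ) hbL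
        · exact absurd hbJ (notMem_empty _)
        · exact subset_univ _
    obtain ⟨L, hL, hsep⟩ := h3 (u, v) (G.mem_undPairs.2 he)
    simp only at hsep
    by_cases huL : u ∈ L
    · exact key u v huJ huI hvJ hvI L hL huL (by tauto)
    · exact key v u hvJ hvI huJ huI L hL (by tauto) huL

/-- A graph with n vertices and |F| edges has at least n - |F| components: a new pair e merges at
most two classes, so discarding the representative of the class of `e.2` suffices. -/
theorem exists_transversal (F : Finset (V × V)) : ∃ A : Finset V, Fintype.card V ≤ #A + #F ∧
    ∀ x ∈ A, ∀ y ∈ A, ReflTransGen (adjoin (fun _ _ => False) F) x y → x = y := by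
  classical
  have hsymm : ∀ F : Finset (V × V), ∀ {x y}, ReflTransGen (adjoin (fun _ _ => False) F) x y →
      ReflTransGen (adjoin (fun _ _ => False) F) y x := by
    intro F x y h
    induction h with
    | refl => exact ReflTransGen.refl
    | tail _ h ih =>
      refine ReflTransGen.head ?_ ih
      rcases h with h | h | h
      · exact h.elim
      · exact Or.inr (Or.inr h)
      · exact Or.inr (Or.inl h)
  induction F using Finset.induction_on with
  | empty =>
    refine ⟨univ, by simp, fun x _ y _ h => ?_⟩
    induction h with
    | refl => rfl
    | tail _ h _ => simp [adjoin] at h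
  | insert e F he ih =>
    obtain ⟨A, hA, hA'⟩ := ih
    set Q := ReflTransGen (adjoin (fun _ _ => False) F) with hQ
    have hexp : ∀ {x y}, ReflTransGen (adjoin (fun _ _ => False) (insert e F)) x y →
        Q x y ∨ (Q x e.1 ∧ Q e.2 y) ∨ (Q x e.2 ∧ Q e.1 y) := by
      intro x y h
      induction h with
      | refl => exact Or.inl ReflTransGen.refl
      | @tail b c _ h2 ih =>
        have hbc : Q b c ∨ (b = e.1 ∧ c = e.2) ∨ (b = e.2 ∧ c = e.1) := by
          rcases h2 with h | h | h
          · exact h.elim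
          · rcases mem_insert.1 h with h | h
            · rw [← h]; simp
            · exact Or.inl (ReflTransGen.single (Or.inr (Or.inl h)))
          · rcases mem_insert.1 h with h | h
            · rw [← h]; simp
            · exact Or.inl (ReflTransGen.single (Or.inr (Or.inr h)))
        rcases hbc with hbc | ⟨rfl, rfl⟩ | ⟨rfl, rfl⟩
        · rcases ih with ih | ⟨i1, i2⟩ | ⟨i1, i2⟩
          · exact Or.inl (ih.trans hbc)
          · exact Or.inr (Or.inl ⟨i1, i2.trans hbc⟩)
          · exact Or.inr (Or.inr ⟨i1, i2.trans hbc⟩)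
        · rcases ih with ih | ⟨i1, i2⟩ | ⟨i1, i2⟩
          · exact Or.inr (Or.inl ⟨ih, ReflTransGen.refl⟩)
          · exact Or.inr (Or.inl ⟨i1, ReflTransGen.refl⟩)
          · exact Or.inl i1
        · rcases ih with ih | ⟨i1, i2⟩ | ⟨i1, i2⟩
          · exact Or.inr (Or.inr ⟨ih, ReflTransGen.refl⟩)
          · exact Or.inl i1
          · exact Or.inr (Or.inr ⟨i1, ReflTransGen.refl⟩)
    refine ⟨A.filter fun a => ¬ Q a e.2, ?_, ?_⟩
    · have h2 : #(A.filter fun a => Q a e.2) ≤ 1 := by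
        rw [card_le_one]
        intro a ha b hb
        rw [mem_filter] at ha hb
        exact hA' a ha.1 b hb.1 (ha.2.trans (hsymm F hb.2))
      rw [card_insert_of_notMem he]
      have := card_filter_add_card_filter_not (s := A) (fun a => Q a e.2)
      omega
    · intro x hx y hy h
      rw [mem_filter] at hx hy
      rcases hexp h with h | ⟨_, h⟩ | ⟨h, _⟩
      · exact hA' x hx.1 y hy.1 h
      · exact absurd (hsymm F h) hy.2
      · exact absurd h hx.2

variable {G}

/-- A directed edge on a closed walk through directed edges and `F` joins vertices that are
connected by `F`, if every mixed cycle has more undirected edges than `F`. -/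
theorem connected_of_adj_of_reflTransGen (hG : G.IsAcyclic) {F : Finset (V × V)}
    (hF : F ⊆ G.undPairs) (hm : #F < G.minUndirected) {u v : V} (huv : G.dir.Adj u v)
    (hvu : ReflTransGen (adjoin G.dir.Adj F) v u) :
    ReflTransGen (adjoin (fun _ _ => False) F) u v := by
  classical
  by_contra hcon
  have hne : u ≠ v := fun h => hcon (h ▸ ReflTransGen.refl)
  have hF1 : (u, v) ∉ F := fun h => hcon (ReflTransGen.single (Or.inr (Or.inl h)))
  have hF2 : (v, u) ∉ F := fun h => hcon (ReflTransGen.single (Or.inr (Or.inr h)))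
  have hdir : ¬ G.dir.Adj v u := fun h => hG u (TransGen.tail (TransGen.single huv) h)
  -- The walk from v back to u can avoid the edge uv: it may stop when it first reaches u, and a
  -- step from v to u along this edge would need an arc from v to u or a pair in F.
  let R : V → V → Prop := fun x y => adjoin G.dir.Adj F x y ∧ s(x, y) ≠ s(u, v)
  have hR : ∀ x, ReflTransGen (adjoin G.dir.Adj F) x u → ReflTransGen R x u := by
    intro x hx
    induction hx using ReflTransGen.head_induction_on with
    | refl => exact ReflTransGen.refl
    | @head x y hxy _ ih =>
      by_cases h : s(x, y) = s(u, v)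
      · rw [Sym2.eq_iff] at h
        rcases h with ⟨rfl, -⟩ | ⟨rfl, rfl⟩
        · exact ReflTransGen.refl
        · rcases hxy with h | h | h
          · exact absurd h hdir
          · exact absurd h hF2
          · exact absurd h hF1
      · exact ReflTransGen.head ⟨hxy, h⟩ ih
  let L : SimpleGraph V := SimpleGraph.fromRel R
  have hL : L.Reachable v u := by
    have : ∀ x, ReflTransGen R x u → L.Reachable x u := by
      intro x hx
      induction hx using ReflTransGen.head_induction_on with
      | refl => exact SimpleGraph.Reachable.refl _
      | @head x y hxy _ ih =>
        by_cases h : x = y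
        · rwa [h]
        · exact (SimpleGraph.Adj.reachable
            ((SimpleGraph.fromRel_adj R x y).2 ⟨h, Or.inl hxy⟩)).trans ih
    exact this v (hR v hvu)
  have hund : ∀ {x y}, (x, y) ∈ F → G.und.Adj x y := fun h => G.mem_undPairs.1 (hF h)
  have hLG : L ≤ G.underlying := by
    have key : ∀ x y, x ≠ y → R x y → G.underlying.Adj x y := by
      rintro x y hxy ⟨h | h | h, -⟩
      · exact Or.inr ((SimpleGraph.fromRel_adj _ _ _).2 ⟨hxy, Or.inl h⟩)
      · exact Or.inl (hund h)
      · exact Or.inl (hund h).symm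
    intro x y hxy
    obtain ⟨h1, h2 | h2⟩ := (SimpleGraph.fromRel_adj R x y).1 hxy
    · exact key x y h1 h2
    · exact (key y x h1.symm h2).symm
  obtain ⟨p, hp⟩ := hL.exists_isPath
  have hadj : G.underlying.Adj u v := Or.inr ((SimpleGraph.fromRel_adj _ _ _).2 ⟨hne, Or.inl huv⟩)
  have hedge : ∀ e ∈ p.edges, e ≠ s(u, v) ∧ (e ∈ F.image (fun p => s(p.1, p.2)) ∨
      ∃ a b, G.dir.Adj a b ∧ e = s(a, b)) := by
    intro e he
    have hedge := p.edges_subset_edgeSet he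
    induction e using Sym2.ind with
    | _ x y =>
      have key : ∀ x y, R x y → s(x, y) ≠ s(u, v) ∧ (s(x, y) ∈ F.image (fun p => s(p.1, p.2)) ∨
          ∃ a b, G.dir.Adj a b ∧ s(x, y) = s(a, b)) := by
        rintro x y ⟨h | h | h, h'⟩
        · exact ⟨h', Or.inr ⟨x, y, h, rfl⟩⟩
        · exact ⟨h', Or.inl (mem_image.2 ⟨_, h, rfl⟩)⟩
        · exact ⟨h', Or.inl (mem_image.2 ⟨_, h, Sym2.eq_swap⟩)⟩
      obtain ⟨h1, h2 | h2⟩ := (SimpleGraph.fromRel_adj R x y).1 hedge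
      · exact key x y h2
      · rw [Sym2.eq_swap]; exact key y x h2
  have hmemF : s(u, v) ∉ F.image (fun p => s(p.1, p.2)) := by
    intro h
    obtain ⟨⟨a, b⟩, hab, h⟩ := mem_image.1 h
    rcases Sym2.eq_iff.1 h with ⟨rfl, rfl⟩ | ⟨rfl, rfl⟩
    · exact hF1 hab
    · exact hF2 hab
  -- The path closed by the arc from u to v. Edges that occur in F are taken as undirected and all
  -- others as directed; uv is not in F, so the cycle is mixed with at most `#F` undirected edges.
  let c : G.MixedCycle :=
    { base := u
      walk := SimpleGraph.Walk.cons hadj (p.mapLe hLG)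
      isCycle := by
        rw [SimpleGraph.Walk.cons_isCycle_iff, SimpleGraph.Walk.isPath_mapLe,
          SimpleGraph.Walk.edges_mapLe_eq_edges]
        exact ⟨hp, fun h => (hedge _ h).1 rfl⟩
      directed := {e | (e = s(u, v) ∨ e ∈ p.edges) ∧ e ∉ F.image (fun p => s(p.1, p.2))}
      directed_subset := by
        rintro e ⟨he, -⟩
        simpa using he
      directed_adj := by
        rintro e ⟨rfl | he, h⟩
        · exact ⟨u, v, huv, rfl⟩
        · exact (hedge e he).2.resolve_left h
      directed_nonempty := ⟨s(u, v), Or.inl rfl, hmemF⟩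
      undirected_adj := by
        intro e he h
        have he' : e ∈ F.image (fun p => s(p.1, p.2)) := by
          by_contra h'
          exact h ⟨by simpa using he, h'⟩
        obtain ⟨⟨a, b⟩, hab, rfl⟩ := mem_image.1 he'
        exact hund hab }
  have hc : c.numUndirected ≤ #F := by
    refine le_trans ?_ (card_image_le (s := F) (f := fun p => s(p.1, p.2)))
    rw [← Set.ncard_coe_finset]
    refine Set.ncard_le_ncard ?_ (Set.toFinite _)
    rintro e ⟨he, h⟩
    by_contra h'
    exact h ⟨by simpa [c] using he, h'⟩
  have : G.minUndirected ≤ c.numUndirected := by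
    rw [minUndirected, if_pos ⟨c⟩]
    exact Nat.sInf_le ⟨c, rfl⟩
  omega

/-- Each arc on a closed walk can be replaced by a connection inside F, so contracting F creates no
equivalences beyond the components of F. -/
theorem connected_of_reflTransGen (hG : G.IsAcyclic) {F : Finset (V × V)}
    (hF : F ⊆ G.undPairs) (hm : #F < G.minUndirected) {x y : V}
    (hxy : ReflTransGen (adjoin G.dir.Adj F) x y) (hyx : ReflTransGen (adjoin G.dir.Adj F) y x) :
    ReflTransGen (adjoin (fun _ _ => False) F) x y := by
  induction hxy using ReflTransGen.head_induction_on with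
  | refl => exact ReflTransGen.refl
  | @head x z hxz hzy ih =>
    refine ReflTransGen.trans ?_ (ih (hyx.tail hxz))
    rcases hxz with h | h
    · exact connected_of_adj_of_reflTransGen hG hF hm h (hzy.trans hyx)
    · exact ReflTransGen.single (Or.inr h)

theorem isRelative_coloringComplex : IsRelative Finset.card G.coloringComplex := by
  rw [coloringComplex_eq]
  exact isRelative_idealChains _ _

/-- The stars in the coloring complex have no homology in low degrees. -/
theorem vanishes_star_coloringComplex (hG : G.IsAcyclic) (σ : Finset (Finset V)) {j : ℕ}
    (hj : j + 2 ≤ Fintype.card V) (hm : j < G.minUndirected + #σ) :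
    Vanishes K Finset.card (star G.coloringComplex σ) j := by
  rw [coloringComplex_eq]
  refine vanishes_star_idealChains _ σ hj fun F hF hFj => ?_
  obtain ⟨A, h1, h2⟩ := exists_transversal F
  exact ⟨A, h1, fun x hx y hy hxy hyx =>
    h2 x hx y hy (connected_of_reflTransGen hG hF (by omega) hxy hyx)⟩

theorem card_bounds_of_mem {τ : Finset (Finset V)} (hτ : τ ∈ G.orderComplex) {I : Finset V}
    (hI : I ∈ τ) : #I ∈ Icc 1 (Fintype.card V - 1) := by
  obtain ⟨-, h1, h2⟩ := hτ.1 I hI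
  have h3 := card_pos.2 (nonempty_iff_ne_empty.2 h1)
  have h4 := card_lt_univ_of_notMem (s := I) (x := (not_forall.1 fun h =>
    h2 (eq_univ_iff_forall.2 h)).choose) (not_forall.1 fun h =>
    h2 (eq_univ_iff_forall.2 h)).choose_spec
  rw [mem_Icc]
  omega

theorem card_image_card {τ : Finset (Finset V)} (hτ : τ ∈ G.orderComplex) :
    #(τ.image card) = #τ :=
  card_image_of_injOn fun _ hI _ hJ h => eq_of_card_eq_of_isChain hτ.2 hI hJ h

theorem card_le_of_mem {τ : Finset (Finset V)} (hτ : τ ∈ G.orderComplex) :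
    #τ ≤ Fintype.card V - 1 := by
  rw [← card_image_card hτ]
  calc #(τ.image card) ≤ #(Icc 1 (Fintype.card V - 1)) := card_le_card fun k hk => by
        obtain ⟨I, hI, rfl⟩ := mem_image.1 hk
        exact card_bounds_of_mem hτ hI
    _ = Fintype.card V - 1 := by simp

/-- The coloring complex satisfies Serre's condition. -/
theorem coloringComplexSatisfiesSerre (hG : G.IsAcyclic) :
    G.ColoringComplexSatisfiesSerre K G.minUndirected := by
  intro σ _ i hdim hi
  have hlink : link G.orderComplex σ \ link (G.orderComplex \ G.coloringComplex) σ
      = link G.coloringComplex σ := by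
    ext τ
    constructor
    · rintro ⟨h1, h2⟩
      refine ⟨h1.1, ?_⟩
      by_contra h
      exact h2 ⟨h1.1, h1.2, h⟩
    · rintro ⟨h1, h2⟩
      exact ⟨⟨h1, h2.1⟩, fun h => h.2.2 h2⟩
  rw [hlink] at hdim
  change Vanishes K Finset.card _ i
  rw [hlink]
  obtain ⟨τ, hτ, hi'⟩ := hdim
  -- The dimension hypothesis enters here: a face of the link with more than i elements, joined with
  -- σ, has at most n - 1 elements, so `i + #σ + 2 ≤ n`.
  have h1 := card_le_of_mem hτ.2.1
  rw [card_union_of_disjoint hτ.1] at h1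
  exact vanishes_link_of_star σ (vanishes_star_coloringComplex hG σ (by omega) (by omega))

/-- The faces of the coloring complex whose set of ranks lies between `B` and `N`. -/
def rankInterval (G : MixedGraph V) (B N : Finset ℕ) : Set (Finset (Finset V)) :=
  {τ ∈ G.coloringComplex | B ⊆ τ.image card ∧ τ.image card ⊆ N}

theorem isRelative_rankInterval (B N : Finset ℕ) :
    IsRelative Finset.card (G.rankInterval B N) where
  injOn τ hτ := isRelative_coloringComplex.injOn τ hτ.1
  convex ρ hρ σ hσ τ h1 h2 := ⟨isRelative_coloringComplex.convex ρ hρ.1 σ hσ.1 τ h1 h2,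
    hρ.2.1.trans (image_subset_image h1), (image_subset_image h2).trans hσ.2.2⟩

/-- The rank-selected coloring complex has no homology in low degrees. -/
theorem vanishes_rankInterval (hG : G.IsAcyclic) {j : ℕ} (N : Finset ℕ)
    (hN : N ⊆ Icc 1 (Fintype.card V - 1)) : ∀ B ⊆ N, j < #N → j < G.minUndirected + #B →
    Vanishes K Finset.card (G.rankInterval B N) j := by
  classical
  -- Induction on the set of excluded ranks.
  obtain ⟨M, hM⟩ : ∃ M, M = Icc 1 (Fintype.card V - 1) \ N := ⟨_, rfl⟩
  induction M using Finset.induction_on generalizing N j with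
  | empty =>
    intro B hB hj hm
    have hN' : N = Icc 1 (Fintype.card V - 1) := subset_antisymm hN (by
      rw [← sdiff_eq_empty_iff_subset, hM])
    -- With all ranks allowed, a face is sorted by its subchain σ of ranks B. Related faces have the
    -- same σ, so this is a disjoint union of stars.
    have e : G.rankInterval B N = ⋃ σ ∈ (univ : Finset (Finset (Finset V))).filter
        (fun σ => σ ∈ G.orderComplex ∧ σ.image card = B), star G.coloringComplex σ := by
      ext τ
      simp only [Set.mem_iUnion, mem_filter, mem_univ, true_and, exists_prop]
      constructor
      · rintro ⟨h1, h2, h3⟩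
        refine ⟨τ.filter (#· ∈ B), ⟨⟨fun I hI => h1.1.1 I (mem_filter.1 hI).1,
          h1.1.2.mono (by exact_mod_cast filter_subset _ _)⟩, ?_⟩, h1, filter_subset _ _⟩
        ext k
        simp only [mem_image, mem_filter]
        constructor
        · rintro ⟨I, hI, rfl⟩
          exact hI.2
        · intro hk
          obtain ⟨I, hI, rfl⟩ := mem_image.1 (h2 hk)
          exact ⟨I, ⟨hI, hk⟩, rfl⟩
      · rintro ⟨σ, ⟨h1, rfl⟩, h2, h3⟩
        refine ⟨h2, image_subset_image h3, fun k hk => ?_⟩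
        obtain ⟨I, hI, rfl⟩ := mem_image.1 hk
        rw [hN']
        exact card_bounds_of_mem h2.1 hI
    rw [e]
    refine vanishes_biUnion _ _ (fun σ _ => isRelative_coloringComplex.star σ) ?_ ?_
    · intro σ hσ ρ hρ τ hτ τ' hτ' hle
      have key : ∀ σ ρ : Finset (Finset V), σ.image card = B → ρ.image card = B → σ ⊆ τ → ρ ⊆ τ →
          σ ⊆ ρ := by
        intro σ ρ h1 h2 h3 h4 I hI
        have : #I ∈ ρ.image card := by rw [h2, ← h1]; exact mem_image_of_mem _ hI
        obtain ⟨J, hJ, hIJ⟩ := mem_image.1 this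
        rwa [← eq_of_card_eq_of_isChain hτ.1.1.2 (h4 hJ) (h3 hI) hIJ]
      have h1 := (mem_filter.1 hσ).2.2
      have h2 := (mem_filter.1 hρ).2.2
      exact subset_antisymm (key σ ρ h1 h2 hτ.2 (hτ'.2.trans hle))
        (key ρ σ h2 h1 (hτ'.2.trans hle) hτ.2)
    · intro σ hσ
      obtain ⟨-, h1, h2⟩ := mem_filter.1 hσ
      rw [hN', Nat.card_Icc] at hj
      rw [← h2, card_image_card h1] at hm
      exact vanishes_star_coloringComplex hG σ (by omega) hm
  | insert a M ha ih =>
    intro B hB hj hm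
    have haM : a ∈ Icc 1 (Fintype.card V - 1) \ N := hM ▸ mem_insert_self _ _
    rw [mem_sdiff] at haM
    have hM' : M = Icc 1 (Fintype.card V - 1) \ insert a N := by
      rw [sdiff_insert, ← hM, erase_insert ha]
    have hN' := insert_subset haM.1 hN
    have hcN : #(insert a N) = #N + 1 := card_insert_of_notMem haM.2
    have haB : a ∉ B := fun h => haM.2 (hB h)
    -- Readmit rank a. The quotient consists of the faces that use a; its homology is needed in
    -- degree j + 1, which is allowed because both `#N` and `#B` grow by one.
    refine Vanishes.subfamily (Φ := G.rankInterval B (insert a N))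
      (isRelative_rankInterval _ _) ⟨?_, ?_⟩
      (ih (insert a N) hN' hM' B (hB.trans (subset_insert _ _)) (by omega) hm) ?_
    · exact fun τ hτ => ⟨hτ.1, hτ.2.1, hτ.2.2.trans (subset_insert _ _)⟩
    · exact fun σ hσ τ hτ hle => ⟨hτ.1, hτ.2.1, (image_subset_image hle).trans hσ.2.2⟩
    · have e : G.rankInterval B (insert a N) \ G.rankInterval B N
          = G.rankInterval (insert a B) (insert a N) := by
        ext τ
        constructor
        · rintro ⟨⟨h1, h2, h3⟩, h4⟩
          refine ⟨h1, insert_subset ?_ h2, h3⟩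
          by_contra h5
          exact h4 ⟨h1, h2, (subset_insert_iff_of_notMem h5).1 h3⟩
        · rintro ⟨h1, h2, h3⟩
          rw [insert_subset_iff] at h2
          exact ⟨⟨h1, h2.2, h3⟩, fun h => haM.2 (h.2.2 h2.1)⟩
      rw [e]
      refine ih (insert a N) hN' hM' (insert a B) (insert_subset_insert _ hB) (by omega) ?_
      rw [card_insert_of_notMem haB]
      omega

end MixedGraph

end

noncomputable section

set_option linter.unusedSectionVars false

/-! ### Effective characters -/

section EffectiveCharacters

variable {H : Type*} [Group H]

theorem isEffectiveCharacter_character {M : Type*} [AddCommGroup M] [Module ℂ M]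
    [FiniteDimensional ℂ M] (ρ : Representation ℂ H M) : IsEffectiveCharacter ρ.character := by
  let e : M ≃ₗ[ℂ] (Fin (Module.finrank ℂ M) → ℂ) := (Module.finBasis ℂ M).equivFun
  refine ⟨Module.finrank ℂ M,
    { toFun := fun g => e.conj (ρ g)
      map_one' := by rw [map_one]; exact LinearEquiv.conj_id e
      map_mul' := fun g h => by rw [map_mul]; exact LinearEquiv.conj_comp e _ _ }, ?_⟩
  ext g
  exact (LinearMap.trace_conj' (ρ g) e).symm

theorem IsEffectiveCharacter.zero : IsEffectiveCharacter (0 : H → ℂ) := by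
  refine ⟨0, 1, ?_⟩
  ext g
  rw [Representation.character, Subsingleton.elim ((1 : Representation ℂ H (Fin 0 → ℂ)) g) 0, map_zero]
  rfl

theorem IsEffectiveCharacter.add {φ ψ : H → ℂ} (hφ : IsEffectiveCharacter φ)
    (hψ : IsEffectiveCharacter ψ) : IsEffectiveCharacter (φ + ψ) := by
  obtain ⟨k, ρ, rfl⟩ := hφ
  obtain ⟨l, τ, rfl⟩ := hψ
  convert isEffectiveCharacter_character (ρ.prod τ) using 1
  ext g
  exact (LinearMap.trace_prodMap' (ρ g) (τ g)).symm

theorem IsEffectiveCharacter.sum {ι : Type*} {s : Finset ι} {φ : ι → H → ℂ}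
    (h : ∀ a ∈ s, IsEffectiveCharacter (φ a)) : IsEffectiveCharacter (∑ a ∈ s, φ a) :=
  Finset.sum_induction φ IsEffectiveCharacter (fun _ _ => IsEffectiveCharacter.add)
    IsEffectiveCharacter.zero h

end EffectiveCharacters

/-! ### Traces -/

section Traces

variable {F : Type*} [Field F] {M N P : Type*} [AddCommGroup M] [Module F M] [Module.Finite F M]
  [AddCommGroup N] [Module F N] [Module.Finite F N] [AddCommGroup P] [Module F P]
  [Module.Finite F P]

/-- The trace is additive on short exact sequences. -/
theorem trace_eq_add_of_exact {i : N →ₗ[F] M} {f : M →ₗ[F] P} (hi : Function.Injective i)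
    (hf : Function.Surjective f) (hif : Function.Exact i f) {a : M →ₗ[F] M} {b : N →ₗ[F] N}
    {c : P →ₗ[F] P} (hab : a ∘ₗ i = i ∘ₗ b) (hac : f ∘ₗ a = c ∘ₗ f) :
    LinearMap.trace F M a = LinearMap.trace F N b + LinearMap.trace F P c := by
  obtain ⟨s, hs⟩ := f.exists_rightInverse_of_surjective (LinearMap.range_eq_top.2 hf)
  obtain ⟨r, hr⟩ := i.exists_leftInverse_of_injective (LinearMap.ker_eq_bot.2 hi)
  let π : M →ₗ[F] N := r ∘ₗ (LinearMap.id - s ∘ₗ f)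
  have hs' : ∀ x, f (s x) = x := fun x => LinearMap.congr_fun hs x
  have hr' : ∀ x, r (i x) = x := fun x => LinearMap.congr_fun hr x
  have hfi : ∀ x, f (i x) = 0 := fun x => (hif _).2 ⟨x, rfl⟩
  have hπ : ∀ x, i (π x) = x - s (f x) := by
    intro x
    obtain ⟨y, hy⟩ := (hif (x - s (f x))).1 (by rw [map_sub, hs', sub_self])
    simp only [π, LinearMap.comp_apply, LinearMap.sub_apply, LinearMap.id_apply]
    rw [← hy, hr']
  have hdec : a = (a ∘ₗ i) ∘ₗ π + (a ∘ₗ s) ∘ₗ f := by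
    ext x
    simp [hπ]
  have h1 : π ∘ₗ (a ∘ₗ i) = b := by
    rw [hab]
    ext x
    simp [π, hfi, hr']
  have h2 : f ∘ₗ (a ∘ₗ s) = c := by
    rw [← LinearMap.comp_assoc, hac, LinearMap.comp_assoc, hs, LinearMap.comp_id]
  rw [hdec, map_add, LinearMap.trace_comp_comm' π (a ∘ₗ i), LinearMap.trace_comp_comm' f (a ∘ₗ s),
    h1, h2]

/-- The sequence 0 → p ∩ ker f → p → f(p) → 0 is exact and compatible with a. It is used with p the
chains of one degree and f the boundary. -/
theorem trace_restrict_eq_add {a f : M →ₗ[F] M} (hcomm : ∀ x, f (a x) = a (f x))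
    (p : Submodule F M) (hp : ∀ x ∈ p, a x ∈ p)
    (hk : ∀ x ∈ p ⊓ LinearMap.ker f, a x ∈ p ⊓ LinearMap.ker f)
    (hr : ∀ x ∈ p.map f, a x ∈ p.map f) :
    LinearMap.trace F p (a.restrict hp) =
      LinearMap.trace F _ (a.restrict hk) + LinearMap.trace F _ (a.restrict hr) := by
  refine trace_eq_add_of_exact (i := Submodule.inclusion inf_le_left)
    (f := f.restrict fun x hx => Submodule.mem_map_of_mem hx)
    (Submodule.inclusion_injective _) ?_ ?_ ?_ ?_
  · rintro ⟨_, x, hx, rfl⟩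
    exact ⟨⟨x, hx⟩, rfl⟩
  · rintro ⟨x, hx⟩
    constructor
    · intro h
      exact ⟨⟨x, hx, congrArg Subtype.val h⟩, rfl⟩
    · rintro ⟨⟨y, hy⟩, h⟩
      obtain rfl : y = x := congrArg Subtype.val h
      exact Subtype.ext hy.2
  · ext x; rfl
  · ext x; exact hcomm x

end Traces

/-! ### Permutation characters on chains and the Hopf trace formula -/

namespace RelComplex

open Finset
open scoped Pointwise

variable {W : Type*} [DecidableEq W] [Fintype W] {κ : W → ℕ} {Φ : Set (Finset W)}
  {H : Type*} [Group H] [MulAction H W]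

/-- The permutation representation on the chains. -/
def chainRep (H W : Type*) [DecidableEq W] [Group H] [MulAction H W] :
    Representation ℂ H (Finset W →₀ ℂ) where
  toFun g := Finsupp.lmapDomain ℂ ℂ (g • ·)
  map_one' := Finsupp.lhom_ext fun τ c => by simp
  map_mul' g h := Finsupp.lhom_ext fun τ c => by simp [mul_smul]

theorem chainRep_single (g : H) (τ : Finset W) (c : ℂ) :
    chainRep H W g (Finsupp.single τ c) = Finsupp.single (g • τ) c := by
  simp [chainRep]

theorem chainRep_apply (g : H) (x : Finset W →₀ ℂ) (τ : Finset W) :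
    chainRep H W g x τ = x (g⁻¹ • τ) := by
  have := Finsupp.mapDomain_apply (MulAction.injective g) x (g⁻¹ • τ)
  rwa [smul_inv_smul] at this

/-- Boundary signs depend only on colors, which the action preserves; hence permuting faces needs no
orientation signs. -/
theorem boundary_chainRep (hκ : ∀ (g : H) w, κ (g • w) = κ w)
    (hΦ : ∀ (g : H) τ, g • τ ∈ Φ ↔ τ ∈ Φ) (g : H) (x : Finset W →₀ ℂ) :
    boundary ℂ κ Φ (chainRep H W g x) = chainRep H W g (boundary ℂ κ Φ x) := by
  ext τ
  rw [chainRep_apply, boundary_apply, boundary_apply, hΦ]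
  split_ifs with h
  · refine Fintype.sum_equiv (MulAction.toPerm g⁻¹) _ _ fun w => ?_
    simp only [MulAction.toPerm_apply, smul_mem_smul_finset_iff, chainRep_apply,
      smul_finset_insert]
    have : #{u ∈ g⁻¹ • τ | κ u < κ (g⁻¹ • w)} = #{u ∈ τ | κ u < κ w} := by
      refine card_bij' (fun u _ => g • u) (fun u _ => g⁻¹ • u) ?_ ?_ ?_ ?_
      · intro u hu
        rw [mem_filter, mem_inv_smul_finset_iff, hκ] at hu
        rw [mem_filter, hκ]
        exact hu
      · intro u hu
        rw [mem_filter] at hu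
        rw [mem_filter, hκ, hκ, smul_mem_smul_finset_iff]
        exact hu
      · intro u _; simp
      · intro u _; simp
    rw [this]
  · rfl

theorem chainRep_mem_chains (hΦ : ∀ (g : H) τ, g • τ ∈ Φ ↔ τ ∈ Φ) (g : H) {i : ℕ}
    {x : Finset W →₀ ℂ} (hx : x ∈ chains ℂ Φ i) : chainRep H W g x ∈ chains ℂ Φ i := by
  rw [mem_chains] at hx ⊢
  intro τ hτ
  rw [chainRep_apply] at hτ
  have := hx _ hτ
  rwa [hΦ, card_smul_finset] at this

open Classical in
theorem trace_chainRep_chains (hΦ : ∀ (g : H) τ, g • τ ∈ Φ ↔ τ ∈ Φ) (g : H) (i : ℕ) :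
    LinearMap.trace ℂ (chains ℂ Φ i)
      ((chainRep H W g).restrict fun _ hx => chainRep_mem_chains hΦ g hx)
      = (#{τ : Finset W | τ ∈ Φ ∧ #τ = i ∧ g • τ = τ} : ℂ) := by
  let ι := (chains ℂ Φ i).subtype
  let π : (Finset W →₀ ℂ) →ₗ[ℂ] chains ℂ Φ i :=
    Finsupp.restrictDom ℂ ℂ {σ : Finset W | σ ∈ Φ ∧ #σ = i}
  have hπ : ∀ x : chains ℂ Φ i, π x = x := fun x =>
    LinearMap.congr_fun (Finsupp.restrictDom_comp_subtype {σ : Finset W | σ ∈ Φ ∧ #σ = i}) x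
  have h1 : (chainRep H W g).restrict (fun _ hx => chainRep_mem_chains hΦ g hx)
      = π ∘ₗ (chainRep H W g ∘ₗ ι) := by
    ext x : 1
    exact (hπ ((chainRep H W g).restrict (fun _ hx => chainRep_mem_chains hΦ g hx) x)).symm
  -- Cyclicity moves the projection to the other side, so the trace can be read off the basis of all
  -- faces: a face contributes one if it is fixed and in the right degree.
  rw [h1, LinearMap.trace_comp_comm', LinearMap.trace_eq_matrix_trace ℂ Finsupp.basisSingleOne,
    Matrix.trace, card_filter, Nat.cast_sum]
  refine sum_congr rfl fun τ _ => ?_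
  rw [Matrix.diag_apply, LinearMap.toMatrix_apply]
  simp only [Finsupp.coe_basisSingleOne, LinearMap.comp_apply, Finsupp.basisSingleOne_repr,
    LinearEquiv.refl_apply, ι, Submodule.subtype_apply]
  have h2 : ((π (Finsupp.single τ 1) : chains ℂ Φ i) : Finset W →₀ ℂ)
      = if τ ∈ Φ ∧ #τ = i then Finsupp.single τ 1 else 0 := by
    have : ((π (Finsupp.single τ 1) : chains ℂ Φ i) : Finset W →₀ ℂ)
      = (Finsupp.single τ 1).filter (· ∈ {σ : Finset W | σ ∈ Φ ∧ #σ = i}) := rfl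
    rw [this]
    split_ifs with h
    · exact Finsupp.filter_single_of_pos _ h
    · exact Finsupp.filter_single_of_neg _ h
  rw [h2]
  by_cases h : τ ∈ Φ ∧ #τ = i
  · rw [if_pos h, chainRep_single, Finsupp.single_apply]
    simp [h]
  · rw [if_neg h, map_zero, if_neg (fun h' => h ⟨h'.1, h'.2.1⟩)]
    simp

open Classical in
/-- The alternating sum of the permutation characters on the faces of a family without homology
below the top is effective. -/
theorem isEffectiveCharacter_alternating (hrel : IsRelative κ Φ)
    (hκ : ∀ (g : H) w, κ (g • w) = κ w) (hΦ : ∀ (g : H) τ, g • τ ∈ Φ ↔ τ ∈ Φ) (N : ℕ)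
    (hv : ∀ j < N, Vanishes ℂ κ Φ j) :
    IsEffectiveCharacter fun g : H => ∑ j ∈ range (N + 1),
      (-1 : ℂ) ^ (N - j) * (#{τ : Finset W | τ ∈ Φ ∧ #τ = j ∧ g • τ = τ} : ℂ) := by
  have hcyc : ∀ (j : ℕ) (g : H), ∀ x ∈ cycles ℂ κ Φ j, chainRep H W g x ∈ cycles ℂ κ Φ j := by
    rintro j g x ⟨h1, h2⟩
    refine ⟨chainRep_mem_chains hΦ g h1, ?_⟩
    rw [SetLike.mem_coe, LinearMap.mem_ker] at h2 ⊢
    rw [boundary_chainRep hκ hΦ, h2, map_zero]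
  -- Below N every cycle is a boundary, so the trace on cycles of degree j + 1 is the trace on
  -- chains of that degree minus the trace on cycles of degree j. Iterating gives the alternating
  -- sum as the character of the cycles of degree N.
  have htrace : ∀ (g : H), ∀ j ≤ N, LinearMap.trace ℂ (cycles ℂ κ Φ j)
      ((chainRep H W g).restrict (hcyc j g)) = ∑ k ∈ range (j + 1),
      (-1 : ℂ) ^ (j - k) * (#{τ : Finset W | τ ∈ Φ ∧ #τ = k ∧ g • τ = τ} : ℂ) := by
    intro g j
    induction j with
    | zero =>
      intro _
      have h0 : cycles ℂ κ Φ 0 = chains ℂ Φ 0 := by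
        refine le_antisymm inf_le_left fun x hx => ⟨hx, ?_⟩
        exact LinearMap.mem_ker.2 (boundary_chains_zero hx)
      have key : ∀ (p : Submodule ℂ (Finset W →₀ ℂ)) (hp : ∀ x ∈ p, chainRep H W g x ∈ p)
          (_ : p = chains ℂ Φ 0), LinearMap.trace ℂ p ((chainRep H W g).restrict hp)
          = (#{τ : Finset W | τ ∈ Φ ∧ #τ = 0 ∧ g • τ = τ} : ℂ) := by
        rintro p hp rfl
        exact trace_chainRep_chains hΦ g 0
      rw [key _ _ h0]
      simp
    | succ j ih =>
      intro hj
      have hB : (chains ℂ Φ (j + 1)).map (boundary ℂ κ Φ) = cycles ℂ κ Φ j := by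
        refine le_antisymm ?_ (hv j (by omega))
        rintro _ ⟨x, hx, rfl⟩
        exact ⟨boundary_mem_chains hx, LinearMap.mem_ker.2 (boundary_boundary hrel hx)⟩
      have hBmem : ∀ x ∈ (chains ℂ Φ (j + 1)).map (boundary ℂ κ Φ),
          chainRep H W g x ∈ (chains ℂ Φ (j + 1)).map (boundary ℂ κ Φ) := by
        rw [hB]; exact hcyc j g
      have key : ∀ (p : Submodule ℂ (Finset W →₀ ℂ)) (hp : ∀ x ∈ p, chainRep H W g x ∈ p)
          (_ : p = cycles ℂ κ Φ j), LinearMap.trace ℂ p ((chainRep H W g).restrict hp)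
          = LinearMap.trace ℂ (cycles ℂ κ Φ j) ((chainRep H W g).restrict (hcyc j g)) := by
        rintro p hp rfl
        rfl
      have h1 := trace_restrict_eq_add (boundary_chainRep hκ hΦ g) (chains ℂ Φ (j + 1))
        (fun _ hx => chainRep_mem_chains hΦ g hx) (hcyc (j + 1) g) hBmem
      rw [trace_chainRep_chains hΦ g (j + 1), key _ _ hB, ih (by omega)] at h1
      have h3 : (#{τ : Finset W | τ ∈ Φ ∧ #τ = j + 1 ∧ g • τ = τ} : ℂ) =
          LinearMap.trace ℂ (cycles ℂ κ Φ (j + 1)) ((chainRep H W g).restrict (hcyc (j + 1) g)) +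
          _ := h1
      rw [sum_range_succ, Nat.sub_self, pow_zero, one_mul]
      have h2 : ∀ k ∈ range (j + 1), (-1 : ℂ) ^ (j + 1 - k) *
          (#{τ : Finset W | τ ∈ Φ ∧ #τ = k ∧ g • τ = τ} : ℂ) = - ((-1 : ℂ) ^ (j - k) *
          (#{τ : Finset W | τ ∈ Φ ∧ #τ = k ∧ g • τ = τ} : ℂ)) := by
        intro k hk
        rw [mem_range] at hk
        rw [show j + 1 - k = (j - k) + 1 by omega, pow_succ]
        ring
      rw [sum_congr rfl h2, sum_neg_distrib]
      linear_combination -h3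
  have := isEffectiveCharacter_character (H := H) (M := cycles ℂ κ Φ N)
    ((chainRep H W).subrepresentation (cycles ℂ κ Φ N) (hcyc N))
  convert this using 1
  ext g
  exact (htrace g N le_rfl).symm

end RelComplex

end

noncomputable section

set_option linter.unusedSectionVars false

/-! ### Positive combinations of Boolean intervals -/

namespace BooleanIntervals

open Finset

/-- Subsets of size `a` inject into the subsets of size `b` that contain them, if `a ≤ b` and
`a + b` is at most the size of the ground set. -/
theorem exists_injOn_superset {ι : Type*} [DecidableEq ι] (Ω : Finset ι) {a b : ℕ} (hab : a ≤ b)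
    (hΩ : a + b ≤ #Ω) : ∃ ψ : Finset ι → Finset ι, Set.InjOn ψ (powersetCard a Ω) ∧
      ∀ R ∈ powersetCard a Ω, R ⊆ ψ R ∧ ψ R ∈ powersetCard b Ω := by
  let t : powersetCard a Ω → Finset (Finset ι) := fun R => {Q ∈ powersetCard b Ω | R.1 ⊆ Q}
  -- Hall's condition by double counting: each R has C(#Ω - a, b - a) supersets of size b, and each
  -- Q contains C(b, a) = C(b, b - a) sets of size a, which is no more because b ≤ #Ω - a.
  have hall : ∀ s : Finset (powersetCard a Ω), #s ≤ #(s.biUnion t) := by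
    intro s
    have h1 : ∀ R ∈ s, (#Ω - a).choose (b - a) ≤
        #((s.biUnion t).bipartiteAbove (fun R Q => R.1 ⊆ Q) R) := by
      intro R hR
      obtain ⟨hRΩ, hRa⟩ := mem_powersetCard.1 R.2
      have hc : (#Ω - a).choose (b - a) = #(powersetCard (b - a) (Ω \ R.1)) := by
        rw [card_powersetCard, card_sdiff_of_subset hRΩ, hRa]
      rw [hc]
      refine card_le_card_of_injOn (fun S => R.1 ∪ S) ?_ ?_
      · intro S hS
        obtain ⟨h2, h3⟩ := mem_powersetCard.1 (mem_coe.1 hS)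
        have hdisj : Disjoint R.1 S := (disjoint_sdiff (s := R.1) (t := Ω)).mono_right h2
        rw [mem_coe, mem_bipartiteAbove, mem_biUnion]
        refine ⟨⟨R, hR, mem_filter.2 ⟨mem_powersetCard.2 ⟨union_subset hRΩ (h2.trans sdiff_subset),
          ?_⟩, subset_union_left⟩⟩, subset_union_left⟩
        rw [card_union_of_disjoint hdisj]
        omega
      · intro S hS S' hS' h
        obtain ⟨h2, -⟩ := mem_powersetCard.1 (mem_coe.1 hS)
        obtain ⟨h2', -⟩ := mem_powersetCard.1 (mem_coe.1 hS')
        have hd : Disjoint R.1 S := (disjoint_sdiff (s := R.1) (t := Ω)).mono_right h2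
        have hd' : Disjoint R.1 S' := (disjoint_sdiff (s := R.1) (t := Ω)).mono_right h2'
        have := congrArg (· \ R.1) h
        simpa [union_sdiff_cancel_left hd, union_sdiff_cancel_left hd'] using this
    have h2 : ∀ Q ∈ s.biUnion t, #(s.bipartiteBelow (fun R Q => R.1 ⊆ Q) Q) ≤ b.choose a := by
      intro Q hQ
      obtain ⟨R, -, hQR⟩ := mem_biUnion.1 hQ
      obtain ⟨-, hQb⟩ := mem_powersetCard.1 (mem_filter.1 hQR).1
      rw [← hQb, ← card_powersetCard]
      refine card_le_card_of_injOn Subtype.val ?_ Subtype.val_injective.injOn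
      intro R' hR'
      rw [mem_coe, mem_bipartiteBelow] at hR'
      exact mem_powersetCard.2 ⟨hR'.2, (mem_powersetCard.1 R'.2).2⟩
    have h3 := card_mul_le_card_mul _ h1 h2
    have h4 : b.choose a ≤ (#Ω - a).choose (b - a) := by
      rw [← Nat.choose_symm hab]
      exact Nat.choose_le_choose _ (by omega)
    have h5 : 0 < (#Ω - a).choose (b - a) := Nat.choose_pos (by omega)
    exact Nat.le_of_mul_le_mul_right (h3.trans (Nat.mul_le_mul_left _ h4)) h5
  obtain ⟨f, hf, hft⟩ := (all_card_le_biUnion_card_iff_exists_injective t).1 hall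
  classical
  refine ⟨fun R => if h : R ∈ powersetCard a Ω then f ⟨R, h⟩ else ∅, ?_, ?_⟩
  · intro R hR S hS h
    rw [mem_coe] at hR hS
    simp only [dif_pos hR, dif_pos hS] at h
    exact congrArg Subtype.val (hf h)
  · intro R hR
    simp only [dif_pos hR]
    have := mem_filter.1 (hft ⟨R, hR⟩)
    exact ⟨this.2, this.1⟩

variable {Y : Type*} [AddCommGroup Y] {P : AddSubmonoid Y} {β : Finset ℕ → Y} {D : Finset ℕ}
  {m : ℕ}

/-- The sums of `β` over the intervals `[T, T ∪ R]` with `|T| ≤ m` lie in `P`. -/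
def IntervalPositive (P : AddSubmonoid Y) (β : Finset ℕ → Y) (D : Finset ℕ) (m : ℕ) : Prop :=
  ∀ T R, Disjoint T R → T ∪ R ⊆ D → #T ≤ m → ∑ S ∈ R.powerset, β (T ∪ S) ∈ P

/-- The binomial counts the p-subsets A of S. Grouping by A gives the intervals from `T ∪ A` to `T ∪
R`, with bottoms of size at most m. -/
theorem sum_choose_self_mem (h : IntervalPositive P β D m) {T R : Finset ℕ} {p : ℕ}
    (hTR : Disjoint T R) (hD : T ∪ R ⊆ D) (hp : #T + p ≤ m) :
    ∑ S ∈ R.powerset, (#S).choose p • β (T ∪ S) ∈ P := by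
  have e : ∑ S ∈ R.powerset, (#S).choose p • β (T ∪ S)
      = ∑ A ∈ powersetCard p R, ∑ S ∈ (R \ A).powerset, β (T ∪ A ∪ S) := by
    have h1 : ∀ S ∈ R.powerset, (#S).choose p • β (T ∪ S)
        = ∑ A ∈ powersetCard p S, β (T ∪ S) := by
      intro S _
      rw [sum_const, card_powersetCard]
    rw [sum_congr rfl h1, sum_sigma', sum_sigma']
    refine sum_bij' (fun x _ => ⟨x.2, x.1 \ x.2⟩) (fun x _ => ⟨x.1 ∪ x.2, x.1⟩) ?_ ?_ ?_ ?_ ?_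
    · rintro ⟨S, A⟩ hx
      simp only [mem_sigma, mem_powerset, mem_powersetCard] at hx ⊢
      exact ⟨⟨hx.2.1.trans hx.1, hx.2.2⟩, sdiff_subset_sdiff hx.1 subset_rfl⟩
    · rintro ⟨A, S⟩ hx
      simp only [mem_sigma, mem_powerset, mem_powersetCard] at hx ⊢
      exact ⟨union_subset hx.1.1 (hx.2.trans sdiff_subset), subset_union_left, hx.1.2⟩
    · rintro ⟨S, A⟩ hx
      simp only [mem_sigma, mem_powerset, mem_powersetCard] at hx
      simp [union_sdiff_of_subset hx.2.1]
    · rintro ⟨A, S⟩ hx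
      simp only [mem_sigma, mem_powerset, mem_powersetCard] at hx
      have : Disjoint A S := disjoint_sdiff.mono_right hx.2
      simp [union_sdiff_cancel_left this]
    · rintro ⟨S, A⟩ hx
      simp only [mem_sigma, mem_powerset, mem_powersetCard] at hx
      simp only
      rw [union_assoc, union_sdiff_of_subset hx.2.1]
  rw [e]
  refine sum_mem fun A hA => ?_
  obtain ⟨h1, h2⟩ := mem_powersetCard.1 hA
  refine h (T ∪ A) (R \ A) ?_ ?_ ?_
  · exact disjoint_union_left.2 ⟨hTR.mono_right sdiff_subset, disjoint_sdiff⟩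
  · rw [union_assoc, union_sdiff_of_subset h1]; exact hD
  · rw [card_union_of_disjoint (hTR.mono_right h1)]; omega

/-- For i = p the coefficient is C(#S, p), the previous lemma. For i < p split off an element a:
sets without a give the same sum over R, and sets with a give the sum with a moved into T and p
lowered by one, because the coefficient depends only on #S - p. -/
theorem sum_choose_mem (h : IntervalPositive P β D m) (R : Finset ℕ) : ∀ (T : Finset ℕ) (p i : ℕ),
    Disjoint T R → T ∪ R ⊆ D → #T + p ≤ m → i ≤ p →
      ∑ S ∈ R.powerset with p ≤ #S, (i + #S - p).choose i • β (T ∪ S) ∈ P := by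
  induction R using Finset.induction_on with
  | empty =>
    intro T p i hTR hD hp hi
    rw [powerset_empty, sum_filter, sum_singleton, card_empty]
    split_ifs with h0
    · obtain rfl : p = 0 := by omega
      obtain rfl : i = 0 := by omega
      simpa using h T ∅ (disjoint_empty_right _) hD hp
    · exact zero_mem _
  | insert a R ha ih =>
    intro T p i hTR hD hp hi
    rcases hi.eq_or_lt with rfl | hi
    · rw [sum_filter]
      convert sum_choose_self_mem h hTR hD hp using 1
      refine sum_congr rfl fun S _ => ?_
      split_ifs with h0
      · rw [Nat.add_sub_cancel_left]
      · rw [Nat.choose_eq_zero_of_lt (by omega), zero_smul]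
    · rw [disjoint_insert_right] at hTR
      rw [sum_filter, sum_powerset_insert ha]
      refine add_mem ?_ ?_
      · rw [← sum_filter]
        exact ih T p i hTR.2 ((union_subset_union_right (subset_insert _ _)).trans hD) hp hi.le
      · have key := ih (insert a T) (p - 1) i (disjoint_insert_left.2 ⟨ha, hTR.2⟩)
          (by rwa [insert_union, ← union_insert]) (by
            rw [card_insert_of_notMem hTR.1]; omega) (by omega)
        rw [sum_filter] at key
        convert key using 1
        refine sum_congr rfl fun S hS => ?_
        have haS : a ∉ S := fun h' => ha (mem_powerset.1 hS h')
        rw [card_insert_of_notMem haS, union_insert, insert_union]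
        by_cases h0 : p ≤ #S + 1
        · rw [if_pos h0, if_pos (by omega), show i + (#S + 1) - p = i + #S - (p - 1) by omega]
        · rw [if_neg h0, if_neg (by omega)]

/-- Each element x added to Q contributes the interval with bottom `insert x T`; hence the room for
one more element in the bound on T. -/
theorem sum_powerset_sub_mem (h : IntervalPositive P β D m) {T : Finset ℕ} (hT : #T + 1 ≤ m)
    {Q Q' : Finset ℕ} (hQ : Q ⊆ Q') (hTQ : Disjoint T Q') (hD : T ∪ Q' ⊆ D) :
    ∑ S ∈ Q'.powerset, β (T ∪ S) - ∑ S ∈ Q.powerset, β (T ∪ S) ∈ P := by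
  obtain ⟨M, hM⟩ : ∃ M, M = Q' \ Q := ⟨_, rfl⟩
  induction M using Finset.induction_on generalizing Q with
  | empty =>
    have : Q = Q' := subset_antisymm hQ (by rw [← sdiff_eq_empty_iff_subset, hM])
    rw [this, sub_self]
    exact zero_mem _
  | insert x M hx ih =>
    have hxM : x ∈ Q' \ Q := hM ▸ mem_insert_self _ _
    rw [mem_sdiff] at hxM
    have hins := insert_subset hxM.1 hQ
    have h1 := ih hins (by rw [sdiff_insert, ← hM, erase_insert hx])
    have hxT : x ∉ T := fun h' => disjoint_left.1 hTQ h' hxM.1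
    have h2 : ∑ S ∈ Q.powerset, β (insert x T ∪ S) ∈ P := by
      refine h _ _ (disjoint_insert_left.2 ⟨hxM.2, hTQ.mono_right hQ⟩) ?_ ?_
      · rw [insert_union, ← union_insert]
        exact (union_subset_union_right hins).trans hD
      · rw [card_insert_of_notMem hxT]; exact hT
    have h3 := add_mem h1 h2
    rw [sum_powerset_insert hxM.2] at h3
    convert h3 using 1
    simp only [union_insert, insert_union]
    abel

/-- For e = 0, match a-sets with b-sets above them: matched pairs differ by a positive amount and
unmatched b-sets are positive. For e > 0 remove x from X: the sets S with x pose the same problem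
with x in T and e, a, b, `#Ω` each lowered by one, which preserves a + b ≤ #Ω + e. Keeping X
separate from Ω lets x leave the first while the sets R still range over the second. -/
theorem sum_powersetCard_sub_mem (h : IntervalPositive P β D m) (e : ℕ) :
    ∀ (X T Ω : Finset ℕ) (a b : ℕ), Disjoint T X → T ∪ X ⊆ D → X ⊆ Ω → #T + e + 1 ≤ m → e ≤ a →
      a ≤ b → a + b ≤ #Ω + e →
      ∑ R ∈ powersetCard b Ω, ∑ S ∈ (R ∩ X).powerset with e ≤ #S, β (T ∪ S) -
        ∑ R ∈ powersetCard a Ω, ∑ S ∈ (R ∩ X).powerset with e ≤ #S, β (T ∪ S) ∈ P := by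
  induction e with
  | zero =>
    intro X T Ω a b hTX hD hX hT _ hab hΩ
    simp only [zero_le, filter_true]
    obtain ⟨ψ, hψ, hψ'⟩ := exists_injOn_superset Ω hab hΩ
    have himg : (powersetCard a Ω).image ψ ⊆ powersetCard b Ω := by
      intro Q hQ
      obtain ⟨R, hR, rfl⟩ := mem_image.1 hQ
      exact (hψ' R hR).2
    rw [← sum_sdiff himg, sum_image hψ, add_sub_assoc, ← sum_sub_distrib]
    have hdis : ∀ R : Finset ℕ, Disjoint T (R ∩ X) := fun R => hTX.mono_right inter_subset_right
    have hsub : ∀ R : Finset ℕ, T ∪ R ∩ X ⊆ D := fun R =>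
      (union_subset_union_right inter_subset_right).trans hD
    refine add_mem (sum_mem fun R _ => h T _ (hdis R) (hsub R) (by omega)) (sum_mem fun R hR => ?_)
    exact sum_powerset_sub_mem h (by omega) (inter_subset_inter_right (hψ' R hR).1) (hdis _)
      (hsub _)
  | succ e ihe =>
    intro X
    induction X using Finset.induction_on with
    | empty =>
      intro T Ω a b _ _ _ _ _ _ _
      simp [sum_filter]
    | insert x X hx ihX =>
      intro T Ω a b hTX hD hX hT hea hab hΩ
      rw [disjoint_insert_right] at hTX
      have hxΩ : x ∈ Ω := hX (mem_insert_self _ _)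
      have hXΩ : X ⊆ Ω := (subset_insert _ _).trans hX
      have split : ∀ c, 1 ≤ c → ∑ R ∈ powersetCard c Ω,
          ∑ S ∈ (R ∩ insert x X).powerset with e + 1 ≤ #S, β (T ∪ S)
          = ∑ R ∈ powersetCard c Ω, ∑ S ∈ (R ∩ X).powerset with e + 1 ≤ #S, β (T ∪ S) +
            ∑ R ∈ powersetCard (c - 1) (Ω.erase x),
              ∑ S ∈ (R ∩ X).powerset with e ≤ #S, β (insert x T ∪ S) := by
        intro c hc
        have h1 : ∀ R ∈ powersetCard c Ω,
            ∑ S ∈ (R ∩ insert x X).powerset with e + 1 ≤ #S, β (T ∪ S)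
            = ∑ S ∈ (R ∩ X).powerset with e + 1 ≤ #S, β (T ∪ S) +
              if x ∈ R then ∑ S ∈ (R ∩ X).powerset with e ≤ #S, β (insert x T ∪ S) else 0 := by
          intro R _
          split_ifs with hxR
          · rw [inter_insert_of_mem hxR, sum_filter, sum_powerset_insert (by simp [hx]),
              ← sum_filter]
            congr 1
            rw [sum_filter]
            refine sum_congr rfl fun S hS => ?_
            have hxS : x ∉ S := fun h' => hx (mem_inter.1 (mem_powerset.1 hS h')).2
            rw [card_insert_of_notMem hxS, union_insert, insert_union]
            simp
          · rw [inter_insert_of_notMem hxR, add_zero]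
        rw [sum_congr rfl h1, sum_add_distrib, ← sum_filter]
        congr 1
        refine sum_bij' (fun R _ => R.erase x) (fun R _ => insert x R) ?_ ?_ ?_ ?_ ?_
        · intro R hR
          rw [mem_filter, mem_powersetCard] at hR
          rw [mem_powersetCard, card_erase_of_mem hR.2]
          exact ⟨erase_subset_erase _ hR.1.1, by omega⟩
        · intro R hR
          rw [mem_powersetCard] at hR
          have hxR : x ∉ R := fun h' => by simpa using hR.1 h'
          rw [mem_filter, mem_powersetCard, card_insert_of_notMem hxR]
          exact ⟨⟨insert_subset hxΩ (hR.1.trans (erase_subset _ _)), by omega⟩,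
            mem_insert_self _ _⟩
        · intro R hR
          exact insert_erase (mem_filter.1 hR).2
        · intro R hR
          rw [mem_powersetCard] at hR
          exact erase_insert fun h' => by simpa using hR.1 h'
        · intro R _
          rw [erase_inter, erase_eq_of_notMem (by simp [hx])]
      rw [split a (by omega), split b (by omega), add_sub_add_comm]
      refine add_mem ?_ ?_
      · exact ihX T Ω a b hTX.2 ((union_subset_union_right (subset_insert _ _)).trans hD) hXΩ hT
          hea hab hΩ
      · refine ihe X (insert x T) (Ω.erase x) (a - 1) (b - 1)
          (disjoint_insert_left.2 ⟨hx, hTX.2⟩) (by rwa [insert_union, ← union_insert])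
          (subset_erase.2 ⟨hXΩ, hx⟩) ?_ (by omega) (by omega) ?_
        · rw [card_insert_of_notMem hTX.1]; omega
        · have := card_pos.2 ⟨x, hxΩ⟩
          rw [card_erase_of_mem hxΩ]; omega

/-- Sums over all `b`-sets dominate sums over all `a`-sets. -/
theorem sum_sub_sum_mem (h : IntervalPositive P β D m) {e a b : ℕ}
    (hβ : ∀ S ⊆ D, #S < e → β S = 0) (hm : e + 1 ≤ m) (ha : e ≤ a) (hab : a ≤ b)
    (hD : a + b ≤ #D + e) :
    ∑ R ∈ powersetCard b D, ∑ S ∈ R.powerset, β S -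
      ∑ R ∈ powersetCard a D, ∑ S ∈ R.powerset, β S ∈ P := by
  have key := sum_powersetCard_sub_mem h e D ∅ D a b (disjoint_empty_left _) (by simp) subset_rfl
    (by simpa using hm) ha hab hD
  have : ∀ c, ∑ R ∈ powersetCard c D, ∑ S ∈ (R ∩ D).powerset with e ≤ #S, β (∅ ∪ S)
      = ∑ R ∈ powersetCard c D, ∑ S ∈ R.powerset, β S := by
    intro c
    refine sum_congr rfl fun R hR => ?_
    have hRD := (mem_powersetCard.1 hR).1
    rw [inter_eq_left.2 hRD, sum_filter]
    refine sum_congr rfl fun S hS => ?_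
    split_ifs with h0
    · rw [empty_union]
    · rw [hβ S ((mem_powerset.1 hS).trans hRD) (by omega)]
  rwa [this, this] at key

theorem sum_powersetCard_sdiff (α : Finset ℕ → Y) (D : Finset ℕ) (k : ℕ) :
    ∑ Q ∈ powersetCard k D, ∑ _x ∈ D \ Q, α Q
      = ∑ R ∈ powersetCard (k + 1) D, ∑ x ∈ R, α (R.erase x) := by
  rw [sum_sigma', sum_sigma']
  refine sum_bij' (fun x _ => ⟨insert x.2 x.1, x.2⟩) (fun x _ => ⟨x.1.erase x.2, x.2⟩)
    ?_ ?_ ?_ ?_ ?_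
  · rintro ⟨Q, x⟩ hx
    simp only [mem_sigma, mem_powersetCard, mem_sdiff] at hx ⊢
    exact ⟨⟨insert_subset hx.2.1 hx.1.1, by rw [card_insert_of_notMem hx.2.2, hx.1.2]⟩,
      mem_insert_self _ _⟩
  · rintro ⟨R, x⟩ hx
    simp only [mem_sigma, mem_powersetCard, mem_sdiff] at hx ⊢
    exact ⟨⟨(erase_subset _ _).trans hx.1.1, by rw [card_erase_of_mem hx.2, hx.1.2]; rfl⟩,
      hx.1.1 hx.2, notMem_erase _ _⟩
  · rintro ⟨Q, x⟩ hx
    simp only [mem_sigma, mem_powersetCard, mem_sdiff] at hx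
    simp [erase_insert hx.2.2]
  · rintro ⟨R, x⟩ hx
    simp only [mem_sigma, mem_powersetCard] at hx
    simp [insert_erase hx.2]
  · rintro ⟨Q, x⟩ hx
    simp only [mem_sigma, mem_powersetCard, mem_sdiff] at hx
    simp [erase_insert hx.2.2]

/-- Both sides are distributed over the sets R of size k + 1. Since S lies in `R.erase x` for k + 1
- #S elements x of R, the difference has coefficient #S - e at S. Terms with #S < e vanish, and the
rest is `sum_choose_mem` with p = e + 1 and i = 1. -/
theorem smul_sum_sub_smul_sum_mem (h : IntervalPositive P β D m) {e k : ℕ}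
    (hβ : ∀ S ⊆ D, #S < e → β S = 0) (hm : e + 1 ≤ m) :
    ((k : ℤ) + 1 - e) • ∑ R ∈ powersetCard (k + 1) D, ∑ S ∈ R.powerset, β S -
      ((#D : ℤ) - k) • ∑ R ∈ powersetCard k D, ∑ S ∈ R.powerset, β S ∈ P := by
  have h1 : ((#D : ℤ) - k) • ∑ R ∈ powersetCard k D, ∑ S ∈ R.powerset, β S
      = ∑ R ∈ powersetCard (k + 1) D, ∑ x ∈ R, ∑ S ∈ (R.erase x).powerset, β S := by
    have h2 : ∀ Q ∈ powersetCard k D, ((#D : ℤ) - k) • ∑ S ∈ Q.powerset, β S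
        = ∑ x ∈ D \ Q, ∑ S ∈ Q.powerset, β S := by
      intro Q hQ
      obtain ⟨h3, h4⟩ := mem_powersetCard.1 hQ
      have h5 := card_le_card h3
      rw [sum_const, card_sdiff_of_subset h3, ← natCast_zsmul, Nat.cast_sub h5, h4]
    rw [smul_sum, sum_congr rfl h2, sum_powersetCard_sdiff]
  rw [h1, smul_sum, ← sum_sub_distrib]
  refine sum_mem fun R hR => ?_
  obtain ⟨hRD, hRk⟩ := mem_powersetCard.1 hR
  have h2 : ∑ x ∈ R, ∑ S ∈ (R.erase x).powerset, β S
      = ∑ S ∈ R.powerset, ((k : ℤ) + 1 - #S) • β S := by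
    have h3 : ∀ S ∈ R.powerset, ((k : ℤ) + 1 - #S) • β S = ∑ x ∈ R \ S, β S := by
      intro S hS
      have hSR := mem_powerset.1 hS
      rw [sum_const, card_sdiff_of_subset hSR, ← natCast_zsmul, Nat.cast_sub (card_le_card hSR),
        hRk]
      push_cast
      rfl
    rw [sum_congr rfl h3]
    refine sum_comm' fun x S => ?_
    simp only [mem_powerset, mem_sdiff, subset_erase]
    tauto
  have key := sum_choose_mem h R ∅ (e + 1) 1 (disjoint_empty_left _) (by simpa using hRD)
    (by simpa using hm) (by omega)
  rw [h2, smul_sum, ← sum_sub_distrib]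
  rw [sum_filter] at key
  convert key using 1
  refine sum_congr rfl fun S hS => ?_
  rw [← sub_smul, empty_union, Nat.choose_one_right, ← natCast_zsmul]
  split_ifs with h0
  · congr 1
    omega
  · rcases Nat.lt_or_ge (#S) e with h3 | h3
    · rw [hβ S ((mem_powerset.1 hS).trans hRD) h3, smul_zero]
    · rw [show (k : ℤ) + 1 - e - ((k : ℤ) + 1 - #S) = 0 by omega, zero_smul]

end BooleanIntervals

end

/-! ### Flag numbers and positivity on Boolean intervals -/

noncomputable section

set_option linter.unusedSectionVars false

/-- The effective characters form a submonoid of the class functions. -/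
def effectiveCharacters (H : Type*) [Group H] : AddSubmonoid (H → ℂ) where
  carrier := {φ | IsEffectiveCharacter φ}
  add_mem' := IsEffectiveCharacter.add
  zero_mem' := IsEffectiveCharacter.zero

namespace BooleanIntervals

open Finset

variable {Y : Type*} [AddCommGroup Y]

/-- The alternating sum of `α` over the sets between `R` and `R ∪ T`. -/
def alternatingSum (α : Finset ℕ → Y) (T R : Finset ℕ) : Y :=
  ∑ Q ∈ T.powerset, (-1 : ℤ) ^ (#T - #Q) • α (R ∪ Q)

theorem alternatingSum_insert (α : Finset ℕ → Y) {x : ℕ} {T : Finset ℕ} (hx : x ∉ T)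
    (R : Finset ℕ) : alternatingSum α T (insert x R)
      = alternatingSum α T R + alternatingSum α (insert x T) R := by
  simp only [alternatingSum]
  rw [sum_powerset_insert hx, ← add_assoc, ← sum_add_distrib]
  have h1 : ∀ Q ∈ T.powerset, (-1 : ℤ) ^ (#T - #Q) • α (R ∪ Q)
      + (-1 : ℤ) ^ (#(insert x T) - #Q) • α (R ∪ Q) = 0 := by
    intro Q hQ
    have := card_le_card (mem_powerset.1 hQ)
    rw [card_insert_of_notMem hx, show #T + 1 - #Q = (#T - #Q) + 1 by omega, ← add_smul]
    ring_nf
    rw [zero_smul]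
  rw [sum_eq_zero h1, zero_add]
  refine sum_congr rfl fun Q hQ => ?_
  have hxQ : x ∉ Q := fun h => hx (mem_powerset.1 hQ h)
  rw [card_insert_of_notMem hx, card_insert_of_notMem hxQ, union_insert, insert_union,
    Nat.add_sub_add_right]

/-- Partial Möbius inversion: summation over the subsets of R undoes the alternation in the
directions of R and leaves the one in T. -/
theorem sum_alternatingSum (α : Finset ℕ → Y) (R : Finset ℕ) : ∀ T : Finset ℕ, Disjoint T R →
    ∑ S ∈ R.powerset, alternatingSum α (T ∪ S) ∅ = alternatingSum α T R := by
  induction R using Finset.induction_on with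
  | empty => intro T _; simp
  | insert x R hx ih =>
    intro T hT
    rw [disjoint_insert_right] at hT
    rw [sum_powerset_insert hx, ih T hT.2, alternatingSum_insert α hT.1,
      ← ih (insert x T) (disjoint_insert_left.2 ⟨hx, hT.2⟩)]
    simp only [union_insert, insert_union]

end BooleanIntervals

namespace MixedGraph

open Finset RelComplex IdealChains BooleanIntervals
open scoped Pointwise

variable {V : Type*} [Fintype V] [DecidableEq V] {G : MixedGraph V}
  {H : Type*} [Group H] [MulAction H V]

theorem smul_mem_coloringComplex_iff (hH : G.IsActedOnBy H) (g : H) (τ : Finset (Finset V)) :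
    g • τ ∈ G.coloringComplex ↔ τ ∈ G.coloringComplex := by
  have key : ∀ (g : H) (τ : Finset (Finset V)), τ ∈ G.coloringComplex →
      g • τ ∈ G.coloringComplex := by
    intro g τ hτ
    rw [coloringComplex_eq] at hτ ⊢
    obtain ⟨h1, h2, h3⟩ := hτ
    refine ⟨?_, ?_, ?_⟩
    · intro I hI
      obtain ⟨J, hJ, rfl⟩ := mem_smul_finset.1 hI
      obtain ⟨h4, h5, h6⟩ := h1 J hJ
      refine ⟨fun u v huv hv => ?_, ?_, ?_⟩
      · rw [← inv_smul_mem_iff] at hv ⊢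
        exact h4 _ _ ((hH g⁻¹ u v).2.2 huv) hv
      · rwa [Ne, smul_finset_eq_empty]
      · rwa [Ne, smul_finset_eq_univ]
    · intro I hI J hJ _
      obtain ⟨I', hI', rfl⟩ := mem_smul_finset.1 (mem_coe.1 hI)
      obtain ⟨J', hJ', rfl⟩ := mem_smul_finset.1 (mem_coe.1 hJ)
      rcases h2.total hI' hJ' with h | h
      · exact Or.inl (smul_finset_subset_smul_finset h)
      · exact Or.inr (smul_finset_subset_smul_finset h)
    · rintro ⟨u, v⟩ he
      rw [mem_undPairs] at he
      obtain ⟨I, hI, h⟩ := h3 (g⁻¹ • u, g⁻¹ • v) (G.mem_undPairs.2 ((hH g⁻¹ u v).1.2 he))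
      refine ⟨g • I, smul_mem_smul_finset hI, ?_⟩
      simpa only [inv_smul_mem_iff] using h
  refine ⟨fun h => ?_, key g τ⟩
  have := key g⁻¹ _ h
  rwa [inv_smul_smul] at this

theorem image_card_smul (g : H) (τ : Finset (Finset V)) : (g • τ).image card = τ.image card := by
  ext k
  simp only [mem_image]
  constructor
  · rintro ⟨I, hI, rfl⟩
    obtain ⟨J, hJ, rfl⟩ := mem_smul_finset.1 hI
    exact ⟨J, hJ, (card_smul_finset _ _).symm⟩
  · rintro ⟨I, hI, rfl⟩
    exact ⟨g • I, smul_mem_smul_finset hI, card_smul_finset _ _⟩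

open Classical in
/-- The number of faces with rank set `S` fixed by `g`. -/
def flagCount (G : MixedGraph V) (S : Finset ℕ) (g : H) : ℂ :=
  (#{τ : Finset (Finset V) | τ ∈ G.coloringComplex ∧ τ.image card = S ∧ g • τ = τ} : ℂ)

/-- The coefficient of `F_S` in the chromatic quasisymmetric function. -/
def flagCoeff (G : MixedGraph V) (S : Finset ℕ) : H → ℂ :=
  alternatingSum (G.flagCount (H := H)) S ∅

theorem sum_flagCoeff (R : Finset ℕ) :
    ∑ S ∈ R.powerset, G.flagCoeff (H := H) S = G.flagCount R := by
  have := sum_alternatingSum (G.flagCount (H := H)) R ∅ (disjoint_empty_left _)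
  simpa [flagCoeff, alternatingSum] using this

/-- The interval sum is the alternating count of the faces in `rankInterval R (T ∪ R)`. Since #T ≤
m, every degree below #T + #R is also below m + #R, so `vanishes_rankInterval` covers all degrees
below the top. -/
theorem intervalPositive_flagCoeff (hG : G.IsAcyclic) (hH : G.IsActedOnBy H) :
    IntervalPositive (effectiveCharacters H) G.flagCoeff (Icc 1 (Fintype.card V - 1))
      G.minUndirected := by
  classical
  intro T R hTR hD hT
  simp only [flagCoeff]
  rw [sum_alternatingSum _ _ _ hTR]
  have hcard : #(T ∪ R) = #T + #R := card_union_of_disjoint hTR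
  have key := isEffectiveCharacter_alternating (H := H) (κ := card)
    (isRelative_rankInterval (G := G) R (T ∪ R)) (fun g I => card_smul_finset g I)
    (fun g τ => by
      simp only [rankInterval, Set.mem_ofPred_eq, smul_mem_coloringComplex_iff hH,
        image_card_smul]) #(T ∪ R) (fun j hj =>
      vanishes_rankInterval hG (T ∪ R) hD R subset_union_right hj (by omega))
  change IsEffectiveCharacter _
  convert key using 1
  ext g
  let X : Finset (Finset (Finset V)) := {τ | τ ∈ G.rankInterval R (T ∪ R) ∧ g • τ = τ}
  have hX : ∀ τ ∈ X, #τ = #(τ.image card) ∧ R ⊆ τ.image card ∧ τ.image card ⊆ T ∪ R := by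
    intro τ hτ
    obtain ⟨h1, h2, h3⟩ := (mem_filter.1 hτ).2.1
    exact ⟨(card_image_card h1.1).symm, h2, h3⟩
  have e1 : ∑ j ∈ range (#(T ∪ R) + 1), (-1 : ℂ) ^ (#(T ∪ R) - j) *
      (#{τ : Finset (Finset V) | τ ∈ G.rankInterval R (T ∪ R) ∧ #τ = j ∧ g • τ = τ} : ℂ)
      = ∑ τ ∈ X, (-1 : ℂ) ^ (#(T ∪ R) - #τ) := by
    rw [← sum_fiberwise_of_maps_to (s := X) (t := range (#(T ∪ R) + 1)) (g := card)]
    · refine sum_congr rfl fun j _ => ?_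
      have h1 : ∀ τ ∈ X.filter (fun τ => #τ = j), (-1 : ℂ) ^ (#(T ∪ R) - #τ)
          = (-1 : ℂ) ^ (#(T ∪ R) - j) := fun τ hτ => by rw [(mem_filter.1 hτ).2]
      rw [sum_congr rfl h1, sum_const, nsmul_eq_mul, mul_comm]
      congr 3
      ext τ
      simp only [X, mem_filter, mem_univ, true_and]
      tauto
    · intro τ hτ
      obtain ⟨h1, -, h3⟩ := hX τ hτ
      rw [mem_range, h1]
      exact Nat.lt_succ_of_le (card_le_card h3)
  rw [e1, alternatingSum, Finset.sum_apply,
    ← sum_fiberwise_of_maps_to (s := X) (t := T.powerset) (g := fun τ => τ.image card \ R)]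
  · refine sum_congr rfl fun Q hQ => ?_
    rw [mem_powerset] at hQ
    have hRQ : Disjoint R Q := (hTR.mono_left hQ).symm
    have hfib : X.filter (fun τ => τ.image card \ R = Q) 
        = (univ : Finset (Finset (Finset V))).filter fun τ =>
          τ ∈ G.coloringComplex ∧ τ.image card = R ∪ Q ∧ g • τ = τ := by
      ext τ
      simp only [X, mem_filter, mem_univ, true_and]
      constructor
      · rintro ⟨⟨⟨h1, h2, h3⟩, h4⟩, h5⟩
        exact ⟨h1, by rw [← h5, union_sdiff_of_subset h2], h4⟩
      · rintro ⟨h1, h2, h3⟩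
        refine ⟨⟨⟨h1, ?_, ?_⟩, h3⟩, ?_⟩
        · rw [h2]; exact subset_union_left
        · rw [h2, union_comm]; exact union_subset_union_left hQ
        · rw [h2, union_sdiff_cancel_left hRQ]
    have h1 : ∀ τ ∈ X.filter (fun τ => τ.image card \ R = Q), (-1 : ℂ) ^ (#(T ∪ R) - #τ)
        = (-1 : ℂ) ^ (#T - #Q) := by
      intro τ hτ
      obtain ⟨h2, h3, -⟩ := hX τ (mem_filter.1 hτ).1
      have h4 : #(τ.image card) = #R + #Q := by
        rw [← (mem_filter.1 hτ).2, card_sdiff_of_subset h3]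
        have := card_le_card h3
        omega
      rw [h2, h4, hcard]
      congr 1
      omega
    rw [sum_congr rfl h1, sum_const, hfib, Pi.smul_apply, flagCount, nsmul_eq_mul, zsmul_eq_mul,
      mul_comm]
    push_cast
    rfl
  · intro τ hτ
    obtain ⟨-, h2, h3⟩ := hX τ hτ
    rw [mem_powerset]
    intro k hk
    rw [mem_sdiff] at hk
    exact (mem_union.1 (h3 hk.1)).resolve_right hk.2

end MixedGraph

end

noncomputable section

set_option linter.unusedSectionVars false

namespace MixedGraph

open Finset RelComplex IdealChains BooleanIntervals
open scoped Pointwise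

variable {V : Type*} [Fintype V] [DecidableEq V]

/-! ### The ordered partition of a chain of sets -/

/-- The index of the block of the ordered partition `I_1, I_2 \ I_1, …` that contains `v`. -/
def block (τ : Finset (Finset V)) (v : V) : ℕ := #{I ∈ τ | v ∉ I}

theorem block_le (τ : Finset (Finset V)) (v : V) : block τ v ≤ #τ := card_filter_le _ _

variable {τ : Finset (Finset V)}

theorem block_lt_block (hτ : IsChain (· ⊆ ·) (τ : Set (Finset V))) {u v : V} :
    block τ u < block τ v ↔ ∃ I ∈ τ, u ∈ I ∧ v ∉ I := by
  constructor
  · intro h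
    by_contra hcon
    push Not at hcon
    refine absurd (card_le_card (s := τ.filter (v ∉ ·)) (t := τ.filter (u ∉ ·)) ?_) h.not_ge
    intro I hI
    rw [mem_filter] at hI ⊢
    exact ⟨hI.1, fun hu => hI.2 (hcon I hI.1 hu)⟩
  · rintro ⟨I, hI, hu, hv⟩
    refine card_lt_card ((ssubset_iff_of_subset fun J hJ => ?_).2
      ⟨I, mem_filter.2 ⟨hI, hv⟩, fun h => (mem_filter.1 h).2 hu⟩)
    rw [mem_filter] at hJ ⊢
    refine ⟨hJ.1, fun hvJ => ?_⟩
    rcases hτ.total hI hJ.1 with h | h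
    · exact hJ.2 (h hu)
    · exact hv (h hvJ)

/-- A member of the chain is the union of an initial segment of the blocks, whose length is its
position in the chain plus one. -/
theorem mem_iff_block_lt (hτ : IsChain (· ⊆ ·) (τ : Set (Finset V))) {I : Finset V} (hI : I ∈ τ)
    (v : V) : v ∈ I ↔ block τ v < #{J ∈ τ | J ⊂ I} + 1 := by
  constructor
  · intro hv
    refine Nat.lt_succ_of_le (card_le_card fun J hJ => ?_)
    rw [mem_filter] at hJ ⊢
    refine ⟨hJ.1, ?_⟩
    rcases hτ.total hJ.1 hI with h | h
    · exact Finset.ssubset_iff_subset_ne.2 ⟨h, fun h' => hJ.2 (h' ▸ hv)⟩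
    · exact absurd (h hv) hJ.2
  · intro h
    by_contra hv
    have : #(insert I (τ.filter (· ⊂ I))) ≤ block τ v := by
      refine card_le_card (insert_subset (mem_filter.2 ⟨hI, hv⟩) fun J hJ => ?_)
      rw [mem_filter] at hJ ⊢
      exact ⟨hJ.1, fun h' => hv (hJ.2.1 h')⟩
    rw [card_insert_of_notMem (by simp)] at this
    omega

theorem image_position (hτ : IsChain (· ⊆ ·) (τ : Set (Finset V))) :
    τ.image (fun I => #{J ∈ τ | J ⊂ I}) = range #τ := by
  refine eq_of_subset_of_card_le ?_ ?_
  · intro k hk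
    obtain ⟨I, hI, rfl⟩ := mem_image.1 hk
    rw [mem_range]
    exact card_lt_card ((ssubset_iff_of_subset (filter_subset _ _)).2 ⟨I, hI, by simp⟩)
  · rw [card_range, card_image_of_injOn]
    have key : ∀ I ∈ τ, ∀ J ∈ τ, I ⊂ J → #{L ∈ τ | L ⊂ I} < #{L ∈ τ | L ⊂ J} := by
      intro I hI J hJ hIJ
      refine card_lt_card ((ssubset_iff_of_subset fun L hL => ?_).2
        ⟨I, mem_filter.2 ⟨hI, hIJ⟩, by simp⟩)
      rw [mem_filter] at hL ⊢
      exact ⟨hL.1, hL.2.trans hIJ⟩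
    intro I hI J hJ h
    by_contra hne
    simp only at h
    rcases hτ.total hI hJ with h' | h'
    · exact absurd h (key I hI J hJ (Finset.ssubset_iff_subset_ne.2 ⟨h', hne⟩)).ne
    · exact absurd h.symm (key J hJ I hI (Finset.ssubset_iff_subset_ne.2 ⟨h', Ne.symm hne⟩)).ne

/-- A chain of nonempty proper subsets. -/
structure IsFlag (τ : Finset (Finset V)) : Prop where
  chain : IsChain (· ⊆ ·) (τ : Set (Finset V))
  ne_empty : ∀ I ∈ τ, I ≠ ∅
  ne_univ : ∀ I ∈ τ, I ≠ univ

theorem isFlag_of_mem_orderComplex {G : MixedGraph V} (hτ : τ ∈ G.orderComplex) : IsFlag τ :=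
  ⟨hτ.2, fun I hI => (hτ.1 I hI).2.1, fun I hI => (hτ.1 I hI).2.2⟩

theorem image_card_block (hτ : IsFlag τ) :
    (range (#τ + 2)).image (fun j => #{v : V | block τ v < j})
      = insert 0 (insert (Fintype.card V) (τ.image card)) := by
  have hcard : ∀ I ∈ τ, #{v : V | block τ v < #{J ∈ τ | J ⊂ I} + 1} = #I := by
    intro I hI
    congr 1
    ext v
    rw [mem_filter, mem_iff_block_lt hτ.chain hI]
    simp
  ext k
  simp only [mem_image, mem_insert, mem_range]
  constructor
  · rintro ⟨j, hj, rfl⟩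
    rcases Nat.eq_zero_or_pos j with rfl | hj0
    · left; simp
    · right
      rcases Nat.lt_or_ge (#τ) j with h | h
      · left
        rw [filter_true_of_mem fun v _ => (block_le τ v).trans_lt h, card_univ]
      · right
        have : j - 1 ∈ τ.image (fun I => #{J ∈ τ | J ⊂ I}) := by
          rw [image_position hτ.chain, mem_range]; omega
        obtain ⟨I, hI, hIj⟩ := mem_image.1 this
        refine ⟨I, hI, ?_⟩
        rw [← hcard I hI, hIj, Nat.sub_add_cancel hj0]
  · rintro (rfl | rfl | ⟨I, hI, rfl⟩)
    · exact ⟨0, by omega, by simp⟩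
    · refine ⟨#τ + 1, by omega, ?_⟩
      rw [filter_true_of_mem fun v _ => Nat.lt_succ_of_le (block_le τ v), card_univ]
    · have : #{J ∈ τ | J ⊂ I} ∈ range #τ := by
        rw [← image_position hτ.chain]
        exact mem_image_of_mem _ hI
      rw [mem_range] at this
      exact ⟨_, by omega, hcard I hI⟩

theorem IsFlag.card_image_card (hτ : IsFlag τ) : #(τ.image card) = #τ :=
  card_image_of_injOn fun _ hI _ hJ h => eq_of_card_eq_of_isChain hτ.chain hI hJ h

theorem IsFlag.card_pos_lt (hτ : IsFlag τ) {I : Finset V} (hI : I ∈ τ) :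
    0 < #I ∧ #I < Fintype.card V :=
  ⟨card_pos.2 (nonempty_iff_ne_empty.2 (hτ.ne_empty I hI)),
    lt_of_le_of_ne (card_le_univ I) fun h => hτ.ne_univ I hI ((card_eq_iff_eq_univ I).1 h)⟩

theorem card_insert_ranks [Nonempty V] (hτ : IsFlag τ) :
    #(insert 0 (insert (Fintype.card V) (τ.image card))) = #τ + 2 := by
  rw [card_insert_of_notMem, card_insert_of_notMem, hτ.card_image_card]
  · rw [mem_image]
    rintro ⟨I, hI, h⟩
    have := (hτ.card_pos_lt hI).2
    omega
  · rw [mem_insert, mem_image, not_or]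
    refine ⟨Fintype.card_pos.ne, ?_⟩
    rintro ⟨I, hI, h⟩
    have := (hτ.card_pos_lt hI).1
    omega

theorem strictMonoOn_card_block [Nonempty V] (hτ : IsFlag τ) :
    StrictMonoOn (fun j => #{v : V | block τ v < j}) (range (#τ + 2)) := by
  have hinj : Set.InjOn (fun j => #{v : V | block τ v < j}) (range (#τ + 2)) := by
    rw [← card_image_iff, image_card_block hτ, card_insert_ranks hτ, card_range]
  intro i hi j hj hij
  refine lt_of_le_of_ne (card_le_card fun v hv => ?_) fun h => hij.ne (hinj hi hj h)
  rw [mem_filter] at hv ⊢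
  exact ⟨hv.1, hv.2.trans hij⟩

theorem exists_block_eq [Nonempty V] (hτ : IsFlag τ) {j : ℕ} (hj : j ≤ #τ) :
    ∃ v, block τ v = j := by
  by_contra hcon
  push Not at hcon
  have h := strictMonoOn_card_block hτ (a := j) (b := j + 1) (mem_coe.2 (mem_range.2 (by omega)))
    (mem_coe.2 (mem_range.2 (by omega))) (Nat.lt_succ_self j)
  refine absurd (card_le_card fun v hv => ?_) h.not_ge
  rw [mem_filter] at hv ⊢
  have := hcon v
  exact ⟨hv.1, by omega⟩

/-- The sizes of the unions of the first j blocks enumerate the ranks together with 0 and n in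
increasing order, and such an enumeration is unique. So the exponents in `monomialQ` are the block
sizes. -/
theorem cut_eq_card_block [Nonempty V] (hτ : IsFlag τ) {j : ℕ} (hj : j < #τ + 2) :
    QSymFun.cut (Fintype.card V) (τ.image card) j = #{v : V | block τ v < j} := by
  have hfin : (Set.ofPred fun x => x ∈ insert 0 (insert (Fintype.card V) (τ.image card))).Finite :=
    (insert 0 (insert (Fintype.card V) (τ.image card))).finite_toSet
  have htof : hfin.toFinset = insert 0 (insert (Fintype.card V) (τ.image card)) := by
    ext x; simp
  have hc : #hfin.toFinset = #τ + 2 := by rw [htof, card_insert_ranks hτ]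
  have hmem : ∀ k < #τ + 2,
      #{v : V | block τ v < k} ∈ insert 0 (insert (Fintype.card V) (τ.image card)) := by
    intro k hk
    rw [← image_card_block hτ]
    exact mem_image_of_mem (fun j => #{v : V | block τ v < j}) (mem_range.2 hk)
  rw [QSymFun.cut, Nat.nth_eq_orderEmbOfFin hfin (by omega)]
  have := Finset.orderEmbOfFin_unique (s := hfin.toFinset) (k := #hfin.toFinset) rfl
    (f := fun i => #{v : V | block τ v < i}) (fun i => ?_) (fun i i' h => ?_)
  · exact (congrFun this ⟨j, by omega⟩).symm
  · have hi := i.2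
    rw [Set.Finite.mem_toFinset]
    exact hmem i (by omega)
  · exact strictMonoOn_card_block hτ (mem_coe.2 (mem_range.2 (by omega)))
      (mem_coe.2 (mem_range.2 (by omega))) h

/-- The block index as an element of `Fin`. -/
def blockIdx (τ : Finset (Finset V)) (v : V) : Fin (#(τ.image card) + 1) :=
  Fin.ofNat _ (block τ v)

theorem blockIdx_val (hτ : IsFlag τ) (v : V) : (blockIdx τ v : ℕ) = block τ v := by
  have := block_le τ v
  rw [← hτ.card_image_card] at this
  exact Nat.mod_eq_of_lt (by omega)

theorem blockIdx_surjective [Nonempty V] (hτ : IsFlag τ) : Function.Surjective (blockIdx τ) := by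
  intro j
  have hj := j.2
  obtain ⟨v, hv⟩ := exists_block_eq hτ (j := j) (by rw [← hτ.card_image_card]; omega)
  exact ⟨v, Fin.ext (by rw [blockIdx_val hτ, hv])⟩

theorem sum_single_blockIdx [Nonempty V] (hτ : IsFlag τ) (i : Fin (#(τ.image card) + 1) → ℕ) :
    ∑ v : V, Finsupp.single (i (blockIdx τ v)) 1 = ∑ j : Fin (#(τ.image card) + 1),
      Finsupp.single (i j) (QSymFun.cut (Fintype.card V) (τ.image card) (j + 1) -
        QSymFun.cut (Fintype.card V) (τ.image card) j) := by
  rw [← sum_fiberwise_of_maps_to (s := (univ : Finset V)) (t := univ) (g := blockIdx τ)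
    (fun _ _ => mem_univ _)]
  refine sum_congr rfl fun j _ => ?_
  have hj := j.2
  have hc := hτ.card_image_card
  have h1 : ∀ v ∈ (univ : Finset V).filter (fun v => blockIdx τ v = j),
      Finsupp.single (i (blockIdx τ v)) 1 = Finsupp.single (i j) 1 := fun v hv => by
    rw [(mem_filter.1 hv).2]
  rw [sum_congr rfl h1, sum_const, Finsupp.smul_single, smul_eq_mul, mul_one,
    cut_eq_card_block hτ (by omega), cut_eq_card_block hτ (by omega)]
  congr 1
  have h2 : (univ.filter fun v : V => block τ v < (j : ℕ) + 1)
      = (univ.filter fun v : V => block τ v < (j : ℕ)) ∪ univ.filter fun v => blockIdx τ v = j := by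
    ext v
    simp only [mem_filter, mem_univ, true_and, mem_union, Fin.ext_iff, blockIdx_val hτ]
    omega
  rw [h2, card_union_of_disjoint]
  · omega
  · refine disjoint_filter.2 fun v _ h3 h4 => ?_
    rw [← h4, blockIdx_val hτ] at h3
    omega

/-! ### Colorings and faces -/

/-- The chain of the sets `{v | f v ≤ c}`. -/
def levelChain (f : V → ℕ) : Finset (Finset V) :=
  (univ.image fun u => univ.filter fun v => f v ≤ f u).erase univ

theorem mem_levelChain {f : V → ℕ} {I : Finset V} :
    I ∈ levelChain f ↔ I ≠ univ ∧ ∃ u, (univ.filter fun v => f v ≤ f u) = I := by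
  simp [levelChain]

theorem isFlag_levelChain (f : V → ℕ) : IsFlag (levelChain f) where
  chain := by
    intro I hI J hJ _
    obtain ⟨-, u, rfl⟩ := mem_levelChain.1 (mem_coe.1 hI)
    obtain ⟨-, v, rfl⟩ := mem_levelChain.1 (mem_coe.1 hJ)
    rcases le_total (f u) (f v) with h | h
    · exact Or.inl fun w hw => mem_filter.2 ⟨mem_univ _, (mem_filter.1 hw).2.trans h⟩
    · exact Or.inr fun w hw => mem_filter.2 ⟨mem_univ _, (mem_filter.1 hw).2.trans h⟩
  ne_empty I hI := by
    obtain ⟨-, u, rfl⟩ := mem_levelChain.1 hI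
    exact ne_empty_of_mem (mem_filter.2 ⟨mem_univ u, le_rfl⟩)
  ne_univ I hI := (mem_levelChain.1 hI).1

theorem exists_mem_levelChain {f : V → ℕ} {u v : V} :
    (∃ I ∈ levelChain f, u ∈ I ∧ v ∉ I) ↔ f u < f v := by
  constructor
  · rintro ⟨I, hI, hu, hv⟩
    obtain ⟨-, w, rfl⟩ := mem_levelChain.1 hI
    simp only [mem_filter, mem_univ, true_and, not_le] at hu hv
    omega
  · intro h
    have hv : v ∉ univ.filter fun w => f w ≤ f u := by simpa using h
    exact ⟨univ.filter fun w => f w ≤ f u,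
      mem_levelChain.2 ⟨fun h' => hv (by rw [h']; exact mem_univ v), u, rfl⟩, by simp, hv⟩

theorem block_levelChain_lt {f : V → ℕ} {u v : V} :
    block (levelChain f) u < block (levelChain f) v ↔ f u < f v := by
  rw [block_lt_block (isFlag_levelChain f).chain, exists_mem_levelChain]

/-- A flag is recovered from its ordered partition: with v in the last block inside I, the set I
consists of the x whose block is not after that of v. A vertex w in the next block shows that this
segment is proper also in τ'. -/
theorem eq_of_block_lt_iff {τ τ' : Finset (Finset V)} [Nonempty V] (hτ : IsFlag τ)
    (hτ' : IsFlag τ')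
    (h : ∀ u v, block τ u < block τ v ↔ block τ' u < block τ' v) : τ = τ' := by
  have key : ∀ {τ τ' : Finset (Finset V)}, IsFlag τ → IsFlag τ' →
      (∀ u v, block τ u < block τ v ↔ block τ' u < block τ' v) → τ ⊆ τ' := by
    intro τ τ' hτ hτ' h I hI
    obtain ⟨v, hv⟩ := exists_block_eq hτ (j := #{J ∈ τ | J ⊂ I}) (card_filter_le _ _)
    have hpos : #{J ∈ τ | J ⊂ I} < #τ := by
      rw [← mem_range, ← image_position hτ.chain]
      exact mem_image_of_mem _ hI
    obtain ⟨w, hw⟩ := exists_block_eq hτ (j := #{J ∈ τ | J ⊂ I} + 1) hpos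
    have hmem : ∀ x, x ∈ I ↔ block τ' x ≤ block τ' v := by
      intro x
      rw [mem_iff_block_lt hτ.chain hI, ← not_lt, ← h, hv]
      omega
    have hlt : block τ' v < block τ' w := (h v w).1 (by omega)
    have hle := block_le τ' w
    have : block τ' v ∈ range #τ' := mem_range.2 (by omega)
    rw [← image_position hτ'.chain] at this
    obtain ⟨J, hJ, hJv⟩ := mem_image.1 this
    have : I = J := by
      ext x
      rw [hmem, mem_iff_block_lt hτ'.chain hJ, hJv]
      omega
    exact this ▸ hJ
  exact subset_antisymm (key hτ hτ' h) (key hτ' hτ fun u v => (h u v).symm)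

theorem levelChain_comp_blockIdx [Nonempty V] (hτ : IsFlag τ)
    {i : Fin (#(τ.image card) + 1) → ℕ} (hi : StrictMono i) :
    levelChain (fun v => i (blockIdx τ v)) = τ := by
  refine eq_of_block_lt_iff (isFlag_levelChain _) hτ fun u v => ?_
  rw [block_levelChain_lt, hi.lt_iff_lt, Fin.lt_def, blockIdx_val hτ, blockIdx_val hτ]

theorem exists_strictMono_comp_blockIdx [Nonempty V] (f : V → ℕ) :
    ∃ i : Fin (#((levelChain f).image card) + 1) → ℕ, StrictMono i ∧
      (fun v => i (blockIdx (levelChain f) v)) = f := by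
  have hτ := isFlag_levelChain f
  choose s hs using blockIdx_surjective hτ
  have hlt : ∀ u v, blockIdx (levelChain f) u < blockIdx (levelChain f) v ↔ f u < f v := by
    intro u v
    rw [Fin.lt_def, blockIdx_val hτ, blockIdx_val hτ, block_levelChain_lt]
  refine ⟨fun j => f (s j), fun j j' h => ?_, ?_⟩
  · rw [← hlt, hs, hs]; exact h
  · ext v
    have h1 := (hlt (s (blockIdx (levelChain f) v)) v).not
    have h2 := (hlt v (s (blockIdx (levelChain f) v))).not
    rw [hs] at h1 h2
    simp only [lt_self_iff_false, not_false_eq_true, true_iff, not_lt] at h1 h2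
    exact le_antisymm h2 h1

variable {G : MixedGraph V} {H : Type*} [Group H] [MulAction H V]

/-- Being weakly monotone along arcs says that sublevel sets are ideals; differing on an edge says
that some sublevel set separates its ends. -/
theorem isColoring_iff_levelChain_mem {f : V → ℕ} :
    G.IsColoring f ↔ levelChain f ∈ G.coloringComplex := by
  rw [coloringComplex_eq]
  have hflag := isFlag_levelChain f
  constructor
  · rintro ⟨h1, h2⟩
    refine ⟨fun I hI => ⟨fun u v huv hv => ?_, hflag.ne_empty I hI, hflag.ne_univ I hI⟩,
      hflag.chain, ?_⟩
    · obtain ⟨-, w, rfl⟩ := mem_levelChain.1 hI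
      rw [mem_filter] at hv ⊢
      exact ⟨mem_univ _, (h2 u v huv).trans hv.2⟩
    · rintro ⟨u, v⟩ he
      rcases lt_or_gt_of_ne (h1 u v (G.mem_undPairs.1 he)) with h | h
      · obtain ⟨I, hI, hu, hv⟩ := exists_mem_levelChain.2 h
        exact ⟨I, hI, by simp only; tauto⟩
      · obtain ⟨I, hI, hu, hv⟩ := exists_mem_levelChain.2 h
        exact ⟨I, hI, by simp only; tauto⟩
  · rintro ⟨h1, -, h3⟩
    refine ⟨fun u v huv h => ?_, fun u v huv => ?_⟩
    · obtain ⟨I, hI, hsep⟩ := h3 (u, v) (G.mem_undPairs.2 huv)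
      obtain ⟨-, w, rfl⟩ := mem_levelChain.1 hI
      simp [h] at hsep
    · by_contra hlt
      obtain ⟨I, hI, hv, hu⟩ := exists_mem_levelChain.2 (not_le.1 hlt)
      exact hu ((h1 I hI).1 u v huv hv)

theorem block_smul (g : H) (τ : Finset (Finset V)) (v : V) :
    block (g • τ) v = block τ (g⁻¹ • v) := by
  refine card_bij' (fun I _ => g⁻¹ • I) (fun I _ => g • I) ?_ ?_ ?_ ?_
  · intro I hI
    rw [mem_filter] at hI ⊢
    rw [inv_smul_mem_iff, smul_mem_smul_finset_iff]
    exact hI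
  · intro I hI
    rw [mem_filter] at hI ⊢
    rw [smul_mem_smul_finset_iff, ← inv_smul_mem_iff]
    exact hI
  · intro I _; simp
  · intro I _; simp

/-- Stability of the chain as a set already fixes the block index, through which f factors. -/
theorem forall_inv_smul_eq_iff [Nonempty V] (g : H) (f : V → ℕ) :
    (∀ v, f (g⁻¹ • v) = f v) ↔ g • levelChain f = levelChain f := by
  constructor
  · intro h
    have hI : ∀ I ∈ levelChain f, g • I = I := by
      intro I hI
      obtain ⟨-, u, rfl⟩ := mem_levelChain.1 hI
      ext v
      rw [← inv_smul_mem_iff, mem_filter, mem_filter, h]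
      simp
    ext I
    rw [mem_smul_finset]
    constructor
    · rintro ⟨J, hJ, rfl⟩
      rwa [hI J hJ]
    · intro hI'
      exact ⟨I, hI', hI I hI'⟩
  · intro h v
    obtain ⟨i, -, hi⟩ := exists_strictMono_comp_blockIdx f
    have h1 : blockIdx (levelChain f) (g⁻¹ • v) = blockIdx (levelChain f) v := by
      rw [blockIdx, ← block_smul, h]
      rfl
    rw [← hi]
    simp only [h1]

open Classical in
/-- Fixed colorings with a given property, sorted by their faces. -/
theorem card_fixedColorings [Nonempty V] (g : H) (Q : (V → ℕ) → Prop) (hQ : {f | Q f}.Finite) :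
    Nat.card {f : V → ℕ // G.IsFixedColoring g f ∧ Q f}
      = ∑ τ : Finset (Finset V) with τ ∈ G.coloringComplex ∧ g • τ = τ,
        Nat.card {i : Fin (#(τ.image card) + 1) → ℕ //
          StrictMono i ∧ Q fun v => i (blockIdx τ v)} := by
  have hfin : {f | G.IsFixedColoring g f ∧ Q f}.Finite := hQ.subset fun f hf => hf.2
  have h1 : Nat.card {f : V → ℕ // G.IsFixedColoring g f ∧ Q f} = #hfin.toFinset := by
    rw [← Set.ncard_eq_toFinset_card _ hfin]
    rfl
  have hiff : ∀ f : V → ℕ, G.IsFixedColoring g f ↔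
      levelChain f ∈ G.coloringComplex ∧ g • levelChain f = levelChain f := fun f => by
    rw [IsFixedColoring, isColoring_iff_levelChain_mem, forall_inv_smul_eq_iff]
  rw [h1, card_eq_sum_card_fiberwise (f := levelChain)
    (t := univ.filter fun τ => τ ∈ G.coloringComplex ∧ g • τ = τ)]
  · refine sum_congr rfl fun τ hτ => ?_
    obtain ⟨-, hτΦ, hτg⟩ := mem_filter.1 hτ
    have hflag := isFlag_of_mem_orderComplex hτΦ.1
    rw [← Fintype.card_coe, ← Nat.card_eq_fintype_card]
    symm
    refine Nat.card_congr (Equiv.ofBijective (fun i => ⟨fun v => i.1 (blockIdx τ v), ?_⟩) ⟨?_, ?_⟩)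
    · have hlevel := levelChain_comp_blockIdx hflag i.2.1
      rw [mem_filter, Set.Finite.mem_toFinset]
      refine ⟨⟨(hiff _).2 ?_, i.2.2⟩, hlevel⟩
      rw [hlevel]
      exact ⟨hτΦ, hτg⟩
    · intro i i' h
      refine Subtype.ext (funext fun j => ?_)
      obtain ⟨v, rfl⟩ := blockIdx_surjective hflag j
      exact congrFun (congrArg Subtype.val h) v
    · rintro ⟨f, hf⟩
      rw [mem_filter, Set.Finite.mem_toFinset] at hf
      obtain ⟨⟨-, hQf⟩, rfl⟩ := hf
      obtain ⟨i, hi, hif⟩ := exists_strictMono_comp_blockIdx f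
      exact ⟨⟨i, hi, by rwa [hif]⟩, Subtype.ext hif⟩
  · intro f hf
    rw [mem_coe, Set.Finite.mem_toFinset] at hf
    rw [mem_coe, mem_filter]
    exact ⟨mem_univ _, (hiff f).1 hf.1⟩

theorem card_strictMono_lt (t k : ℕ) :
    Nat.card {i : Fin t → ℕ // StrictMono i ∧ ∀ j, i j < k} = k.choose t := by
  have : Nat.card (powersetCard t (range k)) = k.choose t := by
    rw [Nat.card_eq_fintype_card, Fintype.card_coe, card_powersetCard, card_range]
  rw [← this]
  symm
  refine Nat.card_congr (Equiv.ofBijective (fun s => ⟨s.1.orderEmbOfFin (mem_powersetCard.1 s.2).2,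
    (s.1.orderEmbOfFin _).strictMono, fun j => ?_⟩) ⟨?_, ?_⟩)
  · exact mem_range.1 ((mem_powersetCard.1 s.2).1 (orderEmbOfFin_mem _ _ j))
  · intro s s' h
    have h' := congrArg (fun x => Set.range x.1) h
    simp only [range_orderEmbOfFin] at h'
    exact Subtype.ext (coe_injective h')
  · rintro ⟨i, hi, hik⟩
    have hcard : #(univ.image i) = t := by
      rw [card_image_of_injective _ hi.injective, card_univ, Fintype.card_fin]
    refine ⟨⟨univ.image i, mem_powersetCard.2 ⟨fun x hx => ?_, hcard⟩⟩, ?_⟩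
    · obtain ⟨j, -, rfl⟩ := mem_image.1 hx
      exact mem_range.2 (hik j)
    · exact Subtype.ext (orderEmbOfFin_unique hcard (fun j => mem_image_of_mem _ (mem_univ _))
        hi).symm

end MixedGraph

end

/-! ### Expansions of the chromatic functions and the f- and h-vectors -/

noncomputable section

set_option linter.unusedSectionVars false

namespace MixedGraph

open Finset RelComplex IdealChains BooleanIntervals
open scoped Pointwise

variable {V : Type*} [Fintype V] [DecidableEq V] [Nonempty V] {G : MixedGraph V}
  {H : Type*} [Group H] [MulAction H V]

open Classical in
theorem sum_fixedFaces (g : H) (w : Finset ℕ → ℂ) :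
    ∑ τ : Finset (Finset V) with τ ∈ G.coloringComplex ∧ g • τ = τ, w (τ.image card)
      = ∑ S ∈ (Icc 1 (Fintype.card V - 1)).powerset, G.flagCount S g * w S := by
  rw [← sum_fiberwise_of_maps_to (t := (Icc 1 (Fintype.card V - 1)).powerset)
    (g := fun τ : Finset (Finset V) => τ.image card)]
  · refine sum_congr rfl fun S _ => ?_
    rw [sum_congr rfl fun τ hτ => congrArg w (mem_filter.1 hτ).2, sum_const, nsmul_eq_mul,
      flagCount, filter_filter]
    congr 4
    ext τ
    tauto
  · intro τ hτ
    rw [mem_powerset]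
    intro k hk
    obtain ⟨I, hI, rfl⟩ := mem_image.1 hk
    exact card_bounds_of_mem (mem_filter.1 hτ).2.1.1 hI

theorem chromaticQ_eq_sum_monomialQ (g : H) :
    G.chromaticQ g = ∑ S ∈ (Icc 1 (Fintype.card V - 1)).powerset,
      G.flagCount S g • QSymFun.monomialQ (Fintype.card V) S := by
  classical
  ext μ
  -- Every value of f lies in the support of μ.
  have hfin : {f : V → ℕ | ∑ v, Finsupp.single (f v) 1 = μ}.Finite := by
    refine (Set.Finite.pi' fun _ : V => μ.support.finite_toSet).subset ?_
    intro f hf u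
    rw [mem_coe, Finsupp.mem_support_iff, ← (show _ = μ from hf), Finsupp.finsetSum_apply]
    refine (sum_pos' (fun _ _ => Nat.zero_le _) ⟨u, mem_univ u, ?_⟩).ne'
    simp
  have h1 : MvPowerSeries.coeff μ (G.chromaticQ g)
      = (Nat.card {f : V → ℕ // G.IsFixedColoring g f ∧
        ∑ v, Finsupp.single (f v) 1 = μ} : ℂ) := rfl
  rw [h1, card_fixedColorings g _ hfin, Nat.cast_sum, map_sum]
  have h2 : ∀ τ ∈ (univ : Finset (Finset (Finset V))).filter
      (fun τ => τ ∈ G.coloringComplex ∧ g • τ = τ),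
      (Nat.card {i : Fin (#(τ.image card) + 1) → ℕ // StrictMono i ∧
        ∑ v, Finsupp.single (i (blockIdx τ v)) 1 = μ} : ℂ)
      = QSymFun.monomialQ (Fintype.card V) (τ.image card) μ := by
    intro τ hτ
    have hflag := isFlag_of_mem_orderComplex (mem_filter.1 hτ).2.1.1
    simp only [sum_single_blockIdx hflag]
    rfl
  rw [sum_congr rfl h2, sum_fixedFaces g fun S => QSymFun.monomialQ (Fintype.card V) S μ]
  rfl

theorem chromaticP_eq_sum_choose (k : ℕ) (g : H) :
    G.chromaticP k g = ∑ S ∈ (Icc 1 (Fintype.card V - 1)).powerset,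
      G.flagCount S g * (k.choose (#S + 1) : ℂ) := by
  classical
  have hfin : {f : V → ℕ | ∀ v, f v < k}.Finite :=
    (Set.Finite.pi' fun _ : V => Set.finite_Iio k).subset fun f hf v => hf v
  rw [chromaticP, card_fixedColorings g _ hfin, Nat.cast_sum,
    ← sum_fixedFaces g fun S => (k.choose (#S + 1) : ℂ)]
  refine sum_congr rfl fun τ hτ => ?_
  have hflag := isFlag_of_mem_orderComplex (mem_filter.1 hτ).2.1.1
  rw [← card_strictMono_lt]
  simp only [(blockIdx_surjective hflag).forall]

theorem chromaticQ_eq_sum_fundamentalQ (g : H) :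
    G.chromaticQ g = ∑ S ∈ (Icc 1 (Fintype.card V - 1)).powerset,
      G.flagCoeff S g • QSymFun.fundamentalQ (Fintype.card V) S := by
  rw [chromaticQ_eq_sum_monomialQ]
  simp only [QSymFun.fundamentalQ, smul_sum]
  have h1 : ∀ T ∈ (Icc 1 (Fintype.card V - 1)).powerset,
      G.flagCount T g • QSymFun.monomialQ (Fintype.card V) T
      = ∑ S ∈ T.powerset, G.flagCoeff S g • QSymFun.monomialQ (Fintype.card V) T := by
    intro T _
    rw [← sum_flagCoeff, Finset.sum_apply, sum_smul]
  rw [sum_congr rfl h1]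
  refine sum_comm' fun T S => ?_
  simp only [mem_powerset, mem_filter]
  exact ⟨fun h => ⟨⟨h.1, h.2⟩, h.2.trans h.1⟩, fun h => ⟨h.1.1, h.1.2⟩⟩

/-- Pascal's rule, once for each element of R. It evaluates the specialization of F_S at k colors.
-/
theorem sum_powerset_choose (R : Finset ℕ) : ∀ k a : ℕ,
    ∑ Q ∈ R.powerset, k.choose (a + #Q + 1) = (k + #R).choose (a + #R + 1) := by
  induction R using Finset.induction_on with
  | empty => simp
  | insert x R hx ih =>
    intro k a
    rw [sum_powerset_insert hx, ih, card_insert_of_notMem hx]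
    have h1 : ∀ Q ∈ R.powerset, k.choose (a + #(insert x Q) + 1)
        = k.choose ((a + 1) + #Q + 1) := by
      intro Q hQ
      rw [card_insert_of_notMem fun h => hx (mem_powerset.1 hQ h)]
      congr 1
      omega
    rw [sum_congr rfl h1, ih, ← add_assoc k, ← add_assoc a, Nat.choose_succ_succ]
    congr 2
    omega

theorem chromaticP_eq_sum_flagCoeff (k : ℕ) (g : H) :
    G.chromaticP k g = ∑ S ∈ (Icc 1 (Fintype.card V - 1)).powerset,
      G.flagCoeff S g * ((k + Fintype.card V - (#S + 1)).choose (Fintype.card V) : ℂ) := by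
  have hn : 0 < Fintype.card V := Fintype.card_pos
  rw [chromaticP_eq_sum_choose]
  have h1 : ∀ T ∈ (Icc 1 (Fintype.card V - 1)).powerset,
      G.flagCount T g * (k.choose (#T + 1) : ℂ)
      = ∑ S ∈ T.powerset, G.flagCoeff S g * (k.choose (#T + 1) : ℂ) := by
    intro T _
    rw [← sum_flagCoeff, Finset.sum_apply, sum_mul]
  rw [sum_congr rfl h1, sum_comm' (t' := (Icc 1 (Fintype.card V - 1)).powerset)
    (s' := fun S => (Icc 1 (Fintype.card V - 1)).powerset.filter (S ⊆ ·))]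
  · refine sum_congr rfl fun S hS => ?_
    rw [mem_powerset] at hS
    rw [← mul_sum]
    congr 1
    have h2 : ∑ T ∈ (Icc 1 (Fintype.card V - 1)).powerset with S ⊆ T, k.choose (#T + 1)
        = ∑ Q ∈ (Icc 1 (Fintype.card V - 1) \ S).powerset, k.choose (#S + #Q + 1) := by
      refine sum_bij' (fun T _ => T \ S) (fun Q _ => S ∪ Q) ?_ ?_ ?_ ?_ ?_
      · intro T hT
        rw [mem_filter, mem_powerset] at hT
        exact mem_powerset.2 (sdiff_subset_sdiff hT.1 subset_rfl)
      · intro Q hQ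
        rw [mem_powerset] at hQ
        rw [mem_filter, mem_powerset]
        exact ⟨union_subset hS (hQ.trans sdiff_subset), subset_union_left⟩
      · intro T hT
        exact union_sdiff_of_subset (mem_filter.1 hT).2
      · intro Q hQ
        exact union_sdiff_cancel_left (disjoint_sdiff.mono_right (mem_powerset.1 hQ))
      · intro T hT
        have hST := (mem_filter.1 hT).2
        have := card_le_card hST
        rw [card_sdiff_of_subset hST]
        congr 1
        omega
    rw [← Nat.cast_sum, h2, sum_powerset_choose]
    have h3 := card_le_card hS
    rw [Nat.card_Icc] at h3
    rw [card_sdiff_of_subset hS, Nat.card_Icc]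
    congr 2 <;> omega
  · intro T S
    simp only [mem_powerset, mem_filter]
    exact ⟨fun h => ⟨⟨h.1, h.2⟩, h.2.trans h.1⟩, fun h => ⟨h.1.1, h.1.2⟩⟩

/-- The block index is a coloring with #τ + 1 colors. Positivity rules out the default value 0 of
the infimum whenever a face exists. -/
theorem chromaticNumber_le_of_mem {τ : Finset (Finset V)} (hτ : τ ∈ G.coloringComplex) :
    0 < G.chromaticNumber ∧ G.chromaticNumber ≤ #τ + 1 := by
  have hflag := isFlag_of_mem_orderComplex hτ.1
  have hmem : #τ + 1 ∈ {k | ∃ f : V → ℕ, G.IsColoring f ∧ ∀ v, f v < k} := by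
    refine ⟨fun v => (blockIdx τ v : ℕ), ?_, fun v => ?_⟩
    · rw [isColoring_iff_levelChain_mem, levelChain_comp_blockIdx hflag Fin.val_strictMono]
      exact hτ
    · change (blockIdx τ v : ℕ) < #τ + 1
      rw [blockIdx_val hflag]
      exact Nat.lt_succ_of_le (block_le τ v)
  refine ⟨?_, Nat.sInf_le hmem⟩
  obtain ⟨f, -, hf⟩ := Nat.sInf_mem ⟨_, hmem⟩
  exact Nat.zero_lt_of_lt (hf (Classical.arbitrary V))

theorem flagCount_eq_zero {S : Finset ℕ}
    (hS : G.chromaticNumber = 0 ∨ #S + 1 < G.chromaticNumber) :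
    G.flagCount (H := H) S = 0 := by
  classical
  ext g
  rw [flagCount, Pi.zero_apply, Nat.cast_eq_zero, card_eq_zero, filter_eq_empty_iff]
  rintro τ - ⟨h1, rfl, -⟩
  have := chromaticNumber_le_of_mem h1
  rw [card_image_card h1.1] at hS
  omega

theorem flagCoeff_eq_zero {S : Finset ℕ} (hS : #S + 1 < G.chromaticNumber) :
    G.flagCoeff (H := H) S = 0 := by
  refine sum_eq_zero fun Q hQ => ?_
  have := card_le_card (mem_powerset.1 hQ)
  rw [empty_union, flagCount_eq_zero (Or.inr (by omega)), smul_zero]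

/-- The `f`-vector, indexed by dimension. -/
def fVector (G : MixedGraph V) (i : ℤ) : H → ℂ :=
  if i < -1 then 0 else
    ∑ S ∈ powersetCard (i + 1).toNat (Icc 1 (Fintype.card V - 1)), G.flagCount S

/-- The `h`-vector. -/
def hVector (G : MixedGraph V) (i : ℤ) : H → ℂ :=
  if i < 0 then 0 else
    ∑ S ∈ powersetCard i.toNat (Icc 1 (Fintype.card V - 1)), G.flagCoeff S

theorem fVector_natCast_sub_one (j : ℕ) : G.fVector (H := H) ((j : ℤ) - 1)
    = ∑ S ∈ powersetCard j (Icc 1 (Fintype.card V - 1)), G.flagCount S := by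
  rw [fVector, if_neg (by omega), show ((j : ℤ) - 1 + 1).toNat = j by omega]

theorem hVector_natCast (j : ℕ) : G.hVector (H := H) (j : ℤ)
    = ∑ S ∈ powersetCard j (Icc 1 (Fintype.card V - 1)), G.flagCoeff S := by
  rw [hVector, if_neg (by omega), Int.toNat_natCast]

theorem fVector_eq_zero {i : ℤ} (hi : i < -1 ∨ (Fintype.card V : ℤ) - 2 < i) :
    G.fVector (H := H) i = 0 := by
  have hn : 0 < Fintype.card V := Fintype.card_pos
  rw [fVector]
  split_ifs with h
  · rfl
  · rw [powersetCard_eq_empty.2 (by rw [Nat.card_Icc]; omega), sum_empty]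

theorem hVector_eq_zero {i : ℤ} (hi : i < 0 ∨ (Fintype.card V : ℤ) - 1 < i) :
    G.hVector (H := H) i = 0 := by
  have hn : 0 < Fintype.card V := Fintype.card_pos
  rw [hVector]
  split_ifs with h
  · rfl
  · rw [powersetCard_eq_empty.2 (by rw [Nat.card_Icc]; omega), sum_empty]

theorem sum_powerset_ranks {M : Type*} [AddCommMonoid M] (F : Finset ℕ → M) :
    ∑ S ∈ (Icc 1 (Fintype.card V - 1)).powerset, F S = ∑ j ∈ range (Fintype.card V),
      ∑ S ∈ powersetCard j (Icc 1 (Fintype.card V - 1)), F S := by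
  have hn : 0 < Fintype.card V := Fintype.card_pos
  rw [sum_powerset, Nat.card_Icc]
  congr 2
  omega

theorem chromaticP_eq_sum_fVector (k : ℕ) (g : H) : G.chromaticP k g =
    ∑ i ∈ range (Fintype.card V + 1), G.fVector ((i : ℤ) - 2) g * (k.choose i : ℂ) := by
  -- The term i = 0 is f_{-2} = 0. A face with j members has j + 1 blocks, hence the shift by two
  -- between the dimension j - 1 and the lower index j + 1 of the binomial.
  rw [sum_range_succ', fVector_eq_zero (Or.inl (by norm_num)), Pi.zero_apply, zero_mul, add_zero,
    chromaticP_eq_sum_choose, sum_powerset_ranks]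
  refine sum_congr rfl fun j _ => ?_
  rw [show ((j + 1 : ℕ) : ℤ) - 2 = (j : ℤ) - 1 by push_cast; ring, fVector_natCast_sub_one,
    Finset.sum_apply, sum_mul]
  exact sum_congr rfl fun S hS => by rw [(mem_powersetCard.1 hS).2]

theorem chromaticP_eq_sum_hVector (k : ℕ) (g : H) : G.chromaticP k g =
    ∑ i ∈ range (Fintype.card V + 1), G.hVector ((i : ℤ) - 1) g *
      ((k + Fintype.card V - i).choose (Fintype.card V) : ℂ) := by
  rw [sum_range_succ', hVector_eq_zero (Or.inl (by norm_num)), Pi.zero_apply, zero_mul, add_zero,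
    chromaticP_eq_sum_flagCoeff, sum_powerset_ranks]
  refine sum_congr rfl fun j _ => ?_
  rw [show ((j + 1 : ℕ) : ℤ) - 1 = (j : ℤ) by push_cast; ring, hVector_natCast,
    Finset.sum_apply, sum_mul]
  exact sum_congr rfl fun S hS => by rw [(mem_powersetCard.1 hS).2]

theorem isEffectiveCharacter_flagCoeff (hG : G.IsAcyclic) (hH : G.IsActedOnBy H) {S : Finset ℕ}
    (hS : S ⊆ Icc 1 (Fintype.card V - 1)) (hm : #S ≤ G.minUndirected) :
    IsEffectiveCharacter (G.flagCoeff (H := H) S) := by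
  have := intervalPositive_flagCoeff hG hH S ∅ (disjoint_empty_right _) (by simpa using hS) hm
  have hmem : G.flagCoeff (H := H) S ∈ effectiveCharacters H := by simpa using this
  exact hmem

theorem isEffectiveCharacter_hVector (hG : G.IsAcyclic) (hH : G.IsActedOnBy H) {i : ℤ}
    (hi : i ≤ G.minUndirected) : IsEffectiveCharacter (G.hVector (H := H) i) := by
  rcases lt_or_ge i 0 with h | h
  · rw [hVector_eq_zero (Or.inl h)]
    exact IsEffectiveCharacter.zero
  · lift i to ℕ using h
    rw [hVector_natCast]
    refine IsEffectiveCharacter.sum fun S hS => ?_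
    obtain ⟨h1, h2⟩ := mem_powersetCard.1 hS
    exact isEffectiveCharacter_flagCoeff hG hH h1 (by omega)

theorem isEffectiveCharacter_sum_choose_hVector (hG : G.IsAcyclic) (hH : G.IsActedOnBy H) {i : ℕ}
    (hi : i ≤ G.minUndirected) : IsEffectiveCharacter
      (∑ j ∈ Icc G.minUndirected (Fintype.card V - 1),
        (i + j - G.minUndirected).choose i • G.hVector (H := H) (j : ℤ)) := by
  have hn : 0 < Fintype.card V := Fintype.card_pos
  have key := sum_choose_mem (intervalPositive_flagCoeff hG hH) (Icc 1 (Fintype.card V - 1)) ∅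
    G.minUndirected i (disjoint_empty_left _) (by simp) (by simp) hi
  change IsEffectiveCharacter _ at key
  convert key using 1
  rw [sum_filter, sum_powerset_ranks]
  have h1 : Icc G.minUndirected (Fintype.card V - 1)
      = (range (Fintype.card V)).filter (G.minUndirected ≤ ·) := by
    ext j
    simp only [mem_Icc, mem_filter, mem_range]
    omega
  rw [h1, sum_filter]
  refine sum_congr rfl fun j _ => ?_
  split_ifs with hj
  · rw [hVector_natCast, smul_sum]
    refine sum_congr rfl fun S hS => ?_
    rw [(mem_powersetCard.1 hS).2, if_pos hj, empty_union]
  · refine (sum_eq_zero fun S hS => ?_).symm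
    rw [(mem_powersetCard.1 hS).2, if_neg hj]

theorem fVector_eq_zero_of_chromaticNumber (h : G.chromaticNumber = 0) (i : ℤ) :
    G.fVector (H := H) i = 0 := by
  rw [fVector]
  split_ifs
  · rfl
  · exact sum_eq_zero fun S _ => flagCount_eq_zero (Or.inl h)

theorem effLE_zero : EffLE (0 : H → ℂ) 0 := by
  rw [EffLE, sub_self]
  exact IsEffectiveCharacter.zero

theorem effLE_smul_fVector (hG : G.IsAcyclic) (hH : G.IsActedOnBy H)
    (hm : G.chromaticNumber ≤ G.minUndirected) {i : ℤ} (hi : G.chromaticNumber ≤ i) :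
    EffLE (((Fintype.card V : ℤ) - 1 - i) • G.fVector (H := H) (i - 1))
      ((i - G.chromaticNumber + 2) • G.fVector (H := H) i) := by
  have hn : 0 < Fintype.card V := Fintype.card_pos
  rcases Nat.eq_zero_or_pos G.chromaticNumber with h0 | h0
  · rw [fVector_eq_zero_of_chromaticNumber h0, fVector_eq_zero_of_chromaticNumber h0, smul_zero,
      smul_zero]
    exact effLE_zero
  lift i to ℕ using by omega
  -- Here e = χ - 1, since a face with j members needs j + 1 ≥ χ; the condition e + 1 ≤ m is χ ≤ m.
  have key := smul_sum_sub_smul_sum_mem (intervalPositive_flagCoeff hG hH)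
    (e := G.chromaticNumber - 1) (k := i) (fun S _ hS => flagCoeff_eq_zero (by omega)) (by omega)
  simp only [sum_flagCoeff] at key
  rw [EffLE, fVector_natCast_sub_one, show (i : ℤ) = ((i + 1 : ℕ) : ℤ) - 1 by push_cast; ring,
    fVector_natCast_sub_one]
  change IsEffectiveCharacter _ at key
  convert key using 3
  · push_cast [Nat.cast_sub (show 1 ≤ G.chromaticNumber from h0)]
    ring
  · rw [Nat.card_Icc]
    push_cast
    omega

/-- Common source of items 4 and 5. The two entries are sums over rank sets of sizes a and b, and
the bound on a + b is that of `sum_sub_sum_mem` for a ground set of n - 1 ranks and e = χ - 1. -/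
theorem effLE_fVector (hG : G.IsAcyclic) (hH : G.IsActedOnBy H)
    (hm : G.chromaticNumber ≤ G.minUndirected) {a b : ℤ}
    (ha : (G.chromaticNumber : ℤ) - 1 ≤ a) (hab : a ≤ b)
    (hsum : a + b + 2 ≤ Fintype.card V + G.chromaticNumber) :
    EffLE (G.fVector (H := H) (a - 1)) (G.fVector (H := H) (b - 1)) := by
  have hn : 0 < Fintype.card V := Fintype.card_pos
  rcases Nat.eq_zero_or_pos G.chromaticNumber with h0 | h0
  · rw [fVector_eq_zero_of_chromaticNumber h0, fVector_eq_zero_of_chromaticNumber h0]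
    exact effLE_zero
  lift a to ℕ using by omega
  lift b to ℕ using by omega
  have key := sum_sub_sum_mem (intervalPositive_flagCoeff hG hH)
    (e := G.chromaticNumber - 1) (a := a) (b := b) (fun S _ hS => flagCoeff_eq_zero (by omega))
    (by omega) (by omega) (by omega) (by rw [Nat.card_Icc]; omega)
  simp only [sum_flagCoeff] at key
  rw [EffLE, fVector_natCast_sub_one, fVector_natCast_sub_one]
  exact key

end MixedGraph

end

theorem mainTheorem9 {V : Type*} [Fintype V] [DecidableEq V] [Nonempty V]
    (G : MixedGraph V) (hG : G.IsAcyclic) (hnear : ∀ c : G.MixedCycle, ¬ c.IsNear)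
    {H : Type*} [Group H] [Finite H] [MulAction H V] (hH : G.IsActedOnBy H)
    (K : Type*) [Field K]
    (n m : ℕ) (hn : n = Fintype.card V) (hm : m = G.minUndirected)
    (d χ : ℤ) (hd : d = n - 1) (hχ : χ = G.chromaticNumber) :
    -- `Φ(G)` satisfies `(S_{m(G)})`
    G.ColoringComplexSatisfiesSerre K m ∧
    -- the coefficients `c S = [F_{S,n}] χ(G, H, x)`
    (∃ c : Finset ℕ → H → ℂ,
      (∀ g : H, G.chromaticQ g =
        ∑ S ∈ (Finset.Icc 1 (n - 1)).powerset, c S g • QSymFun.fundamentalQ n S) ∧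
      ∀ S ⊆ Finset.Icc 1 (n - 1), S.card ≤ m → IsEffectiveCharacter (c S)) ∧
    -- the `f`-vector `f_{-2}, …, f_{n-2}` and the `h`-vector `h_{-1}, …, h_{n-1}`
    ∃ f h : ℤ → H → ℂ,
      (∀ i, i < -2 ∨ (n : ℤ) - 2 < i → f i = 0) ∧
      (∀ i, i < -1 ∨ (n : ℤ) - 1 < i → h i = 0) ∧
      (∀ (k : ℕ) (g : H), G.chromaticP k g =
        ∑ i ∈ Finset.range (n + 1), f ((i : ℤ) - 2) g * (k.choose i : ℂ)) ∧
      (∀ (k : ℕ) (g : H), G.chromaticP k g =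
        ∑ i ∈ Finset.range (n + 1), h ((i : ℤ) - 1) g * ((k + n - i).choose n : ℂ)) ∧
      (∀ i : ℤ, i ≤ m → IsEffectiveCharacter (h i)) ∧
      (∀ i : ℕ, i ≤ m → IsEffectiveCharacter
        (∑ j ∈ Finset.Icc m (n - 1), (i + j - m).choose i • h (j : ℤ))) ∧
      (χ ≤ m →
        (∀ i : ℤ, χ ≤ i → EffLE ((d - i) • f (i - 1)) ((i - χ + 2) • f i)) ∧
        (∀ i : ℤ, χ - 1 ≤ i → i ≤ (d + χ - 2) / 2 → EffLE (f (i - 1)) (f i)) ∧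
        (∀ i : ℤ, χ - 1 ≤ i → i ≤ (d + χ - 1) / 2 →
          EffLE (f (i - 1)) (f (d + χ - i - 2)))) := by
  subst hn hm hd hχ
  refine ⟨MixedGraph.coloringComplexSatisfiesSerre hG,
    ⟨G.flagCoeff, MixedGraph.chromaticQ_eq_sum_fundamentalQ,
      fun S => MixedGraph.isEffectiveCharacter_flagCoeff hG hH⟩,
    G.fVector, G.hVector, fun i hi => MixedGraph.fVector_eq_zero (by omega),
    fun i hi => MixedGraph.hVector_eq_zero (by omega), MixedGraph.chromaticP_eq_sum_fVector,
    MixedGraph.chromaticP_eq_sum_hVector,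
    fun i => MixedGraph.isEffectiveCharacter_hVector hG hH,
    fun i => MixedGraph.isEffectiveCharacter_sum_choose_hVector hG hH, fun hχ => ?_⟩
  have hχ' : G.chromaticNumber ≤ G.minUndirected := by exact_mod_cast hχ
  refine ⟨fun i => MixedGraph.effLE_smul_fVector hG hH hχ', fun i h1 h2 => ?_, fun i h1 h2 => ?_⟩
  · have := MixedGraph.effLE_fVector (H := H) hG hH hχ' (a := i) (b := i + 1) h1 (by omega)
      (by omega)
    rwa [add_sub_cancel_right] at this
  -- The reflected index makes the bound on a + b an equality, so the only condition left is a ≤ b.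
  · have := MixedGraph.effLE_fVector (H := H) hG hH hχ' (a := i)
      (b := (Fintype.card V : ℤ) - 1 + G.chromaticNumber - i - 1) h1 (by omega) (by omega)
    rwa [show (Fintype.card V : ℤ) - 1 + G.chromaticNumber - i - 1 - 1
      = (Fintype.card V : ℤ) - 1 + G.chromaticNumber - i - 2 by ring] at this
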